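/- **Theorem (Existence).** Let $d\ge 1$, let $\Theta\subset\mathbb{R}^d$ be a bounded open set (for instance a bounded Lipschitz domain) and let $T>0$. Write $(\cdot,\cdot)$ for the inner product of $L^2(\Theta)$ and of $L^2(\Theta)^d$, let $H^1_0(\Theta)$ be the closure of $C_c^\infty(\Theta)$ in the $H^1$ norm, and let $\langle\cdot,\cdot\rangle$ be the duality pairing between $H^1_0(\Theta)^*$ and $H^1_0(\Theta)$. Assume: - (AS1) $\mu\in L^\infty(0,T)$ and $0\le\mu(t)\le\bar\mu<1$ for a.e. $t\in(0,T)$; - (AS2) $\rho,\beta\in L^\infty(\Theta\times(0,T))$; - (AS3) $Q\in C([0,T],L^2(\Theta))$; - (AS4) $f:\mathbb{R}\to\mathbb{R}$ is Lipschitz continuous; - (AS5) $\beta\ge\tilde\beta_0$ a.e. in $\Theta\times(0,T)$ for a constant $\tilde\beta_0>0$; - (AS6) the weak derivative $\partial_t\beta$ exists and lies in $L^\infty(\Theta\times(0,T))$; - (AS7) $\rho\ge0$ a.e. in $\Theta\times(0,T)$; - (AS8) $\tilde\Phi_0\in H^1_0(\Theta)$ and $\tilde\Psi_0\in L^2(\Theta)$.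 Then there is a weak solution $\Phi$ of $$\partial_t^2\Phi+\rho\,\partial_t^{\mu(t)}\Phi=\nabla\cdot(\beta\nabla\Phi)+f(\Phi)+Q\ \text{ in }\Theta\times(0,T),\qquad \Phi=0\ \text{ on }\partial\Theta\times(0,T),\qquad \Phi(0)=\tilde\Phi_0,\quad \partial_t\Phi(0)=\tilde\Psi_0,$$ where $\partial_t^{\mu(t)}\Phi(t)=\frac1{\Gamma(1-\mu(t))}\int_0^t (t-r)^{-\mu(t)}\,\partial_t\Phi(r)\,dr$, such that $$\Phi\in \mathrm{Lip}([0,T],L^2(\Theta))\cap L^\infty(0,T;H^1_0(\Theta)),\qquad \partial_t\Phi\in L^\infty(0,T;L^2(\Theta)),\qquad \partial_{tt}\Phi\in L^2(0,T;H^1_0(\Theta)^*).$$ Here a weak solution is a function $\Phi\in C([0,T],L^2(\Theta))\cap L^2(0,T;H^1_0(\Theta))$ with weak time derivatives $\partial_t\Phi\in L^2(0,T;L^2(\Theta))$ and $\partial_{tt}\Phi\in L^2(0,T;H^1_0(\Theta)^*)$, with $\Phi(0)=\tilde\Phi_0$ in $L^2(\Theta)$ and $\partial_t\Phi(0)=\tilde\Psi_0$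 for the representative of $\partial_t\Phi$ in $C([0,T],H^1_0(\Theta)^*)$, such that for every $\chi\in H^1_0(\Theta)$ and a.e. $t\in(0,T)$ $$\langle\partial_{tt}\Phi(t),\chi\rangle+\big(\rho(t)\,\partial_t^{\mu(t)}\Phi(t),\chi\big)+\big(\beta(t)\nabla\Phi(t),\nabla\chi\big)=\big(f(\Phi(t)),\chi\big)+\big(Q(t),\chi\big).$$ -/

import Mathlib

open MeasureTheory Set Filter Topology
open scoped ContDiff NNReal ENNReal

noncomputable section

namespace VOWave

/-- The space `ℝ^d` with its Euclidean norm. -/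
abbrev Space (d : ℕ) : Type := EuclideanSpace ℝ (Fin d)

/-- `L²(Θ)`. -/
abbrev L2 {d : ℕ} (Θ : Set (Space d)) : Type :=
  Lp ℝ 2 (volume.restrict Θ)

/-- `L²(Θ)^d`, the square integrable vector fields on `Θ`. -/
abbrev L2Vec {d : ℕ} (Θ : Set (Space d)) : Type :=
  Lp (Space d) 2 (volume.restrict Θ)

/-- `φ ∈ C_c^∞(O)`. -/
def IsTestFunction {E : Type*} [NormedAddCommGroup E] [NormedSpace ℝ E]
    (O : Set E) (φ : E → ℝ) : Prop :=
  ContDiff ℝ ∞ φ ∧ HasCompactSupport φ ∧ tsupport φ ⊆ O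

/-- The pairs `(φ, ∇φ)`, `φ ∈ C_c^∞(Θ)`, as a subspace of `L²(Θ) × L²(Θ)^d`. This product carries
the Hilbert norm `(‖u‖² + ‖G‖²)^{1/2}`, so that the norm of `(φ, ∇φ)` is the `H¹` norm of `φ`. -/
def testGraph {d : ℕ} (Θ : Set (Space d)) : Submodule ℝ (WithLp 2 (L2 Θ × L2Vec Θ)) where
  carrier := {p | ∃ φ : Space d → ℝ, IsTestFunction Θ φ ∧
    (p.fst : Space d → ℝ) =ᵐ[volume.restrict Θ] φ ∧
    (p.snd : Space d → Space d) =ᵐ[volume.restrict Θ] gradient φ}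
  zero_mem' := by
    refine ⟨0, ⟨contDiff_const, HasCompactSupport.zero, by simp [tsupport]⟩, ?_, ?_⟩
    · exact Lp.coeFn_zero _ _ _
    · refine (Lp.coeFn_zero _ _ _).trans (Eventually.of_forall fun x => ?_)
      have h : gradient (0 : Space d → ℝ) x = 0 := gradient_fun_const x (0 : ℝ)
      simp [h]
  add_mem' := by
    rintro p q ⟨φ, ⟨h1, h2, h3⟩, hp, hp'⟩ ⟨ψ, ⟨k1, k2, k3⟩, hq, hq'⟩
    refine ⟨φ + ψ, ⟨h1.add k1, h2.add k2,
      (tsupport_add φ ψ).trans (union_subset h3 k3)⟩, ?_, ?_⟩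
    · filter_upwards [Lp.coeFn_add p.fst q.fst, hp, hq] with x hx h h'
      simp only [WithLp.add_fst, hx, Pi.add_apply, h, h']
    · filter_upwards [Lp.coeFn_add p.snd q.snd, hp', hq'] with x hx h h'
      have e : gradient (φ + ψ) x = gradient φ x + gradient ψ x := by
        unfold gradient
        rw [fderiv_add (h1.differentiable (by simp) x) (k1.differentiable (by simp) x), map_add]
      simp only [WithLp.add_snd, hx, Pi.add_apply, h, h', e]
  smul_mem' := by
    rintro c p ⟨φ, ⟨h1, h2, h3⟩, hp, hp'⟩
    refine ⟨fun x => c * φ x, ⟨contDiff_const.mul h1, h2.mul_left,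
      (tsupport_mul_subset_right (f := fun _ => c) (g := φ)).trans h3⟩, ?_, ?_⟩
    · filter_upwards [Lp.coeFn_smul c p.fst, hp] with x hx h
      simp only [WithLp.smul_fst, hx, Pi.smul_apply, h, smul_eq_mul]
    · filter_upwards [Lp.coeFn_smul c p.snd, hp'] with x hx h
      have e : gradient (fun x => c * φ x) x = c • gradient φ x := by
        unfold gradient
        rw [fderiv_const_mul (h1.differentiable (by simp) x), map_smulₛₗ]
        simp
      simp only [WithLp.smul_snd, hx, Pi.smul_apply, h, e]

/-- `H¹₀(Θ)`, the closure of `C_c^∞(Θ)` in the `H¹` norm: an element is the pair `(u, ∇u)` of a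
function and its weak gradient, a limit in `L²(Θ) × L²(Θ)^d` of pairs `(φ, ∇φ)`. -/
abbrev H10 {d : ℕ} (Θ : Set (Space d)) : Type :=
  (testGraph Θ).topologicalClosure

/-- The embedding `H¹₀(Θ) → L²(Θ)`. -/
def toL2 {d : ℕ} {Θ : Set (Space d)} : H10 Θ →L[ℝ] L2 Θ :=
  (WithLp.fstL 2 ℝ (L2 Θ) (L2Vec Θ)).comp (testGraph Θ).topologicalClosure.subtypeL

/-- The weak gradient `∇ : H¹₀(Θ) → L²(Θ)^d`. -/
def grad {d : ℕ} {Θ : Set (Space d)} : H10 Θ →L[ℝ] L2Vec Θ :=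
  (WithLp.sndL 2 ℝ (L2 Θ) (L2Vec Θ)).comp (testGraph Θ).topologicalClosure.subtypeL

/-- `H¹₀(Θ)*`, the dual space of `H¹₀(Θ)` with the operator norm. -/
abbrev H10Dual {d : ℕ} (Θ : Set (Space d)) : Type :=
  StrongDual ℝ (H10 Θ)

/-- The embedding `L²(Θ) → H¹₀(Θ)*`, `w ↦ (χ ↦ (w, χ)_{L²(Θ)})`. -/
def toDual {d : ℕ} {Θ : Set (Space d)} (w : L2 Θ) : H10Dual Θ :=
  (innerSL ℝ w).comp toL2

/-- `v` is the weak derivative of the vector-valued function `u` on `(0,T)`: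
`∫₀ᵀ φ' u dt = -∫₀ᵀ φ v dt` for all `φ ∈ C_c^∞(0,T)`. -/
def IsWeakTimeDeriv {Y : Type*} [NormedAddCommGroup Y] [NormedSpace ℝ Y] (T : ℝ)
    (u v : ℝ → Y) : Prop :=
  IntegrableOn u (Ioo 0 T) ∧ IntegrableOn v (Ioo 0 T) ∧
    ∀ φ : ℝ → ℝ, IsTestFunction (Ioo 0 T) φ →
      ∫ t in Ioo 0 T, deriv φ t • u t = -∫ t in Ioo 0 T, φ t • v t

/-- `b` is the weak partial derivative `∂ₜβ` on `Θ × (0,T)`: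
`∫∫ β ∂ₜφ dx dt = -∫∫ b φ dx dt` for all `φ ∈ C_c^∞(Θ × (0,T))`. -/
def IsWeakPartialTime {d : ℕ} (Θ : Set (Space d)) (T : ℝ) (β b : Space d × ℝ → ℝ) : Prop :=
  ∀ φ : Space d × ℝ → ℝ, IsTestFunction (Θ ×ˢ Ioo 0 T) φ →
    ∫ p in Θ ×ˢ Ioo 0 T, β p * fderiv ℝ φ p (0, 1) = -∫ p in Θ ×ˢ Ioo 0 T, b p * φ p

/-- `g ∈ L^∞(Θ × (0,T))`. -/
def IsBddCoeff {d : ℕ} (Θ : Set (Space d)) (T : ℝ) (g : Space d × ℝ → ℝ) : Prop :=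
  MemLp g ∞ (volume.restrict (Θ ×ˢ Ioo 0 T))

/-- The variable-order Caputo derivative, in terms of the first time derivative `v` of the function:
`Γ(1 - μ(t))⁻¹ ∫₀ᵗ (t - r)^{-μ(t)} v(r) dr`. -/
def caputo {Y : Type*} [NormedAddCommGroup Y] [NormedSpace ℝ Y] (μ : ℝ → ℝ) (v : ℝ → Y)
    (t : ℝ) : Y :=
  (Real.Gamma (1 - μ t))⁻¹ • ∫ r in (0 : ℝ)..t, (t - r) ^ (-μ t) • v r

/-- Weak solutions on `(0,T)` of the initial-boundary value problem
`∂ₜₜΦ + ρ ∂ₜ^{μ(t)} Φ = ∇·(β ∇Φ) + f(Φ) + Q` in `Θ`, `Φ = 0` on `∂Θ`, `Φ(0) = Φ₀`, `∂ₜΦ(0) = Ψ₀`.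
Here `Φ` is the solution as a curve in `L²(Θ)`, `U` is the same function as a curve in `H¹₀(Θ)`,
`Φt` is its first and `Φtt` its second weak time derivative. -/
structure IsWeakSolution {d : ℕ} (Θ : Set (Space d)) (T : ℝ) (μ : ℝ → ℝ)
    (ρ β : Space d × ℝ → ℝ) (f : ℝ → ℝ) (Q : ℝ → L2 Θ) (Φ₀ : H10 Θ) (Ψ₀ : L2 Θ)
    (Φ : ℝ → L2 Θ) (U : ℝ → H10 Θ) (Φt : ℝ → L2 Θ) (Φtt : ℝ → H10Dual Θ) : Prop where
  /-- `Φ ∈ C([0,T], L²(Θ))` -/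
  continuousOn : ContinuousOn Φ (Icc 0 T)
  /-- `Φ(t) ∈ H¹₀(Θ)` for almost all `t` -/
  toL2_eq : ∀ᵐ t ∂volume.restrict (Ioo 0 T), toL2 (U t) = Φ t
  /-- `Φ ∈ L²(0,T; H¹₀(Θ))` -/
  memLp : MemLp U 2 (volume.restrict (Ioo 0 T))
  /-- `∂ₜΦ ∈ L²(0,T; L²(Θ))` -/
  memLp_deriv : MemLp Φt 2 (volume.restrict (Ioo 0 T))
  isDeriv : IsWeakTimeDeriv T Φ Φt
  /-- `∂ₜₜΦ ∈ L²(0,T; H¹₀(Θ)*)` -/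
  memLp_deriv2 : MemLp Φtt 2 (volume.restrict (Ioo 0 T))
  isDeriv2 : IsWeakTimeDeriv T (fun t => toDual (Φt t)) Φtt
  /-- `Φ(0) = Φ₀` -/
  init : Φ 0 = toL2 Φ₀
  /-- `∂ₜΦ(0) = Ψ₀`, for the representative of `∂ₜΦ` in `C([0,T], H¹₀(Θ)*)` -/
  init_deriv : ∃ W : ℝ → H10Dual Θ, ContinuousOn W (Icc 0 T) ∧
    (∀ᵐ t ∂volume.restrict (Ioo 0 T), W t = toDual (Φt t)) ∧ W 0 = toDual Ψ₀
  /-- the integral that defines the Caputo derivative converges in `L²(Θ)` for almost all `t` -/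
  integrable_caputo : ∀ᵐ t ∂volume.restrict (Ioo 0 T),
    IntervalIntegrable (fun r => (t - r) ^ (-μ t) • Φt r) volume 0 t
  /-- the weak formulation of the equation -/
  equation : ∀ χ : H10 Θ, ∀ᵐ t ∂volume.restrict (Ioo 0 T),
    Φtt t χ
      + (∫ x in Θ, ρ (x, t) * caputo μ Φt t x * toL2 χ x)
      + (∫ x in Θ, β (x, t) * inner ℝ (grad (U t) x) (grad χ x))
    = (∫ x in Θ, f (Φ t x) * toL2 χ x) + ∫ x in Θ, Q t x * toL2 χ x

end VOWave

end

/-! Write the problem as `u'' + A(t) u = g` in `V*`, with `V = H¹₀(Θ)`, `H = L²(Θ)` and `j : V → H`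
the embedding. The operator `A(t)` represents the form with coefficient `β` plus the shift `β₀ (u,
χ)`, which makes it coercive in the full `H¹` norm. The shift is returned to the right-hand side,
next to `f(Φ)`, `Q` and the memory term. Since `∂ₜβ` is bounded, `A` agrees almost everywhere with a
family Lipschitz in time (`exists_waveForm`).

For a given source `g`, the mass operator `j*j` is replaced by `j*j + ε`, which is invertible on
`V`. The problem becomes a linear ordinary differential equation in `V`, a Volterra equation for
`u''` (`exists_regSol`). Testing with `u'` and applying Gronwall bounds `j u'` in `H` and `u` in
`V`, uniformly in `ε` (`IsRegSol.energy_le`). Weak limits as `ε → 0` are taken along one fixed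
ultrafilter. Hence the limit velocities `Sv g` satisfy `‖Sv g₁ - Sv g₂‖²(t) ≤ K ∫₀ᵗ ‖g₁ - g₂‖²`,
with no uniqueness theorem needed (`exists_linear_solution_operator`).

All remaining terms form a causal Lipschitz map `N` of the velocity: `Φ` is a primitive of `v`, `f`
acts Lipschitz continuously on `L²`, and the kernel `(t - r)^{-μ(t)}` has uniformly bounded mass
because `μ ≤ μbar < 1`. So `g ↦ N (Sv g)` is again a Volterra map, and its fixed point gives the
solution (`exists_isLinSol_nonlinear`). No compactness is needed for the nonlinearity, because weak
limits occur only in the linear problem. -/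

namespace VOWave

/-! ### Integration by parts for primitives of integrable functions. -/

section Primitive

variable {E F G : Type*} [NormedAddCommGroup E] [NormedSpace ℝ E] [CompleteSpace E]
  [NormedAddCommGroup F] [NormedSpace ℝ F] [CompleteSpace F]
  [NormedAddCommGroup G] [NormedSpace ℝ G] [CompleteSpace G]

/-- Fubini's theorem on the triangle `0 < s ≤ r ≤ t` for a bilinear pairing. -/
theorem integral_bilin_primitive (B : E →L[ℝ] F →L[ℝ] G) {x : ℝ → E} {y : ℝ → F} {t : ℝ}
    (ht : 0 ≤ t) (hx : IntervalIntegrable x volume 0 t) (hy : IntervalIntegrable y volume 0 t) :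
    ∫ r in (0 : ℝ)..t, B (x r) (∫ s in (0 : ℝ)..r, y s)
      = ∫ s in (0 : ℝ)..t, B (∫ r in s..t, x r) (y s) := by
  rw [intervalIntegrable_iff_integrableOn_Ioc_of_le ht] at hx hy
  rw [intervalIntegral.integral_of_le ht, intervalIntegral.integral_of_le ht]
  have hint : Integrable (fun p : ℝ × ℝ => B (x p.1) (y p.2))
      ((volume.restrict (Ioc 0 t)).prod (volume.restrict (Ioc 0 t))) :=
    Integrable.op_fst_snd (op := fun a b => B a b) (by fun_prop)
      ⟨‖B‖, fun a b => B.le_opNorm₂ a b⟩ hx hy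
  have hS : MeasurableSet {p : ℝ × ℝ | p.2 ≤ p.1} := measurableSet_le measurable_snd measurable_fst
  have hswap := integral_integral_swap
    (f := fun r s => {p : ℝ × ℝ | p.2 ≤ p.1}.indicator (fun p => B (x p.1) (y p.2)) (r, s))
    (hint.indicator hS)
  calc _ = ∫ r in Ioc 0 t, ∫ s in Ioc 0 t,
        {p : ℝ × ℝ | p.2 ≤ p.1}.indicator (fun p => B (x p.1) (y p.2)) (r, s) := by
        refine setIntegral_congr_fun measurableSet_Ioc fun r hr => ?_
        have e : ∀ s, {p : ℝ × ℝ | p.2 ≤ p.1}.indicator (fun p => B (x p.1) (y p.2)) (r, s)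
            = (Iic r).indicator (fun s => B (x r) (y s)) s := fun s => by
          simp [indicator_apply]
        simp only [e]
        rw [setIntegral_indicator measurableSet_Iic, Ioc_inter_Iic, min_eq_right hr.2,
          intervalIntegral.integral_of_le hr.1.le]
        exact ((B (x r)).integral_comp_comm (hy.mono_set (Ioc_subset_Ioc_right hr.2))).symm
    _ = _ := hswap
    _ = _ := by
        refine setIntegral_congr_fun measurableSet_Ioc fun s hs => ?_
        have e : ∀ r, {p : ℝ × ℝ | p.2 ≤ p.1}.indicator (fun p => B (x p.1) (y p.2)) (r, s)
            = (Ici s).indicator (fun r => B.flip (y s) (x r)) r := fun r => by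
          simp [indicator_apply]
        simp only [e]
        have e2 : Ioc 0 t ∩ Ici s = Icc s t := by
          ext r; constructor
          · rintro ⟨h1, h2⟩; exact ⟨h2, h1.2⟩
          · rintro ⟨h1, h2⟩; exact ⟨⟨hs.1.trans_le h1, h2⟩, h1⟩
        rw [setIntegral_indicator measurableSet_Ici, e2, integral_Icc_eq_integral_Ioc,
          intervalIntegral.integral_of_le hs.2]
        exact (B.flip (y s)).integral_comp_comm (hx.mono_set (Ioc_subset_Ioc_left hs.1.le))

theorem continuousOn_primitive_zero {X : Type*} [NormedAddCommGroup X] [NormedSpace ℝ X]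
    {T : ℝ} (hT : 0 ≤ T) {w : ℝ → X}
    (hw : IntervalIntegrable w volume 0 T) :
    ContinuousOn (fun t => ∫ s in (0 : ℝ)..t, w s) (Icc 0 T) := by
  have := intervalIntegral.continuousOn_primitive_interval' hw left_mem_uIcc
  rwa [uIcc_of_le hT] at this

/-- Chain rule, in integrated form, for a quadratic form along an absolutely continuous curve. -/
theorem bilin_primitive_self (B : E →L[ℝ] E →L[ℝ] ℝ) (hB : ∀ x y, B x y = B y x)
    {w : ℝ → E} {p : E} {t : ℝ} (ht : 0 ≤ t) (hw : IntervalIntegrable w volume 0 t) :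
    B (p + ∫ s in (0 : ℝ)..t, w s) (p + ∫ s in (0 : ℝ)..t, w s)
      = B p p + 2 * ∫ s in (0 : ℝ)..t, B (w s) (p + ∫ r in (0 : ℝ)..s, w r) := by
  have hmeas : ContinuousOn (fun t => ∫ s in (0 : ℝ)..t, w s) (uIcc 0 t) := by
    rw [uIcc_of_le ht]; exact continuousOn_primitive_zero ht hw
  have bound : ∀ c : ℝ → E, ContinuousOn c (uIcc 0 t) →
      IntervalIntegrable (fun s => B (w s) (c s)) volume 0 t := by
    intro c hc
    obtain ⟨C, hC⟩ := isCompact_uIcc.exists_bound_of_continuousOn hc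
    rw [intervalIntegrable_iff] at hw ⊢
    refine Integrable.mono' (hw.norm.const_mul (‖B‖ * C)) ?_ ?_
    · exact B.aestronglyMeasurable_comp₂ hw.aestronglyMeasurable
        ((hc.mono uIoc_subset_uIcc).aestronglyMeasurable measurableSet_uIoc)
    · filter_upwards [ae_restrict_mem measurableSet_uIoc] with s hs
      calc _ ≤ ‖B‖ * ‖w s‖ * ‖c s‖ := B.le_opNorm₂ _ _
        _ ≤ ‖B‖ * ‖w s‖ * C := by gcongr; exact hC s (uIoc_subset_uIcc hs)
        _ = _ := by ring
  have h1 : ∫ s in (0 : ℝ)..t, B (w s) p = B (∫ s in (0 : ℝ)..t, w s) p :=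
    (B.flip p).intervalIntegral_comp_comm hw
  have h2 : ∫ s in (0 : ℝ)..t, B (w s) (∫ r in (0 : ℝ)..t, w r)
      = B (∫ s in (0 : ℝ)..t, w s) (∫ s in (0 : ℝ)..t, w s) :=
    (B.flip (∫ r in (0 : ℝ)..t, w r)).intervalIntegral_comp_comm hw
  -- With `W` the primitive of `w`, Fubini and symmetry turn `∫ B(w, W(t) - W(s))` into `∫ B(w,
  -- W(s))`, so `B(W(t), W(t))` is twice the latter. No derivative of `W` is needed.
  have h3 := integral_bilin_primitive B ht hw hw
  have h4 : ∫ s in (0 : ℝ)..t, B (w s) (∫ r in s..t, w r)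
      = (∫ s in (0 : ℝ)..t, B (w s) (∫ r in (0 : ℝ)..t, w r))
        - ∫ s in (0 : ℝ)..t, B (w s) (∫ r in (0 : ℝ)..s, w r) := by
    rw [← intervalIntegral.integral_sub (bound _ continuousOn_const) (bound _ hmeas)]
    refine intervalIntegral.integral_congr fun s hs => ?_
    rw [uIcc_of_le ht] at hs
    rw [← map_sub, intervalIntegral.integral_interval_sub_left hw]
    exact hw.mono_set (by rw [uIcc_of_le ht, uIcc_of_le hs.1]; exact Icc_subset_Icc_right hs.2)
  have h5 : ∫ s in (0 : ℝ)..t, B (w s) (p + ∫ r in (0 : ℝ)..s, w r)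
      = (∫ s in (0 : ℝ)..t, B (w s) p) + ∫ s in (0 : ℝ)..t, B (w s) (∫ r in (0 : ℝ)..s, w r) := by
    rw [← intervalIntegral.integral_add (bound _ continuousOn_const) (bound _ hmeas)]
    simp only [map_add]
  have h6 : ∫ s in (0 : ℝ)..t, B (∫ r in s..t, w r) (w s)
      = ∫ s in (0 : ℝ)..t, B (w s) (∫ r in s..t, w r) := by simp only [hB]
  rw [h5, h1]
  have : B (p + ∫ s in (0 : ℝ)..t, w s) (p + ∫ s in (0 : ℝ)..t, w s)
      = B p p + 2 * B (∫ s in (0 : ℝ)..t, w s) p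
        + B (∫ s in (0 : ℝ)..t, w s) (∫ s in (0 : ℝ)..t, w s) := by
    simp only [map_add, add_apply]
    rw [hB p (∫ s in (0 : ℝ)..t, w s)]; ring
  rw [this]; linarith

/-- Integration by parts against a smooth scalar function. -/
theorem integral_deriv_smul_primitive {T : ℝ} (hT : 0 ≤ T) {φ : ℝ → ℝ} (hφ : ContDiff ℝ 1 φ)
    (hφ0 : φ 0 = 0) (hφT : φ T = 0) {w : ℝ → E} (w₀ : E) (hw : IntervalIntegrable w volume 0 T) :
    ∫ t in (0 : ℝ)..T, deriv φ t • (w₀ + ∫ s in (0 : ℝ)..t, w s)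
      = -∫ t in (0 : ℝ)..T, φ t • w t := by
  have hc : Continuous (deriv φ) := hφ.continuous_deriv le_rfl
  have hd : ∀ a b, ∫ r in a..b, deriv φ r = φ b - φ a := fun a b =>
    intervalIntegral.integral_deriv_eq_sub (fun x _ => hφ.differentiable one_ne_zero x)
      (hc.intervalIntegrable _ _)
  have h := integral_bilin_primitive (ContinuousLinearMap.lsmul ℝ ℝ (E := E)) hT
    (hc.intervalIntegrable 0 T) hw
  simp only [ContinuousLinearMap.lsmul_apply, hd, hφT, zero_sub] at h
  simp only [smul_add]
  rw [intervalIntegral.integral_add (f := fun t => deriv φ t • w₀)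
    ((hc.smul continuous_const).intervalIntegrable _ _), h,
    intervalIntegral.integral_smul_const, hd, hφ0, hφT]
  · simp [intervalIntegral.integral_neg]
  · refine ContinuousOn.intervalIntegrable ?_
    rw [uIcc_of_le hT]
    exact hc.continuousOn.smul (continuousOn_primitive_zero hT hw)

end Primitive

/-! ### Measurability in separable Hilbert spaces, Gronwall, and the energy inequality. -/

/-- An orthonormal family in a separable space is countable. -/
theorem _root_.Orthonormal.countable_index {ι X : Type*} [NormedAddCommGroup X]
    [InnerProductSpace ℝ X] [TopologicalSpace.SeparableSpace X] {b : ι → X}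
    (hb : Orthonormal ℝ b) : Countable ι := by
  -- Distinct members are at distance `√2`, so these balls are disjoint.
  refine Pairwise.countable_of_isOpen_disjoint (s := fun i => Metric.ball (b i) (1 / 2)) ?_
    (fun i => Metric.isOpen_ball) (fun i => ⟨b i, Metric.mem_ball_self (by norm_num)⟩)
  intro i k hik
  refine Metric.ball_disjoint_ball ?_
  have h : ‖b i - b k‖ ^ 2 = 2 := by
    rw [norm_sub_sq_real, hb.1 i, hb.1 k, hb.2 hik]; norm_num
  rw [dist_eq_norm]
  nlinarith [norm_nonneg (b i - b k)]

/-- Pettis' theorem in a separable Hilbert space. -/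
theorem aestronglyMeasurable_of_inner {α X : Type*} [MeasurableSpace α] {ν : Measure α}
    [NormedAddCommGroup X] [InnerProductSpace ℝ X] [CompleteSpace X]
    [TopologicalSpace.SeparableSpace X] {g : α → X}
    (hg : ∀ z, AEStronglyMeasurable (fun t => inner ℝ z (g t)) ν) : AEStronglyMeasurable g ν := by
  obtain ⟨w, b, -⟩ := exists_hilbertBasis ℝ X
  -- Countability makes `atTop` on finite subsets countably generated, as limits of measurable
  -- functions require.
  have hc : Countable w := b.orthonormal.countable_index
  refine aestronglyMeasurable_of_tendsto_ae (u := (atTop : Filter (Finset w)))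
    (f := fun s t => ∑ i ∈ s, inner ℝ (b i) (g t) • b i) (fun s => ?_) ?_
  · exact Finset.aestronglyMeasurable_fun_sum _ fun i _ => (hg (b i)).smul_const (b i)
  · refine Eventually.of_forall fun t => ?_
    have := b.hasSum_repr (g t)
    simp only [b.repr_apply_apply] at this
    exact this

/-- Gronwall's inequality in integrated form. -/
theorem le_mul_exp_of_le_add_integral {E : ℝ → ℝ} {a C t : ℝ} (ht : 0 ≤ t) (hC : 0 < C)
    (hE : ContinuousOn E (Icc 0 t)) (h : ∀ s ∈ Icc 0 t, E s ≤ a + C * ∫ r in (0 : ℝ)..s, E r) :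
    E t ≤ a * Real.exp (C * t) := by
  have hE' : Continuous (IccExtend ht (Set.domRestrict (Icc 0 t) E)) :=
    (continuousOn_iff_continuous_domRestrict.1 hE).Icc_extend'
  set e := IccExtend ht (Set.domRestrict (Icc 0 t) E) with he
  have hee : ∀ s ∈ Icc 0 t, e s = E s := fun s hs => IccExtend_of_mem ht _ hs
  have hint : ∀ s ∈ Icc 0 t, ∫ r in (0 : ℝ)..s, E r = ∫ r in (0 : ℝ)..s, e r := fun s hs =>
    intervalIntegral.integral_congr fun r hr => by
      rw [uIcc_of_le hs.1] at hr
      exact (hee r ⟨hr.1, hr.2.trans hs.2⟩).symm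
  have hder : ∀ s, HasDerivAt (fun s => ∫ r in (0 : ℝ)..s, e r) (e s) s := fun s =>
    intervalIntegral.integral_hasDerivAt_right (hE'.intervalIntegrable _ _)
      (hE'.stronglyMeasurableAtFilter _ _) hE'.continuousAt
  -- The primitive `P` of `E` satisfies `P' ≤ C P + a` and `P(0) = 0`; its bound is then inserted
  -- into the hypothesis at `t`.
  have key := le_gronwallBound_of_liminf_deriv_right_le (f := fun s => ∫ r in (0 : ℝ)..s, e r)
    (f' := e) (δ := 0) (K := C) (ε := a) (a := 0) (b := t)
    (fun s _ => (hder s).continuousAt.continuousWithinAt)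
    (fun s _ r hr => by
      have := (hder s).hasDerivWithinAt (s := Ici s) |>.liminf_right_slope_le hr
      simpa [slope_def_field, div_eq_inv_mul] using this)
    (by simp) (fun s hs => by
      have h1 := h s ⟨hs.1, hs.2.le⟩
      rw [hint s ⟨hs.1, hs.2.le⟩, ← hee s ⟨hs.1, hs.2.le⟩] at h1
      linarith) t ⟨ht, le_rfl⟩
  have h1 := h t ⟨ht, le_rfl⟩
  rw [hint t ⟨ht, le_rfl⟩] at h1
  rw [gronwallBound_of_K_ne_0 hC.ne'] at key
  simp only [zero_mul, zero_add, sub_zero] at key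
  calc E t ≤ a + C * (a / C * (Real.exp (C * t) - 1)) := h1.trans (by gcongr)
    _ = _ := by field_simp; ring

/-- The energy inequality for a Lipschitz continuous family of quadratic forms. -/
theorem quadratic_le_of_lipschitz {V : Type*} [NormedAddCommGroup V] [InnerProductSpace ℝ V]
    [CompleteSpace V] {A : ℝ → V →L[ℝ] V} {M : ℝ} (hM : 0 ≤ M)
    (hA : ∀ s t, ‖A s - A t‖ ≤ M * |s - t|)
    (hsym : ∀ t x y, inner ℝ (A t x) y = inner ℝ x (A t y)) {T : ℝ} (hT : 0 ≤ T) {y : ℝ → V}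
    (hy : ContinuousOn y (Icc 0 T)) (p : V) :
    inner ℝ (A T (p + ∫ s in (0 : ℝ)..T, y s)) (p + ∫ s in (0 : ℝ)..T, y s) ≤ inner ℝ (A 0 p) p
      + ∫ t in (0 : ℝ)..T, (2 * inner ℝ (A t (p + ∫ s in (0 : ℝ)..t, y s)) (y t)
          + M * ‖p + ∫ s in (0 : ℝ)..t, y s‖ ^ 2) := by
  wlog hyc : Continuous y generalizing y
  · have hY : Continuous (IccExtend hT (Set.domRestrict (Icc 0 T) y)) :=
      (continuousOn_iff_continuous_domRestrict.1 hy).Icc_extend'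
    set Y := IccExtend hT (Set.domRestrict (Icc 0 T) y)
    have hYy : ∀ s ∈ Icc 0 T, Y s = y s := fun s hs => IccExtend_of_mem hT _ hs
    have hint : ∀ s ∈ Icc 0 T, ∫ r in (0 : ℝ)..s, y r = ∫ r in (0 : ℝ)..s, Y r := fun s hs =>
      intervalIntegral.integral_congr fun r hr => by
        rw [uIcc_of_le hs.1] at hr
        exact (hYy r ⟨hr.1, hr.2.trans hs.2⟩).symm
    have := this hY.continuousOn hY
    rw [← hint T ⟨hT, le_rfl⟩] at this
    refine this.trans_eq ?_
    congr 1
    refine intervalIntegral.integral_congr fun t ht => ?_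
    rw [uIcc_of_le hT] at ht
    simp only [hint t ht, hYy t ht]
  have hAc : Continuous A := by
    refine (LipschitzWith.of_dist_le_mul (K := ⟨M, hM⟩) fun s t => ?_).continuous
    rw [dist_eq_norm, Real.dist_eq]; exact hA s t
  set u : ℝ → V := fun t => p + ∫ s in (0 : ℝ)..t, y s with hu
  have hud : ∀ t, HasDerivAt u (y t) t := fun t =>
    (intervalIntegral.integral_hasDerivAt_right (hyc.intervalIntegrable _ _)
      (hyc.stronglyMeasurableAtFilter _ _) hyc.continuousAt).const_add p
  have huc : Continuous u := continuous_iff_continuousAt.2 fun t => (hud t).continuousAt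
  set D : ℝ → ℝ := fun t => 2 * inner ℝ (A t (u t)) (y t) + M * ‖u t‖ ^ 2 with hD
  have hDc : Continuous D := by fun_prop
  have hBd : ∀ t, HasDerivAt (fun t => inner ℝ (A 0 p) p + ∫ s in (0 : ℝ)..t, D s) (D t) t :=
    fun t => (intervalIntegral.integral_hasDerivAt_right (hDc.intervalIntegrable _ _)
      (hDc.stronglyMeasurableAtFilter _ _) hDc.continuousAt).const_add _
  -- A Lipschitz `A` need not be differentiable, so difference quotients from the right are
  -- compared. They split into the quotient of the form frozen at `x` and the increment `A z - A x`,
  -- which contributes at most `M ‖u z‖²`.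
  refine image_le_of_liminf_slope_right_le_deriv_boundary (a := 0) (b := T)
    (f := fun t => inner ℝ (A t (u t)) (u t))
    (B := fun t => inner ℝ (A 0 p) p + ∫ s in (0 : ℝ)..t, D s) (B' := D)
    (by fun_prop) (by simp [hu]) (fun t _ => (hBd t).continuousAt.continuousWithinAt)
    (fun t _ => (hBd t).hasDerivWithinAt) ?_ ⟨hT, le_rfl⟩
  intro x _ r hr
  refine Eventually.frequently ?_
  have hq : HasDerivAt (fun z => inner ℝ (A x (u z)) (u z)) (2 * inner ℝ (A x (u x)) (y x)) x := by
    have := ((A x).hasFDerivAt.comp_hasDerivAt x (hud x)).inner ℝ (hud x)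
    have e : inner ℝ (A x (u x)) (y x) + inner ℝ (A x (y x)) (u x)
        = 2 * inner ℝ (A x (u x)) (y x) := by
      rw [hsym x (y x) (u x), real_inner_comm (A x (u x)) (y x)]; ring
    rw [← e]
    exact this
  have hlim : Tendsto (fun z => M * ‖u z‖ ^ 2
      + slope (fun z => inner ℝ (A x (u z)) (u z)) x z) (𝓝[>] x) (𝓝 (D x)) := by
    have h1 : Tendsto (fun z => M * ‖u z‖ ^ 2) (𝓝[>] x) (𝓝 (M * ‖u x‖ ^ 2)) :=
      ((by fun_prop : Continuous fun z => M * ‖u z‖ ^ 2).tendsto x).mono_left nhdsWithin_le_nhds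
    have h2 := (hasDerivAt_iff_tendsto_slope.1 hq).mono_left
      (nhdsWithin_mono x (fun z (hz : x < z) => hz.ne' : Ioi x ⊆ {x}ᶜ))
    have := h1.add h2
    rwa [add_comm (M * ‖u x‖ ^ 2)] at this
  filter_upwards [hlim.eventually (gt_mem_nhds hr), self_mem_nhdsWithin] with z hz hxz
  refine lt_of_le_of_lt ?_ hz
  have hxz' : 0 < z - x := sub_pos.2 hxz
  simp only [slope_def_field]
  rw [← sub_le_iff_le_add, ← sub_div, div_le_iff₀ hxz']
  have e : inner ℝ (A z (u z)) (u z) - inner ℝ (A x (u x)) (u x)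
      - (inner ℝ (A x (u z)) (u z) - inner ℝ (A x (u x)) (u x))
      = inner ℝ ((A z - A x) (u z)) (u z) := by
    rw [sub_apply, inner_sub_left]; ring
  rw [e]
  calc inner ℝ ((A z - A x) (u z)) (u z) ≤ ‖(A z - A x) (u z)‖ * ‖u z‖ := real_inner_le_norm _ _
    _ ≤ (M * |z - x| * ‖u z‖) * ‖u z‖ := by
      gcongr; exact (A z - A x).le_of_opNorm_le (hA z x) _
    _ = M * ‖u z‖ ^ 2 * (z - x) := by rw [abs_of_pos hxz']; ring

/-! ### Weak limits along ultrafilters. -/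

section WeakLimit

variable {X : Type*} [NormedAddCommGroup X] [InnerProductSpace ℝ X]

/-- A bounded sequence in a Hilbert space has a weak limit along every ultrafilter. -/
theorem exists_weak_ultralimit [CompleteSpace X] (𝒰 : Ultrafilter ℕ) {x : ℕ → X}
    {C : ℝ} (hx : ∀ n, ‖x n‖ ≤ C) :
    ∃ y : X, ∀ z, Tendsto (fun n => inner ℝ z (x n)) 𝒰 (𝓝 (inner ℝ z y)) := by
  have h : ∀ z, ∃ l : ℝ, |l| ≤ C * ‖z‖ ∧ Tendsto (fun n => inner ℝ z (x n)) 𝒰 (𝓝 l) := by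
    intro z
    have hmem : ∀ n, inner ℝ z (x n) ∈ Icc (-(C * ‖z‖)) (C * ‖z‖) := fun n => by
      refine abs_le.1 ?_
      calc |inner ℝ z (x n)| ≤ ‖z‖ * ‖x n‖ := abs_real_inner_le_norm _ _
        _ ≤ ‖z‖ * C := by gcongr; exact hx n
        _ = _ := mul_comm _ _
    obtain ⟨l, hl, hlim⟩ := isCompact_Icc.ultrafilter_le_nhds
      (𝒰.map fun n => inner ℝ z (x n))
      (le_principal_iff.2 (Filter.mem_map.2 (univ_mem' hmem)))
    exact ⟨l, abs_le.2 hl, hlim⟩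
  choose l hlb hl using h
  -- Along a single ultrafilter the scalar limits depend linearly on `z`; Riesz representation then
  -- supplies the weak limit.
  let L : X →ₗ[ℝ] ℝ :=
    { toFun := l
      map_add' := fun a b => tendsto_nhds_unique (hl (a + b)) (by
        simpa only [inner_add_left] using (hl a).add (hl b))
      map_smul' := fun c a => tendsto_nhds_unique (hl (c • a)) (by
        simpa only [real_inner_smul_left, RingHom.id_apply, smul_eq_mul] using (hl a).const_mul c) }
  refine ⟨(InnerProductSpace.toDual ℝ X).symm (L.mkContinuous C hlb), fun z => ?_⟩
  rw [real_inner_comm, InnerProductSpace.toDual_symm_apply]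
  exact hl z

variable {α : Type*} [MeasurableSpace α] {ν : Measure α}

/-- Weak convergence in `L²(ν; X)` along the filter `𝒰`, for functions. -/
def WeakLim (𝒰 : Filter ℕ) (ν : Measure α) (x : ℕ → α → X) (y : α → X) : Prop :=
  ∀ z : α → X, MemLp z 2 ν →
    Tendsto (fun n => ∫ t, inner ℝ (z t) (x n t) ∂ν) 𝒰 (𝓝 (∫ t, inner ℝ (z t) (y t) ∂ν))

theorem exists_weakLim [CompleteSpace X] (𝒰 : Ultrafilter ℕ) {x : ℕ → α → X}
    (hx : ∀ n, MemLp (x n) 2 ν) {C : ℝ}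
    (hC : ∀ n, ∫ t, ‖x n t‖ ^ 2 ∂ν ≤ C) : ∃ y, MemLp y 2 ν ∧ WeakLim 𝒰 ν x y := by
  obtain ⟨y, hy⟩ := exists_weak_ultralimit 𝒰 (x := fun n => (hx n).toLp) (C := Real.sqrt C)
    (fun n => by
      refine Real.le_sqrt_of_sq_le ?_
      rw [← real_inner_self_eq_norm_sq, L2.inner_def]
      refine le_trans (le_of_eq ?_) (hC n)
      refine integral_congr_ae ?_
      filter_upwards [(hx n).coeFn_toLp] with t ht
      rw [ht, real_inner_self_eq_norm_sq])
  refine ⟨y, Lp.memLp y, fun z hz => ?_⟩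
  have e : ∀ w : Lp X 2 ν, inner ℝ hz.toLp w = ∫ t, inner ℝ (z t) (w t) ∂ν := fun w => by
    rw [L2.inner_def]
    refine integral_congr_ae ?_
    filter_upwards [hz.coeFn_toLp] with t ht
    rw [ht]
  have h := hy hz.toLp
  simp only [e] at h
  refine h.congr fun n => integral_congr_ae ?_
  filter_upwards [(hx n).coeFn_toLp] with t ht
  rw [ht]

theorem integrable_inner_of_memLp {f g : α → X} (hf : MemLp f 2 ν) (hg : MemLp g 2 ν) :
    Integrable (fun t => inner ℝ (f t) (g t)) ν := by
  have := (innerSL ℝ (E := X)).memLp_of_bilin (r := 1) hf hg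
  exact memLp_one_iff_integrable.1 this

/-- The difference of the two limits is itself an admissible test function, and testing with it
shows that its norm vanishes. -/
theorem WeakLim.unique {𝒰 : Filter ℕ} [𝒰.NeBot] {x x' : ℕ → α → X} {y y' : α → X}
    (h : WeakLim 𝒰 ν x y) (h' : WeakLim 𝒰 ν x' y') (hy : MemLp y 2 ν) (hy' : MemLp y' 2 ν)
    (hx : ∀ n, x n =ᵐ[ν] x' n) : y =ᵐ[ν] y' := by
  have hz := hy.sub hy'
  have h1 := h _ hz
  have h2 := h' _ hz
  have h3 := tendsto_nhds_unique h1 (h2.congr fun n => integral_congr_ae (by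
    filter_upwards [hx n] with t ht; rw [ht]))
  have h4 : ∫ t, ‖(y - y') t‖ ^ 2 ∂ν = 0 := by
    have : ∀ t, ‖(y - y') t‖ ^ 2 = inner ℝ ((y - y') t) (y t) - inner ℝ ((y - y') t) (y' t) :=
      fun t => by rw [← inner_sub_right, ← real_inner_self_eq_norm_sq]; rfl
    simp only [this]
    rw [integral_sub (integrable_inner_of_memLp hz hy) (integrable_inner_of_memLp hz hy'), h3,
      sub_self]
  have h5 := (integral_eq_zero_iff_of_nonneg (fun t => by positivity)
    (by simpa using hz.integrable_norm_pow (by norm_num))).1 h4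
  filter_upwards [h5] with t ht
  simpa [sub_eq_zero] using ht

theorem WeakLim.sub {𝒰 : Filter ℕ} {x x' : ℕ → α → X} {y y' : α → X}
    (h : WeakLim 𝒰 ν x y) (h' : WeakLim 𝒰 ν x' y') (hx : ∀ n, MemLp (x n) 2 ν)
    (hx' : ∀ n, MemLp (x' n) 2 ν) (hy : MemLp y 2 ν) (hy' : MemLp y' 2 ν) :
    WeakLim 𝒰 ν (fun n t => x n t - x' n t) (fun t => y t - y' t) := by
  intro z hz
  have := (h z hz).sub (h' z hz)
  simp only [inner_sub_right]
  rw [integral_sub (integrable_inner_of_memLp hz hy) (integrable_inner_of_memLp hz hy')]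
  refine this.congr fun n => ?_
  rw [integral_sub (integrable_inner_of_memLp hz (hx n)) (integrable_inner_of_memLp hz (hx' n))]

/-- Pointwise bounds pass to weak limits. -/
theorem WeakLim.norm_le {𝒰 : Filter ℕ} [𝒰.NeBot] {x : ℕ → α → X} {y : α → X} {m : α → ℝ}
    (h : WeakLim 𝒰 ν x y) (hx : ∀ n, MemLp (x n) 2 ν) (hy : MemLp y 2 ν) (hm : MemLp m 2 ν)
    (hb : ∀ n, ∀ᵐ t ∂ν, ‖x n t‖ ≤ m t) : ∀ᵐ t ∂ν, ‖y t‖ ≤ m t := by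
  -- The test function is `y` cut off to the set where the bound fails. The limit inequality forces
  -- the nonnegative function `‖y‖ (‖y‖ - m)` on `s` to vanish almost everywhere.
  set s : Set α := {t | m t < ‖y t‖} with hs
  have hsm : NullMeasurableSet s ν :=
    nullMeasurableSet_lt hm.aestronglyMeasurable.aemeasurable
      hy.aestronglyMeasurable.norm.aemeasurable
  set z : α → X := s.indicator y with hz
  have hzm : MemLp z 2 ν := hy.mono (hy.aestronglyMeasurable.indicator₀ hsm)
    (Eventually.of_forall fun t => norm_indicator_le_norm_self _ _)
  have i1 : Integrable (fun t => ‖z t‖ * m t) ν := by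
    have := integrable_inner_of_memLp hzm.norm hm
    refine this.congr (Eventually.of_forall fun t => ?_)
    simp [mul_comm]
  have h1 : ∫ t, inner ℝ (z t) (y t) ∂ν ≤ ∫ t, ‖z t‖ * m t ∂ν := by
    refine le_of_tendsto (h z hzm) (Eventually.of_forall fun n => ?_)
    refine integral_mono_ae (integrable_inner_of_memLp hzm (hx n)) i1 ?_
    filter_upwards [hb n] with t ht
    exact (real_inner_le_norm _ _).trans (by gcongr)
  have hpt : ∀ t, 0 ≤ inner ℝ (z t) (y t) - ‖z t‖ * m t := fun t => by
    by_cases ht : t ∈ s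
    · rw [hz, indicator_of_mem ht, real_inner_self_eq_norm_sq]
      have : m t < ‖y t‖ := ht
      nlinarith [norm_nonneg (y t)]
    · simp [hz, ht]
  have h2 := (integral_eq_zero_iff_of_nonneg hpt
    ((integrable_inner_of_memLp hzm hy).sub i1)).1 (le_antisymm (by
      rw [integral_sub (integrable_inner_of_memLp hzm hy) i1]; linarith) (integral_nonneg hpt))
  -- The bound for one index gives `m ≥ 0`, which excludes `y t = 0` on `s`.
  filter_upwards [h2, hb 0] with t ht ht0
  by_contra hlt
  have hts : t ∈ s := not_le.1 hlt
  simp only [Pi.zero_apply] at ht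
  rw [hz, indicator_of_mem hts, real_inner_self_eq_norm_sq] at ht
  have h3 : m t < ‖y t‖ := hts
  have h4 : 0 ≤ m t := (norm_nonneg _).trans ht0
  nlinarith [norm_nonneg (y t)]

end WeakLimit

/-! ### Volterra fixed points on a time interval. -/

/-- Lebesgue measure on the time interval `(0,T)`. -/
noncomputable abbrev tmeas (T : ℝ) : Measure ℝ := volume.restrict (Ioo 0 T)

section Time

variable {Y : Type*} [NormedAddCommGroup Y] {T : ℝ}

theorem intervalIntegrable_of_memLp {y : ℝ → Y} {p : ℝ≥0∞} (hp : 1 ≤ p) (hy : MemLp y p (tmeas T))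
    {t : ℝ} (ht : t ∈ Icc 0 T) : IntervalIntegrable y volume 0 t := by
  rw [intervalIntegrable_iff_integrableOn_Ioo_of_le ht.1]
  exact IntegrableOn.mono_set (hy.integrable hp) (Ioo_subset_Ioo_right ht.2)

theorem intervalIntegrable_sq_of_memLp {y : ℝ → Y} (hy : MemLp y 2 (tmeas T))
    {t : ℝ} (ht : t ∈ Icc 0 T) : IntervalIntegrable (fun s => ‖y s‖ ^ 2) volume 0 t := by
  rw [intervalIntegrable_iff_integrableOn_Ioo_of_le ht.1]
  have : Integrable (fun s => ‖y s‖ ^ 2) (tmeas T) := by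
    simpa using hy.integrable_norm_pow (by norm_num)
  exact IntegrableOn.mono_set this (Ioo_subset_Ioo_right ht.2)

theorem integral_tmeas [NormedSpace ℝ Y] (hT : 0 ≤ T) (y : ℝ → Y) :
    ∫ t, y t ∂(tmeas T) = ∫ t in (0 : ℝ)..T, y t := by
  rw [intervalIntegral.integral_of_le hT, integral_Ioc_eq_integral_Ioo]

theorem memLp_of_continuousOn {y : ℝ → Y} (p : ℝ≥0∞) (hy : ContinuousOn y (Icc 0 T)) :
    MemLp y p (tmeas T) := by
  obtain ⟨C, hC⟩ := isCompact_Icc.exists_bound_of_continuousOn hy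
  refine MemLp.of_bound ((hy.mono Ioo_subset_Icc_self).aestronglyMeasurable
    measurableSet_Ioo) C ?_
  filter_upwards [ae_restrict_mem measurableSet_Ioo] with t ht
  exact hC t (Ioo_subset_Icc_self ht)

/-- `t ↦ ∫₀ᵗ ‖y₁ - y₂‖²` decreases factorially under iteration of a Volterra map. -/
theorem integral_sq_iterate_le (hT : 0 ≤ T) {F : Lp Y 2 (tmeas T) → Lp Y 2 (tmeas T)} {K : ℝ}
    (hK0 : 0 ≤ K) (hK : ∀ y₁ y₂, ∀ᵐ t ∂(tmeas T),
      ‖F y₁ t - F y₂ t‖ ^ 2 ≤ K * ∫ s in (0 : ℝ)..t, ‖y₁ s - y₂ s‖ ^ 2)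
    (y₁ y₂ : Lp Y 2 (tmeas T)) (n : ℕ) : ∀ t ∈ Icc 0 T,
      ∫ s in (0 : ℝ)..t, ‖(F^[n] y₁) s - (F^[n] y₂) s‖ ^ 2
        ≤ (K * t) ^ n / n.factorial * ∫ s in (0 : ℝ)..T, ‖y₁ s - y₂ s‖ ^ 2 := by
  set D := ∫ s in (0 : ℝ)..T, ‖y₁ s - y₂ s‖ ^ 2 with hD
  have hsq : ∀ (a b : Lp Y 2 (tmeas T)), ∀ t ∈ Icc 0 T,
      IntervalIntegrable (fun s => ‖a s - b s‖ ^ 2) volume 0 t := fun a b t ht =>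
    intervalIntegrable_sq_of_memLp ((Lp.memLp a).sub (Lp.memLp b)) ht
  induction n with
  | zero =>
    intro t ht
    simp only [Function.iterate_zero, id, pow_zero, Nat.factorial_zero, Nat.cast_one, div_one,
      one_mul]
    exact intervalIntegral.integral_mono_interval le_rfl ht.1 ht.2
      (Eventually.of_forall fun s => by positivity) (hsq _ _ T ⟨hT, le_rfl⟩)
  | succ n ih =>
    intro t ht
    simp only [Function.iterate_succ_apply']
    -- Each application of the map integrates the previous bound once, which produces the factor `K
    -- t / (n + 1)`.
    calc _ ≤ ∫ s in (0 : ℝ)..t, K * ((K * s) ^ n / n.factorial * D) := by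
          refine intervalIntegral.integral_mono_ae_restrict ht.1 (hsq _ _ t ht)
            (Continuous.intervalIntegrable (by fun_prop) _ _) ?_
          have h1 := ae_restrict_of_ae_restrict_of_subset (Ioo_subset_Ioo_right ht.2)
            (hK (F^[n] y₁) (F^[n] y₂))
          rw [← restrict_Ioo_eq_restrict_Icc]
          filter_upwards [h1, ae_restrict_mem measurableSet_Ioo] with s hs hs'
          exact hs.trans (by gcongr; exact ih s ⟨hs'.1.le, hs'.2.le.trans ht.2⟩)
      _ = _ := by
          simp only [mul_pow, intervalIntegral.integral_const_mul,
            intervalIntegral.integral_mul_const, intervalIntegral.integral_div, integral_pow,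
            Nat.factorial_succ, Nat.cast_mul]
          have := Nat.factorial_ne_zero n
          push_cast
          field_simp
          simp
          ring

/-- Fixed points of Volterra maps in `L²(0,T;Y)`. -/
theorem exists_volterra_fixedPoint [NormedSpace ℝ Y] [CompleteSpace Y] (hT : 0 ≤ T)
    {F : (ℝ → Y) → ℝ → Y}
    (hF : ∀ y, MemLp y 2 (tmeas T) → MemLp (F y) 2 (tmeas T)) {K : ℝ}
    (hK : ∀ y₁ y₂, MemLp y₁ 2 (tmeas T) → MemLp y₂ 2 (tmeas T) → ∀ᵐ t ∂(tmeas T),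
      ‖F y₁ t - F y₂ t‖ ^ 2 ≤ K * ∫ s in (0 : ℝ)..t, ‖y₁ s - y₂ s‖ ^ 2) :
    ∃ y, MemLp y 2 (tmeas T) ∧ F y =ᵐ[tmeas T] y := by
  -- `F` acts on functions and need not be defined on classes; `Φ` evaluates it on the chosen
  -- representative, which is also the fixed point returned.
  set Φ : Lp Y 2 (tmeas T) → Lp Y 2 (tmeas T) := fun y => (hF y (Lp.memLp y)).toLp with hΦ
  have hΦK : ∀ y₁ y₂, ∀ᵐ t ∂(tmeas T),
      ‖Φ y₁ t - Φ y₂ t‖ ^ 2 ≤ |K| * ∫ s in (0 : ℝ)..t, ‖y₁ s - y₂ s‖ ^ 2 := fun y₁ y₂ => by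
    filter_upwards [hK y₁ y₂ (Lp.memLp _) (Lp.memLp _), (hF y₁ (Lp.memLp y₁)).coeFn_toLp,
      (hF y₂ (Lp.memLp y₂)).coeFn_toLp, ae_restrict_mem measurableSet_Ioo] with t h1 h2 h3 h4
    rw [h2, h3]
    refine h1.trans ?_
    have := intervalIntegral.integral_nonneg (f := fun s => ‖y₁ s - y₂ s‖ ^ 2)
      (μ := volume) h4.1.le (fun s _ => by positivity)
    gcongr
    exact le_abs_self K
  have hnorm : ∀ y₁ y₂ : Lp Y 2 (tmeas T),
      dist y₁ y₂ ^ 2 = ∫ s in (0 : ℝ)..T, ‖y₁ s - y₂ s‖ ^ 2 := fun y₁ y₂ => by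
    rw [dist_eq_norm, Lp.norm_def, ← integral_tmeas hT]
    have h := (Lp.memLp (y₁ - y₂)).eLpNorm_eq_integral_rpow_norm (by norm_num) (by norm_num)
    have e : ∫ s, ‖(y₁ - y₂ : Lp Y 2 (tmeas T)) s‖ ^ (2 : ℝ≥0∞).toReal ∂(tmeas T)
        = ∫ s, ‖y₁ s - y₂ s‖ ^ 2 ∂(tmeas T) := by
      refine integral_congr_ae ?_
      filter_upwards [Lp.coeFn_sub y₁ y₂] with s hs
      rw [hs, Pi.sub_apply, ENNReal.toReal_ofNat, Real.rpow_ofNat]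
    rw [h, e, ENNReal.toReal_ofReal (by positivity), ← Real.rpow_natCast, ← Real.rpow_mul
      (integral_nonneg fun _ => by positivity)]
    norm_num
  -- Some iterate has squared Lipschitz constant below `1/4`, hence contracts with constant `1/2`;
  -- its unique fixed point is fixed by `Φ` as well.
  have hlim := FloorSemiring.tendsto_pow_div_factorial_atTop (|K| * T)
  obtain ⟨n, hn⟩ := (hlim.eventually (gt_mem_nhds (show (0 : ℝ) < 1 / 4 by norm_num))).exists
  have hcon : ContractingWith (1 / 2 : ℝ≥0) (Φ^[n]) := by
    refine ⟨by rw [← NNReal.coe_lt_coe]; norm_num, LipschitzWith.of_dist_le_mul fun a b => ?_⟩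
    refine abs_le_of_sq_le_sq' ?_ (by positivity) |>.2
    rw [hnorm, mul_pow, hnorm]
    refine (integral_sq_iterate_le hT (abs_nonneg K) hΦK a b n T ⟨hT, le_rfl⟩).trans ?_
    have : 0 ≤ ∫ s in (0 : ℝ)..T, ‖a s - b s‖ ^ 2 :=
      intervalIntegral.integral_nonneg hT fun s _ => by positivity
    gcongr
    refine hn.le.trans ?_
    norm_num
  obtain ⟨y, hfix⟩ : ∃ y, Φ y = y := ⟨_, hcon.isFixedPt_fixedPoint_iterate⟩
  refine ⟨y, Lp.memLp y, ?_⟩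
  have h1 := (hF _ (Lp.memLp y)).coeFn_toLp
  change (Φ y : ℝ → Y) =ᵐ[tmeas T] _ at h1
  rw [hfix] at h1
  exact h1.symm

/-- Cauchy–Schwarz on `(0,t)`. -/
theorem sq_integral_norm_le {y : ℝ → Y} (hy : MemLp y 2 (tmeas T)) {t : ℝ} (ht : t ∈ Icc 0 T) :
    (∫ s in (0 : ℝ)..t, ‖y s‖) ^ 2 ≤ t * ∫ s in (0 : ℝ)..t, ‖y s‖ ^ 2 := by
  have h1 := (intervalIntegrable_of_memLp one_le_two hy ht).norm
  have h2 := intervalIntegrable_sq_of_memLp hy ht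
  set I := ∫ s in (0 : ℝ)..t, ‖y s‖
  set J := ∫ s in (0 : ℝ)..t, ‖y s‖ ^ 2
  rcases ht.1.eq_or_lt with rfl | htp
  · simp [I]
  -- The variance of `‖y‖` about its mean `I / t` is nonnegative.
  have h3 : 0 ≤ ∫ s in (0 : ℝ)..t, (‖y s‖ - I / t) ^ 2 :=
    intervalIntegral.integral_nonneg ht.1 fun s _ => by positivity
  have h4 : ∫ s in (0 : ℝ)..t, (‖y s‖ - I / t) ^ 2 = J - 2 * (I / t) * I + t * (I / t) ^ 2 := by
    have : ∀ s, (‖y s‖ - I / t) ^ 2 = ‖y s‖ ^ 2 - 2 * (I / t) * ‖y s‖ + (I / t) ^ 2 :=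
      fun s => by ring
    simp only [this]
    rw [intervalIntegral.integral_add (h2.sub (h1.const_mul _)) intervalIntegrable_const,
      intervalIntegral.integral_sub h2 (h1.const_mul _), intervalIntegral.integral_const_mul]
    simp [J, I]
  rw [h4] at h3
  have h5 : J - 2 * (I / t) * I + t * (I / t) ^ 2 = J - I ^ 2 / t := by field_simp; ring
  rw [h5, sub_nonneg, div_le_iff₀ htp] at h3
  linarith

end Time

/-- The primitive of `w` with value `p` at time `0`. -/
noncomputable def prim {E : Type*} [NormedAddCommGroup E] [NormedSpace ℝ E] (p : E) (w : ℝ → E)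
    (t : ℝ) : E :=
  p + ∫ s in (0 : ℝ)..t, w s

/-! ### Calculus of primitives with prescribed initial value. -/

section Prim

variable {E : Type*} [NormedAddCommGroup E] [NormedSpace ℝ E] {T : ℝ}

@[simp] theorem prim_zero (p : E) (w : ℝ → E) : prim p w 0 = p := by simp [prim]

theorem continuousOn_prim (hT : 0 ≤ T) (p : E) {w : ℝ → E} (hw : IntervalIntegrable w volume 0 T) :
    ContinuousOn (prim p w) (Icc 0 T) :=
  continuousOn_const.add (continuousOn_primitive_zero hT hw)

theorem ContinuousOn.intervalIntegrable_prefix {E : Type*} [NormedAddCommGroup E] {T : ℝ}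
    {w : ℝ → E} (hw : ContinuousOn w (Icc 0 T)) {t : ℝ}
    (ht : t ∈ Icc 0 T) : IntervalIntegrable w volume 0 t := by
  refine ContinuousOn.intervalIntegrable (hw.mono ?_)
  rw [uIcc_of_le ht.1]
  exact Icc_subset_Icc_right ht.2

theorem prim_sub {p q : E} {w z : ℝ → E} {t : ℝ} (hw : IntervalIntegrable w volume 0 t)
    (hz : IntervalIntegrable z volume 0 t) :
    prim p w t - prim q z t = prim (p - q) (fun s => w s - z s) t := by
  rw [prim, prim, prim, intervalIntegral.integral_sub hw hz]
  abel

theorem prim_congr {p : E} {w z : ℝ → E} {t : ℝ} (ht : 0 ≤ t) (h : ∀ s ∈ Icc 0 t, w s = z s) :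
    prim p w t = prim p z t := by
  rw [prim, prim, intervalIntegral.integral_congr fun s hs => h s (by rwa [uIcc_of_le ht] at hs)]

theorem prim_congr_ae {p : E} {w z : ℝ → E} {t : ℝ} (ht : t ∈ Icc 0 T) (h : w =ᵐ[tmeas T] z) :
    prim p w t = prim p z t := by
  rw [prim, prim, intervalIntegral.integral_of_le ht.1, intervalIntegral.integral_of_le ht.1,
    integral_Ioc_eq_integral_Ioo, integral_Ioc_eq_integral_Ioo]
  congr 1
  exact integral_congr_ae (ae_restrict_of_ae_restrict_of_subset (Ioo_subset_Ioo_right ht.2) h)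

theorem prim_map {F : Type*} [NormedAddCommGroup F] [NormedSpace ℝ F] [CompleteSpace E]
    [CompleteSpace F] (L : E →L[ℝ] F)
    (p : E) {w : ℝ → E} {t : ℝ} (hw : IntervalIntegrable w volume 0 t) :
    L (prim p w t) = prim (L p) (fun s => L (w s)) t := by
  rw [prim, prim, map_add, L.intervalIntegral_comp_comm hw]

end Prim

/-! ### The regularised evolution problem and its energy estimate. -/

variable {V H : Type*} [NormedAddCommGroup V] [InnerProductSpace ℝ V]
  [NormedAddCommGroup H] [InnerProductSpace ℝ H] [CompleteSpace H]

/-- A Lipschitz continuous family of bounded self-adjoint operators on `V`, uniformly coercive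
on `[0,T]`. -/
structure IsEvolutionForm (T M α : ℝ) (A : ℝ → V →L[ℝ] V) : Prop where
  M_nonneg : 0 ≤ M
  α_pos : 0 < α
  lipschitz : ∀ s t, ‖A s - A t‖ ≤ M * |s - t|
  symm : ∀ t x y, inner ℝ (A t x) y = inner ℝ x (A t y)
  coercive : ∀ t ∈ Icc 0 T, ∀ x, α * ‖x‖ ^ 2 ≤ inner ℝ (A t x) x

namespace IsEvolutionForm

variable {T M α : ℝ} {A : ℝ → V →L[ℝ] V}

theorem continuous (h : IsEvolutionForm T M α A) : Continuous A := by
  refine (LipschitzWith.of_dist_le_mul (K := ⟨M, h.M_nonneg⟩) fun s t => ?_).continuous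
  rw [dist_eq_norm, Real.dist_eq]; exact h.lipschitz s t

theorem norm_le (h : IsEvolutionForm T M α A) {t : ℝ} (ht : t ∈ Icc 0 T) :
    ‖A t‖ ≤ ‖A 0‖ + M * T := by
  have h1 := h.lipschitz t 0
  rw [sub_zero, abs_of_nonneg ht.1] at h1
  calc ‖A t‖ = ‖A 0 + (A t - A 0)‖ := by abel_nf
    _ ≤ ‖A 0‖ + ‖A t - A 0‖ := norm_add_le _ _
    _ ≤ _ := by have := h.M_nonneg; gcongr; exact h1.trans (by gcongr; exact ht.2)

theorem memLp_apply (h : IsEvolutionForm T M α A) {u : ℝ → V} {p : ℝ≥0∞}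
    (hu : MemLp u p (tmeas T)) : MemLp (fun t => A t (u t)) p (tmeas T) := by
  refine hu.of_le_mul (c := ‖A 0‖ + M * T) ?_ ?_
  · exact (ContinuousLinearMap.id ℝ (V →L[ℝ] V)).aestronglyMeasurable_comp₂
      h.continuous.aestronglyMeasurable hu.aestronglyMeasurable
  · filter_upwards [ae_restrict_mem measurableSet_Ioo] with t ht
    exact (A t).le_of_opNorm_le (h.norm_le (Ioo_subset_Icc_self ht)) _

end IsEvolutionForm

/-- This is the Volterra bound behind `exists_regSol`. The outer integral contributes `T²` after
squaring, and Cauchy–Schwarz contributes the third factor `T`. -/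
theorem norm_primitive_primitive_sq_le {T : ℝ} {w : ℝ → V} (hw : MemLp w 2 (tmeas T)) {t : ℝ}
    (ht : t ∈ Icc 0 T) :
    ‖∫ s in (0 : ℝ)..t, ∫ r in (0 : ℝ)..s, w r‖ ^ 2
      ≤ T ^ 3 * ∫ s in (0 : ℝ)..t, ‖w s‖ ^ 2 := by
  have hT : 0 ≤ T := ht.1.trans ht.2
  have hwt := intervalIntegrable_of_memLp one_le_two hw ht
  have h1 : ‖∫ s in (0 : ℝ)..t, ∫ r in (0 : ℝ)..s, w r‖ ≤ T * ∫ s in (0 : ℝ)..t, ‖w s‖ := by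
    have hb : ∀ s ∈ uIoc 0 t, ‖∫ r in (0 : ℝ)..s, w r‖ ≤ ∫ r in (0 : ℝ)..t, ‖w r‖ := by
      intro s hs
      rw [uIoc_of_le ht.1] at hs
      refine (intervalIntegral.norm_integral_le_integral_norm hs.1.le).trans ?_
      exact intervalIntegral.integral_mono_interval le_rfl hs.1.le hs.2
        (Eventually.of_forall fun s => norm_nonneg _) hwt.norm
    refine (intervalIntegral.norm_integral_le_of_norm_le_const hb).trans ?_
    rw [sub_zero, abs_of_nonneg ht.1, mul_comm]
    have : 0 ≤ ∫ r in (0 : ℝ)..t, ‖w r‖ :=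
      intervalIntegral.integral_nonneg ht.1 fun _ _ => norm_nonneg _
    gcongr
    exact ht.2
  have h2 := sq_integral_norm_le hw ht
  have h3 : 0 ≤ ∫ s in (0 : ℝ)..t, ‖w s‖ ^ 2 :=
    intervalIntegral.integral_nonneg ht.1 fun _ _ => by positivity
  calc _ ≤ (T * ∫ s in (0 : ℝ)..t, ‖w s‖) ^ 2 := by gcongr
    _ = T ^ 2 * (∫ s in (0 : ℝ)..t, ‖w s‖) ^ 2 := by ring
    _ ≤ T ^ 2 * (T * ∫ s in (0 : ℝ)..t, ‖w s‖ ^ 2) := by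
        gcongr; exact h2.trans (by gcongr; exact ht.2)
    _ = _ := by ring

variable [CompleteSpace V]

/-- The regularised mass operator `j*j + ε`. -/
noncomputable def massOp (j : V →L[ℝ] H) (ε : ℝ) : V →L[ℝ] V :=
  j.adjoint.comp j + ε • ContinuousLinearMap.id ℝ V

theorem massOp_inner (j : V →L[ℝ] H) (ε : ℝ) (x y : V) :
    inner ℝ (massOp j ε x) y = inner ℝ (j x) (j y) + ε * inner ℝ x y := by
  simp [massOp, inner_add_left, ContinuousLinearMap.adjoint_inner_left, real_inner_smul_left]

theorem massOp_inner_self (j : V →L[ℝ] H) (ε : ℝ) (x : V) :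
    inner ℝ (massOp j ε x) x = ‖j x‖ ^ 2 + ε * ‖x‖ ^ 2 := by
  rw [massOp_inner, real_inner_self_eq_norm_sq, real_inner_self_eq_norm_sq]

/-- Lax–Milgram applies, since the form of `massOp j ε` is coercive with constant `ε`. -/
theorem exists_massOp_inverse (j : V →L[ℝ] H) {ε : ℝ} (hε : 0 < ε) :
    ∃ R : V →L[ℝ] V, ∀ x, massOp j ε (R x) = x := by
  have hco : IsCoercive ((innerSL ℝ).comp (massOp j ε) : V →L[ℝ] V →L[ℝ] ℝ) := by
    refine ⟨ε, hε, fun x => ?_⟩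
    have := massOp_inner_self j ε x
    simp only [ContinuousLinearMap.comp_apply, innerSL_apply_apply]
    nlinarith [sq_nonneg ‖j x‖]
  refine ⟨hco.continuousLinearEquivOfBilin.symm, fun x => ?_⟩
  have h : ∀ y, massOp j ε y = hco.continuousLinearEquivOfBilin y := fun y =>
    hco.unique_continuousLinearEquivOfBilin fun z => rfl
  rw [h]
  exact hco.continuousLinearEquivOfBilin.apply_symm_apply x

/-- `w` is the second time derivative of a solution of the regularised evolution problem
`(j*j + ε) u'' + A u = j* g`, `u(0) = p`, `u'(0) = q`. -/
structure IsRegSol (T : ℝ) (A : ℝ → V →L[ℝ] V) (j : V →L[ℝ] H) (ε : ℝ) (p q : V) (g : ℝ → H)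
    (w : ℝ → V) : Prop where
  memLp : MemLp w 2 (tmeas T)
  eq : ∀ᵐ t ∂(tmeas T), massOp j ε (w t) = j.adjoint (g t) - A t (prim p (prim q w) t)

/-- With `R` an inverse of the mass operator, the problem reads `w = R (j* g - A u)`, where `u` is a
double primitive of `w`. All operators are bounded on `V`, so this is a Volterra equation. -/
theorem exists_regSol {T M α : ℝ} (hT : 0 ≤ T) {A : ℝ → V →L[ℝ] V} (hA : IsEvolutionForm T M α A)
    (j : V →L[ℝ] H) {ε : ℝ} (hε : 0 < ε) (p q : V) {g : ℝ → H} (hg : MemLp g 2 (tmeas T)) :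
    ∃ w, IsRegSol T A j ε p q g w := by
  obtain ⟨R, hR⟩ := exists_massOp_inverse j hε
  have hTT : T ∈ Icc 0 T := ⟨hT, le_rfl⟩
  have hy : ∀ {w : ℝ → V}, MemLp w 2 (tmeas T) → ContinuousOn (prim q w) (Icc 0 T) := fun hw =>
    continuousOn_prim hT q (intervalIntegrable_of_memLp one_le_two hw hTT)
  have hu : ∀ {w : ℝ → V}, MemLp w 2 (tmeas T) →
      ContinuousOn (prim p (prim q w)) (Icc 0 T) := fun hw =>
    continuousOn_prim hT p (ContinuousOn.intervalIntegrable_prefix (hy hw) hTT)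
  set CA := ‖A 0‖ + M * T
  obtain ⟨w, hw, hwF⟩ := exists_volterra_fixedPoint (Y := V) hT
    (F := fun w t => R (j.adjoint (g t) - A t (prim p (prim q w) t)))
    (fun w hw => R.comp_memLp' ((j.adjoint.comp_memLp' hg).sub
      (hA.memLp_apply (memLp_of_continuousOn 2 (hu hw)))))
    (K := (‖R‖ * CA) ^ 2 * T ^ 3) (fun w₁ w₂ h₁ h₂ => by
      filter_upwards [ae_restrict_mem measurableSet_Ioo] with t ht'
      have ht := Ioo_subset_Icc_self ht'
      have e : R (j.adjoint (g t) - A t (prim p (prim q w₁) t))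
          - R (j.adjoint (g t) - A t (prim p (prim q w₂) t))
          = - R (A t (∫ s in (0 : ℝ)..t, ∫ r in (0 : ℝ)..s, (w₁ r - w₂ r))) := by
        rw [← map_sub, sub_sub_sub_cancel_left, ← map_sub, ← map_neg, ← map_neg, ← neg_sub,
          prim_sub (ContinuousOn.intervalIntegrable_prefix (hy h₁) ht)
            (ContinuousOn.intervalIntegrable_prefix (hy h₂) ht)]
        rw [prim, sub_self, zero_add, intervalIntegral.integral_congr (fun s hs => ?_)]
        rw [uIcc_of_le ht.1] at hs
        have hs' : s ∈ Icc 0 T := ⟨hs.1, hs.2.trans ht.2⟩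
        rw [prim_sub (intervalIntegrable_of_memLp one_le_two h₁ hs')
          (intervalIntegrable_of_memLp one_le_two h₂ hs'), prim, sub_self, zero_add]
      rw [e, norm_neg]
      have h3 := norm_primitive_primitive_sq_le (h₁.sub h₂) ht
      simp only [Pi.sub_apply] at h3
      set z := ∫ s in (0 : ℝ)..t, ∫ r in (0 : ℝ)..s, (w₁ r - w₂ r)
      have h4 : ‖R (A t z)‖ ≤ ‖R‖ * CA * ‖z‖ := by
        rw [mul_assoc]
        exact (R.le_opNorm _).trans (by gcongr; exact (A t).le_of_opNorm_le (hA.norm_le ht) _)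
      calc _ ≤ (‖R‖ * CA * ‖z‖) ^ 2 := by gcongr
        _ = (‖R‖ * CA) ^ 2 * ‖z‖ ^ 2 := by ring
        _ ≤ (‖R‖ * CA) ^ 2 * (T ^ 3 * ∫ s in (0 : ℝ)..t, ‖w₁ s - w₂ s‖ ^ 2) := by gcongr
        _ = _ := by ring)
  refine ⟨w, hw, ?_⟩
  filter_upwards [hwF] with t ht
  rw [← ht, hR]

/-- The energy estimate for the regularised problem. -/
theorem IsRegSol.energy_le {T M α : ℝ} {A : ℝ → V →L[ℝ] V} (hA : IsEvolutionForm T M α A)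
    {j : V →L[ℝ] H} {ε : ℝ} (hε : 0 ≤ ε) {p q : V} {ψ : H} (hq : massOp j ε q = j.adjoint ψ)
    {g : ℝ → H} (hg : MemLp g 2 (tmeas T)) {w : ℝ → V} (hw : IsRegSol T A j ε p q g w)
    {t : ℝ} (ht : t ∈ Icc 0 T) :
    ‖j (prim q w t)‖ ^ 2 + ε * ‖prim q w t‖ ^ 2 + α * ‖prim p (prim q w) t‖ ^ 2
      ≤ (‖ψ‖ ^ 2 + ‖A 0‖ * ‖p‖ ^ 2 + ∫ s in (0 : ℝ)..t, ‖g s‖ ^ 2)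
        * Real.exp ((1 + M / α) * t) := by
  have hα := hA.α_pos
  have hM := hA.M_nonneg
  have hT : 0 ≤ T := ht.1.trans ht.2
  have hTT : T ∈ Icc 0 T := ⟨hT, le_rfl⟩
  set y := prim q w with hy
  set u := prim p y with hu
  have hyc : ContinuousOn y (Icc 0 T) :=
    continuousOn_prim hT q (intervalIntegrable_of_memLp one_le_two hw.memLp hTT)
  have huc : ContinuousOn u (Icc 0 T) :=
    continuousOn_prim hT p (ContinuousOn.intervalIntegrable_prefix hyc hTT)
  have hAc := hA.continuous
  set E : ℝ → ℝ := fun t => inner ℝ (massOp j ε (y t)) (y t) + inner ℝ (A t (u t)) (u t) with hE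
  have hEc : ContinuousOn E (Icc 0 T) := by
    have h1 : ContinuousOn (fun t => A t (u t)) (Icc 0 T) := hAc.continuousOn.clm_apply huc
    have h2 : ContinuousOn (fun t => massOp j ε (y t)) (Icc 0 T) :=
      (massOp j ε).continuous.comp_continuousOn hyc
    exact (h2.inner hyc).add (h1.inner huc)
  have hElow : ∀ s ∈ Icc 0 T, ‖j (y s)‖ ^ 2 + ε * ‖y s‖ ^ 2 + α * ‖u s‖ ^ 2 ≤ E s := fun s hs => by
    simp only [hE, massOp_inner_self]
    linarith [hA.coercive s hs (u s)]
  have hgi := intervalIntegrable_sq_of_memLp hg ht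
  -- Testing `massOp j ε q = j* ψ` with `q` bounds the initial kinetic energy by `ψ` alone,
  -- uniformly in `ε`; no bound on `‖q‖` is involved.
  have hq2 : inner ℝ (massOp j ε q) q ≤ ‖ψ‖ ^ 2 := by
    have h1 := massOp_inner_self j ε q
    have h2 : inner ℝ (massOp j ε q) q ≤ ‖ψ‖ * ‖j q‖ := by
      rw [hq, ContinuousLinearMap.adjoint_inner_left]; exact real_inner_le_norm _ _
    nlinarith [sq_nonneg (‖ψ‖ - ‖j q‖), mul_nonneg hε (sq_nonneg ‖q‖)]
  have hp2 : inner ℝ (A 0 p) p ≤ ‖A 0‖ * ‖p‖ ^ 2 := by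
    calc _ ≤ ‖A 0 p‖ * ‖p‖ := real_inner_le_norm _ _
      _ ≤ (‖A 0‖ * ‖p‖) * ‖p‖ := by gcongr; exact (A 0).le_opNorm p
      _ = _ := by ring
  refine (hElow t ht).trans (le_mul_exp_of_le_add_integral ht.1 (by positivity)
    (hEc.mono (Icc_subset_Icc_right ht.2)) fun s hs => ?_)
  have hsT : s ∈ Icc 0 T := ⟨hs.1, hs.2.trans ht.2⟩
  have hwi := intervalIntegrable_of_memLp one_le_two hw.memLp hsT
  have k1 := bilin_primitive_self ((innerSL ℝ).comp (massOp j ε) : V →L[ℝ] V →L[ℝ] ℝ)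
    (fun x y => by
      simp only [ContinuousLinearMap.comp_apply, innerSL_apply_apply, massOp_inner]
      rw [real_inner_comm, real_inner_comm y x]) (w := w) (p := q) hs.1 hwi
  have k2 := quadratic_le_of_lipschitz hM hA.lipschitz hA.symm hs.1
    (hyc.mono (Icc_subset_Icc_right hsT.2)) p
  simp only [ContinuousLinearMap.comp_apply, innerSL_apply_apply] at k1
  change inner ℝ (massOp j ε (y s)) (y s) = _ + 2 * ∫ r in (0 : ℝ)..s,
    inner ℝ (massOp j ε (w r)) (y r) at k1
  change inner ℝ (A s (u s)) (u s) ≤ _ + ∫ r in (0 : ℝ)..s,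
    (2 * inner ℝ (A r (u r)) (y r) + M * ‖u r‖ ^ 2) at k2
  have hyi := hyc.mono (Icc_subset_Icc_right hsT.2)
  have hui := huc.mono (Icc_subset_Icc_right hsT.2)
  have c1 : IntervalIntegrable (fun r => 2 * inner ℝ (A r (u r)) (y r) + M * ‖u r‖ ^ 2)
      volume 0 s := by
    refine ContinuousOn.intervalIntegrable_prefix (T := T) ?_ hsT
    have h1 : ContinuousOn (fun t => A t (u t)) (Icc 0 T) := hAc.continuousOn.clm_apply huc
    exact ((h1.inner hyc).const_mul 2).add ((huc.norm.pow 2).const_mul M)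
  have c2 : IntervalIntegrable (fun r => inner ℝ (massOp j ε (w r)) (y r)) volume 0 s := by
    obtain ⟨C, hC⟩ := isCompact_Icc.exists_bound_of_continuousOn hyc
    have hm := (massOp j ε).comp_memLp' hw.memLp
    have := integrable_inner_of_memLp hm (memLp_of_continuousOn 2 hyc)
    rw [intervalIntegrable_iff_integrableOn_Ioo_of_le hs.1]
    exact IntegrableOn.mono_set this (Ioo_subset_Ioo_right hsT.2)
  have cE : IntervalIntegrable E volume 0 s := ContinuousOn.intervalIntegrable_prefix hEc hsT
  have cg := intervalIntegrable_sq_of_memLp hg hsT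
  have k3 : 2 * (∫ r in (0 : ℝ)..s, inner ℝ (massOp j ε (w r)) (y r))
      + (∫ r in (0 : ℝ)..s, (2 * inner ℝ (A r (u r)) (y r) + M * ‖u r‖ ^ 2))
      ≤ (∫ r in (0 : ℝ)..s, ‖g r‖ ^ 2) + (1 + M / α) * ∫ r in (0 : ℝ)..s, E r := by
    rw [← intervalIntegral.integral_const_mul, ← intervalIntegral.integral_const_mul,
      ← intervalIntegral.integral_add (c2.const_mul 2) c1,
      ← intervalIntegral.integral_add cg (cE.const_mul _)]
    refine intervalIntegral.integral_mono_ae_restrict hs.1 ((c2.const_mul 2).add c1)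
      (cg.add (cE.const_mul _)) ?_
    rw [← restrict_Ioo_eq_restrict_Icc]
    filter_upwards [ae_restrict_of_ae_restrict_of_subset (Ioo_subset_Ioo_right hsT.2) hw.eq,
      ae_restrict_mem measurableSet_Ioo] with r hr hr'
    have hrT : r ∈ Icc 0 T := ⟨hr'.1.le, hr'.2.le.trans hsT.2⟩
    -- Inserting the equation cancels the two terms with `A`. Young's inequality for `(g, j y)`
    -- gives the `1` in the Gronwall constant, and `α ‖u‖² ≤ E` gives `M / α`.
    rw [hr, inner_sub_left, ContinuousLinearMap.adjoint_inner_left]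
    have h1 := hElow r hrT
    have h2 : 2 * inner ℝ (g r) (j (y r)) ≤ ‖g r‖ ^ 2 + ‖j (y r)‖ ^ 2 := by
      nlinarith [real_inner_le_norm (g r) (j (y r)), sq_nonneg (‖g r‖ - ‖j (y r)‖)]
    have h3 : M * ‖u r‖ ^ 2 ≤ M / α * E r := by
      rw [div_mul_eq_mul_div, le_div_iff₀ hα]
      have : α * ‖u r‖ ^ 2 ≤ E r := by nlinarith [sq_nonneg ‖j (y r)‖, sq_nonneg ‖y r‖]
      nlinarith
    have h4 : ‖j (y r)‖ ^ 2 ≤ E r := by nlinarith [sq_nonneg ‖u r‖, sq_nonneg ‖y r‖]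
    change _ + (_ + M * ‖u r‖ ^ 2) ≤ _
    change 2 * (_ - inner ℝ (A r (u r)) (y r)) + _ ≤ _
    linarith
  have k4 : ∫ r in (0 : ℝ)..s, ‖g r‖ ^ 2 ≤ ∫ r in (0 : ℝ)..t, ‖g r‖ ^ 2 :=
    intervalIntegral.integral_mono_interval le_rfl hs.1 hs.2
      (Eventually.of_forall fun s => by positivity) hgi
  simp only [hE]
  simp only [hE] at k3
  linarith

/-! ### Operations preserving weak limits. -/

section WeakLimitOperations

variable {X Y : Type*} [NormedAddCommGroup X] [InnerProductSpace ℝ X]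
  [NormedAddCommGroup Y] [InnerProductSpace ℝ Y] {𝒰 : Filter ℕ}

theorem WeakLim.const {α : Type*} [MeasurableSpace α] {ν : Measure α} (y : α → X) :
    WeakLim 𝒰 ν (fun _ => y) y := fun _ _ => tendsto_const_nhds

/-- Self-adjointness moves `A t` onto the test function, which remains in `L²`. -/
theorem WeakLim.evolution {T M α : ℝ} {A : ℝ → X →L[ℝ] X} (hA : IsEvolutionForm T M α A)
    {x : ℕ → ℝ → X} {y : ℝ → X} (h : WeakLim 𝒰 (tmeas T) x y) :
    WeakLim 𝒰 (tmeas T) (fun n t => A t (x n t)) (fun t => A t (y t)) := by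
  intro z hz
  have := h _ (hA.memLp_apply hz)
  simpa only [hA.symm] using this

variable [CompleteSpace X] [CompleteSpace Y]

theorem WeakLim.map {α : Type*} [MeasurableSpace α] {ν : Measure α} {x : ℕ → α → X} {y : α → X}
    (h : WeakLim 𝒰 ν x y) (L : X →L[ℝ] Y) :
    WeakLim 𝒰 ν (fun n t => L (x n t)) (fun t => L (y t)) := by
  intro z hz
  have := h _ (L.adjoint.comp_memLp' hz)
  simpa only [Function.comp_apply, ContinuousLinearMap.adjoint_inner_left] using this

/-- The adjoint of integration from `0` is integration up to `T`. This lets weak limits pass through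
`prim`. -/
theorem integral_inner_prim {T : ℝ} (hT : 0 ≤ T) {x z : ℝ → X} (hx : MemLp x 2 (tmeas T))
    (hz : MemLp z 2 (tmeas T)) (p : X) :
    ∫ t, inner ℝ (z t) (prim p x t) ∂(tmeas T)
      = (∫ t, inner ℝ (z t) p ∂(tmeas T))
        + ∫ t, inner ℝ (∫ s in t..T, z s) (x t) ∂(tmeas T) := by
  have hTT : T ∈ Icc 0 T := ⟨hT, le_rfl⟩
  have hxi := intervalIntegrable_of_memLp one_le_two hx hTT
  have hzi := intervalIntegrable_of_memLp one_le_two hz hTT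
  have h := integral_bilin_primitive (innerSL ℝ : X →L[ℝ] X →L[ℝ] ℝ) hT hzi hxi
  change (∫ r in (0 : ℝ)..T, inner ℝ (z r) (∫ s in (0 : ℝ)..r, x s))
    = ∫ s in (0 : ℝ)..T, inner ℝ (∫ r in s..T, z r) (x s) at h
  rw [integral_tmeas hT (fun t => inner ℝ (∫ s in t..T, z s) (x t)), ← h, ← integral_tmeas hT,
    ← integral_add]
  · simp only [prim, inner_add_right]
  · exact integrable_inner_of_memLp hz (memLp_const p)
  · exact integrable_inner_of_memLp hz (memLp_of_continuousOn 2 (continuousOn_primitive_zero hT hxi))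

theorem WeakLim.prim {T : ℝ} (hT : 0 ≤ T) {x : ℕ → ℝ → X} {y : ℝ → X}
    (h : WeakLim 𝒰 (tmeas T) x y) (hx : ∀ n, MemLp (x n) 2 (tmeas T)) (hy : MemLp y 2 (tmeas T))
    (p : X) : WeakLim 𝒰 (tmeas T) (fun n => VOWave.prim p (x n)) (VOWave.prim p y) := by
  intro z hz
  have hTT : T ∈ Icc 0 T := ⟨hT, le_rfl⟩
  have hzi := intervalIntegrable_of_memLp one_le_two hz hTT
  have hzc : ContinuousOn (fun t => ∫ s in t..T, z s) (Icc 0 T) := by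
    have := (continuousOn_primitive_zero hT hzi)
    refine (continuousOn_const (c := ∫ s in (0 : ℝ)..T, z s)).sub this |>.congr fun t ht => ?_
    exact (intervalIntegral.integral_interval_sub_left hzi
      (intervalIntegrable_of_memLp one_le_two hz ht)).symm
  rw [integral_inner_prim hT hy hz]
  simp only [fun n => integral_inner_prim hT (hx n) hz p]
  exact (h _ (memLp_of_continuousOn 2 hzc)).const_add _

end WeakLimitOperations

/-! ### The linear problem as a limit of regularised ones. -/

variable {V H : Type*} [NormedAddCommGroup V] [InnerProductSpace ℝ V] [CompleteSpace V]
  [NormedAddCommGroup H] [InnerProductSpace ℝ H] [CompleteSpace H]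

/-- Solutions `u`, with time derivative `v`, of the linear problem `u'' + A u = g` in `V*`,
`u(0) = p`, `u'(0) = ψ`, in integrated form. -/
structure IsLinSol (T : ℝ) (A : ℝ → V →L[ℝ] V) (j : V →L[ℝ] H) (p : V) (ψ : H) (g : ℝ → H)
    (v : ℝ → H) (u : ℝ → V) : Prop where
  memLp_v : MemLp v ∞ (tmeas T)
  memLp_u : MemLp u ∞ (tmeas T)
  eq_u : ∀ᵐ t ∂(tmeas T), j (u t) = prim (j p) v t
  eq_v : ∀ᵐ t ∂(tmeas T), j.adjoint (v t)
    = prim (j.adjoint ψ) (fun s => j.adjoint (g s) - A s (u s)) t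

/-- The difference has zero data, so the energy estimate bounds it by the difference of the sources
only. -/
theorem IsRegSol.sub {T : ℝ} (hT : 0 ≤ T) {A : ℝ → V →L[ℝ] V} {j : V →L[ℝ] H} {ε : ℝ}
    {p q : V} {g₁ g₂ : ℝ → H} {w₁ w₂ : ℝ → V}
    (h₁ : IsRegSol T A j ε p q g₁ w₁) (h₂ : IsRegSol T A j ε p q g₂ w₂) :
    IsRegSol T A j ε 0 0 (fun t => g₁ t - g₂ t) (fun t => w₁ t - w₂ t) := by
  have hTT : T ∈ Icc 0 T := ⟨hT, le_rfl⟩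
  refine ⟨h₁.memLp.sub h₂.memLp, ?_⟩
  filter_upwards [h₁.eq, h₂.eq, ae_restrict_mem measurableSet_Ioo] with t e₁ e₂ ht'
  have ht := Ioo_subset_Icc_self ht'
  have hc : ∀ {w}, MemLp w 2 (tmeas T) → ContinuousOn (prim q w) (Icc 0 T) := fun hw =>
    continuousOn_prim hT q (intervalIntegrable_of_memLp one_le_two hw hTT)
  have h3 : prim 0 (prim 0 fun t => w₁ t - w₂ t) t
      = prim p (prim q w₁) t - prim p (prim q w₂) t := by
    rw [prim_sub (ContinuousOn.intervalIntegrable_prefix (hc h₁.memLp) ht)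
      (ContinuousOn.intervalIntegrable_prefix (hc h₂.memLp) ht), sub_self]
    refine prim_congr ht.1 fun s hs => ?_
    have hs' : s ∈ Icc 0 T := ⟨hs.1, hs.2.trans ht.2⟩
    rw [prim_sub (intervalIntegrable_of_memLp one_le_two h₁.memLp hs')
      (intervalIntegrable_of_memLp one_le_two h₂.memLp hs'), sub_self]
  rw [map_sub, e₁, e₂, h3, map_sub, map_sub]
  abel

/-- The energy estimate does not control `w`, so the limit is taken in the equation integrated once.
-/
theorem IsRegSol.massOp_prim {T : ℝ} {A : ℝ → V →L[ℝ] V} {j : V →L[ℝ] H} {ε : ℝ} {p q : V} {ψ : H}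
    (hq : massOp j ε q = j.adjoint ψ) {g : ℝ → H} {w : ℝ → V} (hw : IsRegSol T A j ε p q g w)
    {t : ℝ} (ht : t ∈ Icc 0 T) :
    massOp j ε (prim q w t) = prim (j.adjoint ψ)
      (fun s => j.adjoint (g s) - A s (prim p (prim q w) s)) t := by
  rw [prim_map _ _ (intervalIntegrable_of_memLp one_le_two hw.memLp ht), hq]
  exact prim_congr_ae ht hw.eq

theorem memLp_two_of_top {Y : Type*} [NormedAddCommGroup Y] {T : ℝ} {y : ℝ → Y}
    (hy : MemLp y ∞ (tmeas T)) : MemLp y 2 (tmeas T) := hy.mono_exponent le_top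

/-- Passage to the limit in the regularised problem. -/
theorem isLinSol_of_weakLim {T M α : ℝ} (hT : 0 ≤ T) {A : ℝ → V →L[ℝ] V}
    (hA : IsEvolutionForm T M α A) (j : V →L[ℝ] H) (p : V) (ψ : H) {𝒰 : Filter ℕ} [𝒰.NeBot]
    (h𝒰 : 𝒰 ≤ atTop) {ε : ℕ → ℝ} (hε : ∀ n, 0 < ε n) (hε0 : Tendsto ε atTop (𝓝 0)) {q : ℕ → V}
    (hq : ∀ n, massOp j (ε n) (q n) = j.adjoint ψ) {g : ℝ → H} (hg : MemLp g 2 (tmeas T))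
    {w : ℕ → ℝ → V} (hw : ∀ n, IsRegSol T A j (ε n) p (q n) g (w n))
    {v : ℝ → H} {u : ℝ → V} (hv : MemLp v 2 (tmeas T)) (hu : MemLp u 2 (tmeas T))
    (hvlim : WeakLim 𝒰 (tmeas T) (fun n t => j (prim (q n) (w n) t)) v)
    (hulim : WeakLim 𝒰 (tmeas T) (fun n => prim p (prim (q n) (w n))) u) :
    IsLinSol T A j p ψ g v u := by
  have hα := hA.α_pos
  have hM := hA.M_nonneg
  have hTT : T ∈ Icc 0 T := ⟨hT, le_rfl⟩
  have hyc : ∀ n, ContinuousOn (prim (q n) (w n)) (Icc 0 T) := fun n =>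
    continuousOn_prim hT (q n) (intervalIntegrable_of_memLp one_le_two (hw n).memLp hTT)
  have huc : ∀ n, ContinuousOn (prim p (prim (q n) (w n))) (Icc 0 T) := fun n =>
    continuousOn_prim hT p (ContinuousOn.intervalIntegrable_prefix (hyc n) hTT)
  have hjyc : ∀ n, ContinuousOn (fun t => j (prim (q n) (w n) t)) (Icc 0 T) := fun n =>
    j.continuous.comp_continuousOn (hyc n)
  set B := (‖ψ‖ ^ 2 + ‖A 0‖ * ‖p‖ ^ 2 + ∫ s in (0 : ℝ)..T, ‖g s‖ ^ 2)
        * Real.exp ((1 + M / α) * T) with hB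
  have hen : ∀ n, ∀ t ∈ Icc 0 T, ‖j (prim (q n) (w n) t)‖ ^ 2 + ε n * ‖prim (q n) (w n) t‖ ^ 2
      + α * ‖prim p (prim (q n) (w n)) t‖ ^ 2 ≤ B := fun n t ht => by
    refine ((hw n).energy_le hA (hε n).le (hq n) hg ht).trans ?_
    have h1 : ∫ s in (0 : ℝ)..t, ‖g s‖ ^ 2 ≤ ∫ s in (0 : ℝ)..T, ‖g s‖ ^ 2 :=
      intervalIntegral.integral_mono_interval le_rfl ht.1 ht.2
        (Eventually.of_forall fun s => by positivity) (intervalIntegrable_sq_of_memLp hg hTT)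
    have h2 : 0 ≤ ∫ s in (0 : ℝ)..T, ‖g s‖ ^ 2 :=
      intervalIntegral.integral_nonneg hT fun _ _ => by positivity
    rw [hB]
    gcongr
    exact ht.2
  -- The energy bound holds pointwise in time and survives weak limits, which lifts `v` and `u` from
  -- `L²` to `L^∞` in time.
  have hbv : ∀ᵐ t ∂(tmeas T), ‖v t‖ ≤ Real.sqrt B :=
    hvlim.norm_le (fun n => memLp_of_continuousOn 2 (hjyc n)) hv (memLp_const _) fun n => by
      filter_upwards [ae_restrict_mem measurableSet_Ioo] with t ht
      refine Real.le_sqrt_of_sq_le ?_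
      have := hen n t (Ioo_subset_Icc_self ht)
      have h3 := (hε n).le
      nlinarith [mul_nonneg h3 (sq_nonneg ‖prim (q n) (w n) t‖),
        mul_nonneg hα.le (sq_nonneg ‖prim p (prim (q n) (w n)) t‖)]
  have hbu : ∀ᵐ t ∂(tmeas T), ‖u t‖ ≤ Real.sqrt (B / α) :=
    hulim.norm_le (fun n => memLp_of_continuousOn 2 (huc n)) hu (memLp_const _) fun n => by
      filter_upwards [ae_restrict_mem measurableSet_Ioo] with t ht
      refine Real.le_sqrt_of_sq_le ?_
      rw [le_div_iff₀ hα]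
      have := hen n t (Ioo_subset_Icc_self ht)
      have h3 := (hε n).le
      nlinarith [mul_nonneg h3 (sq_nonneg ‖prim (q n) (w n) t‖),
        sq_nonneg ‖j (prim (q n) (w n) t)‖]
  refine ⟨memLp_top_of_bound hv.aestronglyMeasurable _ hbv,
    memLp_top_of_bound hu.aestronglyMeasurable _ hbu, ?_, ?_⟩
  · refine WeakLim.unique (hulim.map j) (hvlim.prim hT (fun n => memLp_of_continuousOn 2 (hjyc n))
      hv (j p)) (j.comp_memLp' hu) (memLp_of_continuousOn 2 (continuousOn_prim hT _
        (intervalIntegrable_of_memLp one_le_two hv hTT))) fun n => ?_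
    filter_upwards [ae_restrict_mem measurableSet_Ioo] with t ht
    exact prim_map j p (ContinuousOn.intervalIntegrable_prefix (hyc n) (Ioo_subset_Icc_self ht))
  · have hAu : ∀ {u}, MemLp u 2 (tmeas T) →
        MemLp (fun s => j.adjoint (g s) - A s (u s)) 2 (tmeas T) := fun hu =>
      (j.adjoint.comp_memLp' hg).sub (hA.memLp_apply hu)
    have hun : ∀ n, MemLp (prim p (prim (q n) (w n))) 2 (tmeas T) := fun n =>
      memLp_of_continuousOn 2 (huc n)
    have hr := ((WeakLim.const (𝒰 := 𝒰) (ν := tmeas T) fun s => j.adjoint (g s)).sub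
      (hulim.evolution hA) (fun n => j.adjoint.comp_memLp' hg)
      (fun n => hA.memLp_apply (hun n)) (j.adjoint.comp_memLp' hg)
      (hA.memLp_apply hu)).prim hT (fun n => hAu (hun n)) (hAu hu) (j.adjoint ψ)
    have hl : WeakLim 𝒰 (tmeas T) (fun n t => massOp j (ε n) (prim (q n) (w n) t))
        (fun t => j.adjoint (v t)) := by
      intro z hz
      have h1 := hvlim.map j.adjoint z hz
      -- The energy controls `ε ‖y‖²` by `B`, hence `‖ε y‖ ≤ √(ε B)` and the regularising term
      -- disappears.
      have h2 : Tendsto (fun n => ∫ t, inner ℝ (z t) (ε n • prim (q n) (w n) t) ∂(tmeas T)) 𝒰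
          (𝓝 0) := by
        refine squeeze_zero_norm (a := fun n => (∫ t, ‖z t‖ ∂(tmeas T)) * Real.sqrt (ε n * B))
          (fun n => ?_) ?_
        · rw [← integral_mul_const]
          refine norm_integral_le_of_norm_le
            ((hz.integrable one_le_two).norm.mul_const _) ?_
          filter_upwards [ae_restrict_mem measurableSet_Ioo] with t ht
          refine (norm_inner_le_norm _ _).trans ?_
          gcongr
          refine Real.le_sqrt_of_sq_le ?_
          rw [norm_smul, mul_pow, Real.norm_of_nonneg (hε n).le, sq (ε n), mul_assoc]
          have h3 := (hε n).le
          gcongr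
          have := hen n t (Ioo_subset_Icc_self ht)
          nlinarith [mul_nonneg hα.le (sq_nonneg ‖prim p (prim (q n) (w n)) t‖),
            sq_nonneg ‖j (prim (q n) (w n) t)‖]
        · have h3 : Tendsto (fun n => (∫ t, ‖z t‖ ∂(tmeas T)) * Real.sqrt (ε n * B)) atTop
              (𝓝 ((∫ t, ‖z t‖ ∂(tmeas T)) * Real.sqrt (0 * B))) :=
            ((hε0.mul_const B).sqrt).const_mul _
          simpa using h3.mono_left h𝒰
      have h3 := h1.add h2
      rw [add_zero] at h3
      refine h3.congr fun n => ?_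
      have i1 := integrable_inner_of_memLp hz
        (j.adjoint.comp_memLp' (memLp_of_continuousOn 2 (hjyc n)))
      have i2 := integrable_inner_of_memLp hz
        ((memLp_of_continuousOn 2 (hyc n)).const_smul (ε n))
      refine (integral_add i1 i2).symm.trans (integral_congr_ae (Eventually.of_forall fun t => ?_))
      exact (inner_add_right _ _ _).symm
    refine WeakLim.unique hl hr (j.adjoint.comp_memLp' hv) (memLp_of_continuousOn 2
      (continuousOn_prim hT _ (intervalIntegrable_of_memLp one_le_two (hAu hu) hTT))) fun n => ?_
    filter_upwards [ae_restrict_mem measurableSet_Ioo] with t ht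
    exact (hw n).massOp_prim (hq n) (Ioo_subset_Icc_self ht)

/-- The solution operator of the linear problem, with its Volterra type estimate. -/
theorem exists_linear_solution_operator {T M α : ℝ} (hT : 0 ≤ T) {A : ℝ → V →L[ℝ] V}
    (hA : IsEvolutionForm T M α A) (j : V →L[ℝ] H) (p : V) (ψ : H) :
    ∃ (K : ℝ) (Sv : (ℝ → H) → ℝ → H) (Su : (ℝ → H) → ℝ → V), 0 ≤ K ∧
      (∀ g, MemLp g 2 (tmeas T) → IsLinSol T A j p ψ g (Sv g) (Su g)) ∧
      ∀ g₁ g₂, MemLp g₁ 2 (tmeas T) → MemLp g₂ 2 (tmeas T) → ∀ᵐ t ∂(tmeas T),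
        ‖Sv g₁ t - Sv g₂ t‖ ^ 2 ≤ K * ∫ s in (0 : ℝ)..t, ‖g₁ s - g₂ s‖ ^ 2 := by
  classical
  have hα := hA.α_pos
  have hM := hA.M_nonneg
  have hTT : T ∈ Icc 0 T := ⟨hT, le_rfl⟩
  set ε : ℕ → ℝ := fun n => 1 / ((n : ℝ) + 1) with hεdef
  have hε : ∀ n, 0 < ε n := fun n => Nat.one_div_pos_of_nat
  have hε0 : Tendsto ε atTop (𝓝 0) := tendsto_one_div_add_atTop_nhds_zero_nat
  have hq : ∀ n, ∃ q : V, massOp j (ε n) q = j.adjoint ψ := fun n => by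
    obtain ⟨R, hR⟩ := exists_massOp_inverse j (hε n)
    exact ⟨R (j.adjoint ψ), hR _⟩
  choose q hq using hq
  -- The same ultrafilter serves every source. Differences of limits are then limits of differences,
  -- so the energy estimate for differences passes to the limit.
  set 𝒰 : Ultrafilter ℕ := hyperfilter ℕ
  have h𝒰 : (𝒰 : Filter ℕ) ≤ atTop := Nat.hyperfilter_le_atTop
  have hw : ∀ g : ℝ → H, ∃ w : ℕ → ℝ → V, MemLp g 2 (tmeas T) →
      ∀ n, IsRegSol T A j (ε n) p (q n) g (w n) := fun g => by
    by_cases hg : MemLp g 2 (tmeas T)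
    · choose w hw using fun n => exists_regSol hT hA j (hε n) p (q n) hg
      exact ⟨w, fun _ => hw⟩
    · exact ⟨0, fun h => absurd h hg⟩
  choose w hw using hw
  have hyc : ∀ g, MemLp g 2 (tmeas T) → ∀ n, ContinuousOn (prim (q n) (w g n)) (Icc 0 T) :=
    fun g hg n => continuousOn_prim hT (q n)
      (intervalIntegrable_of_memLp one_le_two (hw g hg n).memLp hTT)
  have hjyc : ∀ g, MemLp g 2 (tmeas T) → ∀ n,
      ContinuousOn (fun t => j (prim (q n) (w g n) t)) (Icc 0 T) := fun g hg n =>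
    j.continuous.comp_continuousOn (hyc g hg n)
  have huc : ∀ g, MemLp g 2 (tmeas T) → ∀ n,
      ContinuousOn (prim p (prim (q n) (w g n))) (Icc 0 T) := fun g hg n =>
    continuousOn_prim hT p (ContinuousOn.intervalIntegrable_prefix (hyc g hg n) hTT)
  have hlim : ∀ g : ℝ → H, ∃ (v : ℝ → H) (u : ℝ → V), MemLp g 2 (tmeas T) →
      MemLp v 2 (tmeas T) ∧ MemLp u 2 (tmeas T) ∧
      WeakLim 𝒰 (tmeas T) (fun n t => j (prim (q n) (w g n) t)) v ∧
      WeakLim 𝒰 (tmeas T) (fun n => prim p (prim (q n) (w g n))) u := fun g => by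
    by_cases hg : MemLp g 2 (tmeas T)
    · have hen : ∀ n, ∀ᵐ t ∂(tmeas T), ‖j (prim (q n) (w g n) t)‖ ^ 2
          + α * ‖prim p (prim (q n) (w g n)) t‖ ^ 2 ≤
          (‖ψ‖ ^ 2 + ‖A 0‖ * ‖p‖ ^ 2 + ∫ s in (0 : ℝ)..T, ‖g s‖ ^ 2)
            * Real.exp ((1 + M / α) * T) := fun n => by
        filter_upwards [ae_restrict_mem measurableSet_Ioo] with t ht'
        have ht := Ioo_subset_Icc_self ht'
        have h0 := (hw g hg n).energy_le hA (hε n).le (hq n) hg ht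
        have h1 : ∫ s in (0 : ℝ)..t, ‖g s‖ ^ 2 ≤ ∫ s in (0 : ℝ)..T, ‖g s‖ ^ 2 :=
          intervalIntegral.integral_mono_interval le_rfl ht.1 ht.2
            (Eventually.of_forall fun s => by positivity) (intervalIntegrable_sq_of_memLp hg hTT)
        have h2 : 0 ≤ ∫ s in (0 : ℝ)..T, ‖g s‖ ^ 2 :=
          intervalIntegral.integral_nonneg hT fun _ _ => by positivity
        have h3 : (‖ψ‖ ^ 2 + ‖A 0‖ * ‖p‖ ^ 2 + ∫ s in (0 : ℝ)..t, ‖g s‖ ^ 2)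
            * Real.exp ((1 + M / α) * t) ≤
          (‖ψ‖ ^ 2 + ‖A 0‖ * ‖p‖ ^ 2 + ∫ s in (0 : ℝ)..T, ‖g s‖ ^ 2)
            * Real.exp ((1 + M / α) * T) := by gcongr; exact ht.2
        have h4 : 0 ≤ ε n * ‖prim (q n) (w g n) t‖ ^ 2 := by have := hε n; positivity
        linarith
      set B := (‖ψ‖ ^ 2 + ‖A 0‖ * ‖p‖ ^ 2 + ∫ s in (0 : ℝ)..T, ‖g s‖ ^ 2)
            * Real.exp ((1 + M / α) * T)
      obtain ⟨v, hv, hvl⟩ := exists_weakLim 𝒰 (x := fun n t => j (prim (q n) (w g n) t))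
        (fun n => memLp_of_continuousOn 2 (hjyc g hg n)) (C := ∫ _, B ∂(tmeas T)) (fun n => by
          have h := memLp_of_continuousOn 2 (hjyc g hg n)
          refine integral_mono_ae (by simpa using h.integrable_norm_pow (by norm_num))
            (integrable_const _) ?_
          filter_upwards [hen n] with t ht
          nlinarith [mul_nonneg hα.le (sq_nonneg ‖prim p (prim (q n) (w g n)) t‖)])
      obtain ⟨u, hu, hul⟩ := exists_weakLim 𝒰 (x := fun n => prim p (prim (q n) (w g n)))
        (fun n => memLp_of_continuousOn 2 (huc g hg n)) (C := ∫ _, B / α ∂(tmeas T)) (fun n => by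
          have h := memLp_of_continuousOn 2 (huc g hg n)
          refine integral_mono_ae (by simpa using h.integrable_norm_pow (by norm_num))
            (integrable_const _) ?_
          filter_upwards [hen n] with t ht
          rw [le_div_iff₀ hα]
          nlinarith [sq_nonneg ‖j (prim (q n) (w g n) t)‖])
      exact ⟨v, u, fun _ => ⟨hv, hu, hvl, hul⟩⟩
    · exact ⟨0, 0, fun h => absurd h hg⟩
  choose Sv Su hS using hlim
  refine ⟨Real.exp ((1 + M / α) * T), Sv, Su, (Real.exp_pos _).le, fun g hg => ?_,
    fun g₁ g₂ h₁ h₂ => ?_⟩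
  · obtain ⟨hv, hu, hvl, hul⟩ := hS g hg
    exact isLinSol_of_weakLim hT hA j p ψ h𝒰 hε hε0 hq hg (hw g hg) hv hu hvl hul
  · obtain ⟨hv₁, -, hvl₁, -⟩ := hS g₁ h₁
    obtain ⟨hv₂, -, hvl₂, -⟩ := hS g₂ h₂
    have hd := hvl₁.sub hvl₂ (fun n => memLp_of_continuousOn 2 (hjyc g₁ h₁ n))
      (fun n => memLp_of_continuousOn 2 (hjyc g₂ h₂ n)) hv₁ hv₂
    have hm : ContinuousOn (fun t => Real.sqrt (Real.exp ((1 + M / α) * T)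
        * ∫ s in (0 : ℝ)..t, ‖g₁ s - g₂ s‖ ^ 2)) (Icc 0 T) :=
      (continuousOn_const.mul (continuousOn_primitive_zero hT
        (intervalIntegrable_sq_of_memLp (h₁.sub h₂) hTT))).sqrt
    have := hd.norm_le (fun n => (memLp_of_continuousOn 2 (hjyc g₁ h₁ n)).sub
      (memLp_of_continuousOn 2 (hjyc g₂ h₂ n))) (hv₁.sub hv₂) (memLp_of_continuousOn 2 hm)
      (fun n => by
        filter_upwards [ae_restrict_mem measurableSet_Ioo] with t ht'
        have ht := Ioo_subset_Icc_self ht'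
        have hr := (IsRegSol.sub hT (hw g₁ h₁ n) (hw g₂ h₂ n)).energy_le hA (hε n).le
          (ψ := 0) (by simp) (h₁.sub h₂) ht
        rw [← map_sub, prim_sub (intervalIntegrable_of_memLp one_le_two (hw g₁ h₁ n).memLp ht)
          (intervalIntegrable_of_memLp one_le_two (hw g₂ h₂ n).memLp ht), sub_self]
        refine Real.le_sqrt_of_sq_le ?_
        simp only [Pi.sub_apply, norm_zero, ne_eq, OfNat.ofNat_ne_zero, not_false_eq_true, zero_pow,
          mul_zero, zero_add] at hr
        have h3 : 0 ≤ ∫ s in (0 : ℝ)..t, ‖g₁ s - g₂ s‖ ^ 2 :=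
          intervalIntegral.integral_nonneg ht.1 fun _ _ => by positivity
        have h4 : (∫ s in (0 : ℝ)..t, ‖g₁ s - g₂ s‖ ^ 2) * Real.exp ((1 + M / α) * t)
            ≤ Real.exp ((1 + M / α) * T) * ∫ s in (0 : ℝ)..t, ‖g₁ s - g₂ s‖ ^ 2 := by
          rw [mul_comm]; gcongr; exact ht.2
        have h5 := hε n
        have h6 : 0 ≤ ε n * ‖prim 0 (fun s => w g₁ n s - w g₂ n s) t‖ ^ 2 := by positivity
        have h7 : 0 ≤ α * ‖prim 0 (prim 0 fun s => w g₁ n s - w g₂ n s) t‖ ^ 2 := by positivity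
        linarith)
    filter_upwards [this, ae_restrict_mem measurableSet_Ioo] with t ht ht'
    have h3 : 0 ≤ ∫ s in (0 : ℝ)..t, ‖g₁ s - g₂ s‖ ^ 2 :=
      intervalIntegral.integral_nonneg ht'.1.le fun _ _ => by positivity
    calc _ ≤ (Real.sqrt (Real.exp ((1 + M / α) * T)
        * ∫ s in (0 : ℝ)..t, ‖g₁ s - g₂ s‖ ^ 2)) ^ 2 := by gcongr
      _ = _ := Real.sq_sqrt (by positivity)

/-! ### The nonlinear fixed point. -/

/-- Solvability of the evolution problem with a causal Lipschitz perturbation `N` of the velocity. -/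
theorem exists_isLinSol_nonlinear {V H : Type*} [NormedAddCommGroup V] [InnerProductSpace ℝ V]
    [CompleteSpace V] [NormedAddCommGroup H] [InnerProductSpace ℝ H] [CompleteSpace H]
    {T M α : ℝ} (hT : 0 ≤ T) {A : ℝ → V →L[ℝ] V}
    (hA : IsEvolutionForm T M α A) (j : V →L[ℝ] H) (p : V) (ψ : H) {N : (ℝ → H) → ℝ → H}
    (hN : ∀ v, MemLp v ∞ (tmeas T) → MemLp (N v) 2 (tmeas T)) {L : ℝ}
    (hL : ∀ v₁ v₂, MemLp v₁ ∞ (tmeas T) → MemLp v₂ ∞ (tmeas T) → ∀ᵐ t ∂(tmeas T), ∀ m : ℝ, 0 ≤ m →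
      (∀ᵐ s ∂(tmeas t), ‖v₁ s - v₂ s‖ ≤ m) → ‖N v₁ t - N v₂ t‖ ≤ L * m) :
    ∃ v u, IsLinSol T A j p ψ (N v) v u := by
  obtain ⟨K, Sv, Su, hK, hS, hSK⟩ := exists_linear_solution_operator hT hA j p ψ
  -- The unknown of the fixed point is the source `g`, not the velocity.
  obtain ⟨g, hg, hfix⟩ := exists_volterra_fixedPoint hT (F := fun g => N (Sv g)) (K := L ^ 2 * K)
    (fun g hg => hN _ (hS g hg).memLp_v) (fun g₁ g₂ h₁ h₂ => by
      have hdiff := hSK g₁ g₂ h₁ h₂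
      filter_upwards [hL _ _ (hS g₁ h₁).memLp_v (hS g₂ h₂).memLp_v,
        ae_restrict_mem measurableSet_Ioo] with t ht ht'
      have htT := Ioo_subset_Icc_self ht'
      have h3 : 0 ≤ ∫ s in (0 : ℝ)..t, ‖g₁ s - g₂ s‖ ^ 2 :=
        intervalIntegral.integral_nonneg htT.1 fun _ _ => by positivity
      -- The integral up to `s` increases with `s`, so its value at `t` bounds the velocity
      -- difference on all of `(0,t)`.
      have h4 := ht (Real.sqrt (K * ∫ s in (0 : ℝ)..t, ‖g₁ s - g₂ s‖ ^ 2)) (Real.sqrt_nonneg _) (by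
        filter_upwards [ae_restrict_of_ae_restrict_of_subset (Ioo_subset_Ioo_right htT.2) hdiff,
          ae_restrict_mem measurableSet_Ioo] with s hs hs'
        refine Real.le_sqrt_of_sq_le (hs.trans ?_)
        gcongr
        exact intervalIntegral.integral_mono_interval le_rfl hs'.1.le hs'.2.le
          (Eventually.of_forall fun s => by positivity)
          (intervalIntegrable_sq_of_memLp (h₁.sub h₂) htT))
      calc _ ≤ (L * Real.sqrt (K * ∫ s in (0 : ℝ)..t, ‖g₁ s - g₂ s‖ ^ 2)) ^ 2 := by gcongr
        _ = _ := by rw [mul_pow, Real.sq_sqrt (by positivity)]; ring)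
  have h := hS g hg
  refine ⟨Sv g, Su g, h.memLp_v, h.memLp_u, h.eq_u, ?_⟩
  filter_upwards [h.eq_v, ae_restrict_mem measurableSet_Ioo] with t ht ht'
  rw [ht]
  refine prim_congr_ae (Ioo_subset_Icc_self ht') ?_
  filter_upwards [hfix] with s hs
  rw [← hs]

/-! ### Lipschitz representatives of operator families. -/

/-- The exceptional set inside `(0,T)` is open and null, hence empty; the endpoints follow by
closure. -/
theorem le_of_ae_le_of_continuous {T c : ℝ} (hT : 0 < T) {f : ℝ → ℝ} (hf : Continuous f)
    (h : ∀ᵐ t ∂(tmeas T), c ≤ f t) : ∀ t ∈ Icc 0 T, c ≤ f t := by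
  have h1 : ∀ t ∈ Ioo 0 T, c ≤ f t := by
    have ho : IsOpen ({t | f t < c} ∩ Ioo 0 T) := (isOpen_lt hf continuous_const).inter isOpen_Ioo
    have h0 : volume ({t | f t < c} ∩ Ioo 0 T) = 0 := by
      rw [ae_iff, Measure.restrict_apply' measurableSet_Ioo] at h
      simpa only [not_le] using h
    have := (ho.measure_eq_zero_iff volume).1 h0
    intro t ht
    by_contra hc
    exact (this.subset ⟨not_le.1 hc, ht⟩ : t ∈ (∅ : Set ℝ))
  have h2 : closure (Ioo 0 T) ⊆ {t | c ≤ f t} :=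
    closure_minimal h1 (isClosed_le continuous_const hf)
  rw [closure_Ioo hT.ne] at h2
  exact h2

theorem tmeas_neBot {T : ℝ} (hT : 0 < T) : (ae (tmeas T)).NeBot := by
  rw [ae_neBot]
  intro h
  have := Measure.restrict_eq_zero.1 h
  simp [hT.not_ge] at this

/-- A family of self-adjoint operators with a bounded weak time derivative coincides almost
everywhere with a Lipschitz continuous family. -/
theorem exists_evolutionForm {V : Type*} [NormedAddCommGroup V] [InnerProductSpace ℝ V]
    [CompleteSpace V] [TopologicalSpace.SeparableSpace V] {T M C α : ℝ} (hT : 0 < T) (hα : 0 < α)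
    (hM : 0 ≤ M) {a b : ℝ → V →L[ℝ] V} (haC : ∀ t, ‖a t‖ ≤ C) (hbM : ∀ t, ‖b t‖ ≤ M)
    (hbm : ∀ u w, AEStronglyMeasurable (fun t => inner ℝ (b t u) w) (tmeas T))
    (hasym : ∀ t u w, inner ℝ (a t u) w = inner ℝ u (a t w))
    (hbsym : ∀ t u w, inner ℝ (b t u) w = inner ℝ u (b t w))
    (hab : ∀ u w, ∃ c : ℝ, ∀ᵐ t ∂(tmeas T),
      inner ℝ (a t u) w = c + ∫ s in (0 : ℝ)..t, inner ℝ (b s u) w)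
    (hco : ∀ u, ∀ᵐ t ∂(tmeas T), α * ‖u‖ ^ 2 ≤ inner ℝ (a t u) u) :
    ∃ A : ℝ → V →L[ℝ] V, IsEvolutionForm T M α A ∧ ∀ᵐ t ∂(tmeas T), a t = A t := by
  have hne := tmeas_neBot hT
  choose c hc using hab
  -- Clamping time to `[0,T]` defines the family on all of `ℝ` with a global Lipschitz bound.
  set τ : ℝ → ℝ := fun t => projIcc 0 T hT.le t with hτ
  have hτm : ∀ t, τ t ∈ Icc 0 T := fun t => (projIcc 0 T hT.le t).2
  have hτid : ∀ t ∈ Icc 0 T, τ t = t := fun t ht => by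
    simp only [hτ, projIcc_of_mem _ ht]
  have hτL : ∀ s t, |τ s - τ t| ≤ |s - t| := fun s t => by
    have := (LipschitzWith.projIcc hT.le).dist_le_mul s t
    rwa [NNReal.coe_one, one_mul, Real.dist_eq, Subtype.dist_eq, Real.dist_eq] at this
  have hbb : ∀ s u w, ‖inner ℝ (b s u) w‖ ≤ M * ‖u‖ * ‖w‖ := fun s u w =>
    (norm_inner_le_norm _ _).trans (by gcongr; exact (b s).le_of_opNorm_le (hbM s) u)
  have hbi : ∀ u w, ∀ t ∈ Icc 0 T, IntervalIntegrable (fun s => inner ℝ (b s u) w) volume 0 t :=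
    fun u w t ht => intervalIntegrable_of_memLp (p := ∞) le_top
      (memLp_top_of_bound (hbm u w) _ (Eventually.of_forall fun s => hbb s u w)) ht
  -- The null sets in `hc` depend on the vectors, but `c` does not depend on time, so each identity
  -- for `c` needs only one good instant.
  have hex : ∀ {P : ℝ → Prop}, (∀ᵐ t ∂(tmeas T), P t) → ∃ t ∈ Icc 0 T, P t := fun h => by
    obtain ⟨t, h1, h2⟩ := (h.and (ae_restrict_mem measurableSet_Ioo)).exists
    exact ⟨t, Ioo_subset_Icc_self h2, h1⟩
  have cadd1 : ∀ u₁ u₂ w, c (u₁ + u₂) w = c u₁ w + c u₂ w := fun u₁ u₂ w => by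
    obtain ⟨t, ht, h1, h2, h3⟩ := hex ((hc (u₁ + u₂) w).and ((hc u₁ w).and (hc u₂ w)))
    simp only [map_add, inner_add_left] at h1
    rw [intervalIntegral.integral_add (hbi _ _ t ht) (hbi _ _ t ht)] at h1
    linarith
  have cadd2 : ∀ u w₁ w₂, c u (w₁ + w₂) = c u w₁ + c u w₂ := fun u w₁ w₂ => by
    obtain ⟨t, ht, h1, h2, h3⟩ := hex ((hc u (w₁ + w₂)).and ((hc u w₁).and (hc u w₂)))
    simp only [inner_add_right] at h1
    rw [intervalIntegral.integral_add (hbi _ _ t ht) (hbi _ _ t ht)] at h1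
    linarith
  have csmul1 : ∀ (k : ℝ) u w, c (k • u) w = k * c u w := fun k u w => by
    obtain ⟨t, ht, h1, h2⟩ := hex ((hc (k • u) w).and (hc u w))
    simp only [map_smul, real_inner_smul_left, intervalIntegral.integral_const_mul] at h1
    rw [h2] at h1
    linarith
  have csmul2 : ∀ (k : ℝ) u w, c u (k • w) = k * c u w := fun k u w => by
    obtain ⟨t, ht, h1, h2⟩ := hex ((hc u (k • w)).and (hc u w))
    simp only [real_inner_smul_right, intervalIntegral.integral_const_mul] at h1
    rw [h2] at h1
    linarith
  have csym : ∀ u w, c u w = c w u := fun u w => by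
    obtain ⟨t, ht, h1, h2⟩ := hex ((hc u w).and (hc w u))
    have e : ∀ s, inner ℝ (b s w) u = inner ℝ (b s u) w := fun s => by
      rw [hbsym s u w, real_inner_comm]
    simp only [e] at h2
    rw [hasym t w u, real_inner_comm] at h2
    linarith
  have hint : ∀ u w x y, |∫ s in x..y, inner ℝ (b s u) w| ≤ M * ‖u‖ * ‖w‖ * |y - x| :=
    fun u w x y => intervalIntegral.norm_integral_le_of_norm_le_const fun s _ => hbb s u w
  have cbound : ∀ u w, |c u w| ≤ (C + M * T) * ‖u‖ * ‖w‖ := fun u w => by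
    obtain ⟨t, ht, h1⟩ := hex (hc u w)
    have h2 : |inner ℝ (a t u) w| ≤ C * ‖u‖ * ‖w‖ :=
      (abs_real_inner_le_norm _ _).trans (by gcongr; exact (a t).le_of_opNorm_le (haC t) u)
    have h3 := hint u w 0 t
    rw [sub_zero, abs_of_nonneg ht.1] at h3
    have h4 : M * ‖u‖ * ‖w‖ * t ≤ M * ‖u‖ * ‖w‖ * T := by gcongr; exact ht.2
    have h5 : c u w = inner ℝ (a t u) w - ∫ s in (0 : ℝ)..t, inner ℝ (b s u) w := by linarith
    rw [h5]
    refine (abs_sub _ _).trans ?_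
    linarith
  let Bl : ℝ → V →ₗ[ℝ] V →ₗ[ℝ] ℝ := fun t =>
    LinearMap.mk₂ ℝ (fun u w => c u w + ∫ s in (0 : ℝ)..τ t, inner ℝ (b s u) w)
      (fun u₁ u₂ w => by
        simp only [map_add, inner_add_left]
        rw [intervalIntegral.integral_add (hbi _ _ _ (hτm t)) (hbi _ _ _ (hτm t)), cadd1]; ring)
      (fun k u w => by
        simp only [map_smul, real_inner_smul_left, intervalIntegral.integral_const_mul, csmul1,
          smul_eq_mul]
        ring)
      (fun u w₁ w₂ => by
        simp only [inner_add_right]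
        rw [intervalIntegral.integral_add (hbi _ _ _ (hτm t)) (hbi _ _ _ (hτm t)), cadd2]; ring)
      (fun k u w => by
        simp only [real_inner_smul_right, intervalIntegral.integral_const_mul, csmul2,
          smul_eq_mul]
        ring)
  let Bc : ℝ → V →L[ℝ] V →L[ℝ] ℝ := fun t =>
    (Bl t).mkContinuous₂ (C + M * T + M * T) (fun u w => by
      have h3 := hint u w 0 (τ t)
      rw [sub_zero, abs_of_nonneg (hτm t).1] at h3
      have h4 : M * ‖u‖ * ‖w‖ * τ t ≤ M * ‖u‖ * ‖w‖ * T := by gcongr; exact (hτm t).2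
      have h5 := cbound u w
      change |c u w + ∫ s in (0 : ℝ)..τ t, inner ℝ (b s u) w| ≤ _
      refine (abs_add_le _ _).trans ?_
      linarith)
  let A : ℝ → V →L[ℝ] V := fun t => InnerProductSpace.continuousLinearMapOfBilin (Bc t)
  have hA : ∀ t u w, inner ℝ (A t u) w = c u w + ∫ s in (0 : ℝ)..τ t, inner ℝ (b s u) w :=
    fun t u w => InnerProductSpace.continuousLinearMapOfBilin_apply (Bc t) u w
  have hAeq : ∀ u w, ∀ᵐ t ∂(tmeas T), inner ℝ (a t u) w = inner ℝ (A t u) w := fun u w => by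
    filter_upwards [hc u w, ae_restrict_mem measurableSet_Ioo] with t h1 h2
    rw [h1, hA, hτid t (Ioo_subset_Icc_self h2)]
  have hLip : ∀ s t, ‖A s - A t‖ ≤ M * |s - t| := fun s t => by
    refine ContinuousLinearMap.opNorm_le_bound _ (by positivity) fun u => ?_
    set z := (A s - A t) u with hz
    have h1 : ‖z‖ ^ 2 ≤ M * ‖u‖ * ‖z‖ * |s - t| := by
      rw [← real_inner_self_eq_norm_sq]
      have h2 : inner ℝ z z = ∫ r in τ t..τ s, inner ℝ (b r u) z := by
        nth_rewrite 1 [hz]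
        rw [sub_apply, inner_sub_left, hA, hA,
          ← intervalIntegral.integral_interval_sub_left (hbi _ _ _ (hτm s)) (hbi _ _ _ (hτm t))]
        ring
      rw [h2]
      refine (le_abs_self _).trans ((hint u z _ _).trans ?_)
      exact mul_le_mul_of_nonneg_left (hτL s t) (by positivity)
    rcases (norm_nonneg z).eq_or_lt with h0 | h0
    · rw [← h0]; positivity
    · nlinarith
  have hAc : Continuous A := by
    refine (LipschitzWith.of_dist_le_mul (K := ⟨M, hM⟩) fun s t => ?_).continuous
    rw [dist_eq_norm, Real.dist_eq]; exact hLip s t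
  refine ⟨A, ⟨hM, hα, hLip, fun t x y => ?_, fun t ht x => ?_⟩, ?_⟩
  · have e : ∀ s, inner ℝ (b s y) x = inner ℝ (b s x) y := fun s => by
      rw [hbsym s x y, real_inner_comm]
    rw [real_inner_comm (A t y) x, hA, hA, csym]
    simp only [e]
  · refine le_of_ae_le_of_continuous hT (f := fun t => inner ℝ (A t x) x) (by fun_prop) ?_ t ht
    filter_upwards [hco x, hAeq x x] with s h1 h2
    rwa [← h2]
  -- A countable dense set merges the null sets of `hAeq` into one; continuity then gives equality
  -- of operators.
  · set D := TopologicalSpace.denseSeq V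
    have hD : DenseRange D := TopologicalSpace.denseRange_denseSeq V
    have hall : ∀ᵐ t ∂(tmeas T), ∀ m n, inner ℝ (a t (D m)) (D n) = inner ℝ (A t (D m)) (D n) :=
      ae_all_iff.2 fun m => ae_all_iff.2 fun n => hAeq _ _
    filter_upwards [hall] with t ht
    have h1 : ∀ m, a t (D m) = A t (D m) := fun m => by
      refine ext_inner_right ℝ fun w => ?_
      exact congrFun (hD.equalizer (g := fun w => inner ℝ (a t (D m)) w)
        (h := fun w => inner ℝ (A t (D m)) w) (by fun_prop) (by fun_prop) (funext fun n => ht m n)) w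
    ext u
    exact congrFun (hD.equalizer (a t).continuous (A t).continuous (funext h1)) u

/-! ### The du Bois-Reymond lemma. -/

theorem exists_Icc_of_isCompact_subset_Ioo {T : ℝ} (hT : 0 < T) {K : Set ℝ} (hK : IsCompact K)
    (hKT : K ⊆ Ioo 0 T) : ∃ a b, 0 < a ∧ b < T ∧ K ⊆ Icc a b := by
  rcases K.eq_empty_or_nonempty with rfl | hne
  · exact ⟨T, 0, hT, hT, empty_subset _⟩
  · exact ⟨sInf K, sSup K, (hKT (hK.sInf_mem hne)).1, (hKT (hK.sSup_mem hne)).2, fun x hx =>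
      ⟨csInf_le hK.bddBelow hx, le_csSup hK.bddAbove hx⟩⟩

/-- The primitive of a test function with zero mean is a test function. -/
theorem isTestFunction_primitive {T : ℝ} (hT : 0 < T) {φ : ℝ → ℝ} (hφ : IsTestFunction (Ioo 0 T) φ)
    (h0 : ∫ t in (0 : ℝ)..T, φ t = 0) :
    IsTestFunction (Ioo 0 T) (fun t => ∫ s in (0 : ℝ)..t, φ s) := by
  obtain ⟨h1, h2, h3⟩ := hφ
  obtain ⟨a, b, ha, hb, hK⟩ := exists_Icc_of_isCompact_subset_Ioo hT h2 h3
  have hd : ∀ t, HasDerivAt (fun t => ∫ s in (0 : ℝ)..t, φ s) (φ t) t := fun t =>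
    intervalIntegral.integral_hasDerivAt_right (h1.continuous.intervalIntegrable _ _)
      (h1.continuous.stronglyMeasurableAtFilter _ _) h1.continuous.continuousAt
  have hz : ∀ s, s ∉ Icc a b → φ s = 0 := fun s hs => by
    by_contra h
    exact hs (hK (subset_tsupport φ h))
  -- To the left of `a` the integrand vanishes; to the right of `b` the primitive equals the total
  -- integral, which is zero.
  have hsupp : Function.support (fun t => ∫ s in (0 : ℝ)..t, φ s) ⊆ Icc a b := by
    intro t ht
    by_contra htn
    refine ht ?_
    rw [mem_Icc, not_and_or, not_le, not_le] at htn
    rcases htn with h | h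
    · refine intervalIntegral.integral_zero_ae (Eventually.of_forall fun s hs => hz s fun hs' => ?_)
      rcases le_total 0 t with h0t | h0t
      · rw [uIoc_of_le h0t] at hs; linarith [hs.2, hs'.1]
      · rw [uIoc_of_ge h0t] at hs; linarith [hs.2, hs'.1]
    · have e : (∫ s in (0 : ℝ)..t, φ s) + ∫ s in t..T, φ s = ∫ s in (0 : ℝ)..T, φ s :=
        intervalIntegral.integral_add_adjacent_intervals (h1.continuous.intervalIntegrable _ _)
          (h1.continuous.intervalIntegrable _ _)
      have e2 : ∫ s in t..T, φ s = 0 := by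
        refine intervalIntegral.integral_zero_ae
          (Eventually.of_forall fun s hs => hz s fun hs' => ?_)
        rcases le_total t T with h0t | h0t
        · rw [uIoc_of_le h0t] at hs; linarith [hs.1, hs'.2]
        · rw [uIoc_of_ge h0t] at hs; linarith [hs.1, hs'.2]
      simp only
      linarith
  refine ⟨contDiff_infty_iff_deriv.2 ⟨fun t => (hd t).differentiableAt, ?_⟩,
    HasCompactSupport.of_support_subset_isCompact isCompact_Icc hsupp,
    (closure_minimal hsupp isClosed_Icc).trans fun t ht => ⟨ha.trans_le ht.1, ht.2.trans_lt hb⟩⟩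
  have : deriv (fun t => ∫ s in (0 : ℝ)..t, φ s) = φ := funext fun t => (hd t).deriv
  rw [this]; exact h1

/-- A bump of unit mass is used to correct the mean of an arbitrary test function. -/
theorem exists_isTestFunction_integral_eq_one {T : ℝ} (hT : 0 < T) :
    ∃ η : ℝ → ℝ, IsTestFunction (Ioo 0 T) η ∧ ∫ t in (0 : ℝ)..T, η t = 1 := by
  let f : ContDiffBump (T / 2) := ⟨T / 8, T / 4, by positivity, by linarith⟩
  have hsub : tsupport (f.normed volume) ⊆ Ioo 0 T := by
    rw [f.tsupport_normed_eq, Real.closedBall_eq_Icc]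
    rintro x ⟨h1, h2⟩
    change T / 2 - T / 4 ≤ x at h1
    change x ≤ T / 2 + T / 4 at h2
    constructor <;> linarith
  refine ⟨f.normed volume, ⟨f.contDiff_normed, f.hasCompactSupport_normed, hsub⟩, ?_⟩
  rw [← f.integral_normed (μ := volume), ← integral_tmeas hT.le]
  exact setIntegral_eq_integral_of_forall_compl_eq_zero fun x hx => by
    by_contra h
    exact hx (hsub (subset_tsupport _ h))

/-- The du Bois-Reymond lemma: a function on `(0,T)` with an integrable weak derivative is
absolutely continuous. -/
theorem exists_eq_const_add_integral {T : ℝ} (hT : 0 < T) {h k : ℝ → ℝ}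
    (hh : Integrable h (tmeas T)) (hk : Integrable k (tmeas T))
    (hw : ∀ φ, IsTestFunction (Ioo 0 T) φ →
      ∫ t, deriv φ t * h t ∂(tmeas T) = -∫ t, φ t * k t ∂(tmeas T)) :
    ∃ c : ℝ, ∀ᵐ t ∂(tmeas T), h t = c + ∫ s in (0 : ℝ)..t, k s := by
  have hki : IntervalIntegrable k volume 0 T := by
    rwa [intervalIntegrable_iff_integrableOn_Ioo_of_le hT.le]
  have hprim := continuousOn_primitive_zero hT.le hki
  set g : ℝ → ℝ := fun t => h t - ∫ s in (0 : ℝ)..t, k s with hg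
  have hpi : Integrable (fun t => ∫ s in (0 : ℝ)..t, k s) (tmeas T) :=
    (memLp_of_continuousOn 1 hprim).integrable le_rfl
  have hgi : Integrable g (tmeas T) := hh.sub hpi
  have hmul : ∀ {φ : ℝ → ℝ} {f : ℝ → ℝ}, Continuous φ → Integrable f (tmeas T) →
      Integrable (fun t => φ t * f t) (tmeas T) := fun {φ f} hφ hf => by
    obtain ⟨C, hC⟩ := (isCompact_Icc (a := (0 : ℝ)) (b := T)).exists_bound_of_continuousOn
      hφ.continuousOn
    refine hf.bdd_mul (c := C) hφ.aestronglyMeasurable ?_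
    filter_upwards [ae_restrict_mem measurableSet_Ioo] with t ht
    exact hC t (Ioo_subset_Icc_self ht)
  have hzero : ∀ φ : ℝ → ℝ, IsTestFunction (Ioo 0 T) φ → (0 : ℝ) = φ 0 ∧ 0 = φ T := fun φ hφ => by
    constructor
    · by_contra h
      exact absurd (hφ.2.2 (subset_tsupport φ (Ne.symm h))).1 (lt_irrefl _)
    · by_contra h
      exact absurd (hφ.2.2 (subset_tsupport φ (Ne.symm h))).2 (lt_irrefl _)
  have hg0 : ∀ φ, IsTestFunction (Ioo 0 T) φ → ∫ t, deriv φ t * g t ∂(tmeas T) = 0 :=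
    fun φ hφ => by
      have hφ1 : ContDiff ℝ 1 φ := hφ.1.of_le (by simp)
      have h1 := integral_deriv_smul_primitive hT.le hφ1 (hzero φ hφ).1.symm (hzero φ hφ).2.symm
        0 hki
      simp only [zero_add, smul_eq_mul] at h1
      simp only [hg, mul_sub]
      rw [integral_sub (hmul (hφ1.continuous_deriv le_rfl) hh)
        (hmul (hφ1.continuous_deriv le_rfl) hpi), hw φ hφ, integral_tmeas hT.le,
        integral_tmeas hT.le, h1]
      ring
  obtain ⟨η, hη, hη1⟩ := exists_isTestFunction_integral_eq_one hT
  set c := ∫ t, η t * g t ∂(tmeas T) with hc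
  have key : ∀ᵐ t ∂volume, t ∈ Ioo 0 T → g t - c = 0 := by
    refine isOpen_Ioo.ae_eq_zero_of_integral_contDiff_smul_eq_zero
      (IntegrableOn.locallyIntegrableOn (hgi.sub (integrable_const c))) fun ψ h1 h2 h3 => ?_
    -- `ψ - I η` has mean zero, so it is the derivative of a test function and is orthogonal to `g`.
    -- Hence `∫ ψ g = I c`.
    set I := ∫ t in (0 : ℝ)..T, ψ t with hI
    have ht : IsTestFunction (Ioo 0 T) (fun t => ψ t - I * η t) :=
      ⟨h1.sub (contDiff_const.mul hη.1), h2.sub hη.2.1.mul_left,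
        (tsupport_sub _ _).trans (union_subset h3
          ((tsupport_mul_subset_right (f := fun _ => I) (g := η)).trans hη.2.2))⟩
    have h0 : ∫ t in (0 : ℝ)..T, (ψ t - I * η t) = 0 := by
      rw [intervalIntegral.integral_sub (h1.continuous.intervalIntegrable _ _)
        ((hη.1.continuous.const_mul I).intervalIntegrable _ _),
        intervalIntegral.integral_const_mul, hη1]
      simp [hI]
    have h4 := hg0 _ (isTestFunction_primitive hT ht h0)
    have hd : deriv (fun t => ∫ s in (0 : ℝ)..t, (ψ s - I * η s)) = fun t => ψ t - I * η t :=
      funext fun t => (intervalIntegral.integral_hasDerivAt_right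
        (ht.1.continuous.intervalIntegrable _ _)
        (ht.1.continuous.stronglyMeasurableAtFilter _ _) ht.1.continuous.continuousAt).deriv
    simp only [hd, sub_mul, mul_assoc] at h4
    rw [integral_sub (hmul h1.continuous hgi) ((hmul hη.1.continuous hgi).const_mul I),
      integral_const_mul] at h4
    have h5 : ∫ t, ψ t • (g t - c) = ∫ t, ψ t • (g t - c) ∂(tmeas T) := by
      refine (setIntegral_eq_integral_of_forall_compl_eq_zero fun x hx => ?_).symm
      have : ψ x = 0 := by
        by_contra h
        exact hx (h3 (subset_tsupport _ h))
      rw [this, zero_smul]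
    rw [h5]
    simp only [smul_eq_mul, mul_sub]
    rw [integral_sub (hmul h1.continuous hgi) (hmul h1.continuous (integrable_const c)),
      integral_mul_const, integral_tmeas hT.le ψ]
    linarith
  refine ⟨c, ?_⟩
  filter_upwards [(ae_restrict_iff' measurableSet_Ioo).2 key] with t ht
  simp only [hg] at ht
  linarith

/-! ### Multiplication operators and bounded coefficients. -/

section Multiplication

variable {X E : Type*} [MeasurableSpace X] {ν : Measure X} [NormedAddCommGroup E]
  [InnerProductSpace ℝ E]

/-- Multiplication by a bounded function on `L²(ν; E)`. -/
noncomputable def mulOp (ν : Measure X) (E : Type*) [NormedAddCommGroup E] [InnerProductSpace ℝ E]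
    (k : X → ℝ) : Lp E 2 ν →L[ℝ] Lp E 2 ν :=
  open Classical in
  if h : MemLp k ∞ ν then (ContinuousLinearMap.lsmul ℝ ℝ (E := E)).holderL ν ∞ 2 2 h.toLp else 0

theorem mulOp_coeFn {k : X → ℝ} (hk : MemLp k ∞ ν) (Y : Lp E 2 ν) :
    mulOp ν E k Y =ᵐ[ν] fun x => k x • Y x := by
  rw [mulOp, dif_pos hk]
  change (ContinuousLinearMap.lsmul ℝ ℝ (E := E)).holder 2 hk.toLp Y =ᵐ[ν] _
  filter_upwards [(ContinuousLinearMap.lsmul ℝ ℝ (E := E)).coeFn_holder (r := 2) hk.toLp Y,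
    hk.coeFn_toLp] with x h1 h2
  rw [h1, h2, ContinuousLinearMap.lsmul_apply]

theorem mulOp_norm_le {k : X → ℝ} (hk : MemLp k ∞ ν) {R : ℝ} (hR : 0 ≤ R) (hkR : ∀ x, |k x| ≤ R) :
    ‖mulOp ν E k‖ ≤ R := by
  refine ContinuousLinearMap.opNorm_le_bound _ hR fun Y => ?_
  refine Lp.norm_le_mul_norm_of_ae_le_mul ?_
  filter_upwards [mulOp_coeFn hk Y] with x hx
  rw [hx, norm_smul]
  gcongr
  exact hkR x

theorem inner_mulOp {k : X → ℝ} (hk : MemLp k ∞ ν) (Y Z : Lp E 2 ν) :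
    inner ℝ (mulOp ν E k Y) Z = ∫ x, k x * inner ℝ (Y x) (Z x) ∂ν := by
  rw [L2.inner_def]
  refine integral_congr_ae ?_
  filter_upwards [mulOp_coeFn hk Y] with x hx
  rw [hx, real_inner_smul_left]

theorem mulOp_symm {k : X → ℝ} (hk : MemLp k ∞ ν) (Y Z : Lp E 2 ν) :
    inner ℝ (mulOp ν E k Y) Z = inner ℝ Y (mulOp ν E k Z) := by
  rw [real_inner_comm (mulOp ν E k Z) Y, inner_mulOp hk, inner_mulOp hk]
  simp only [real_inner_comm]

end Multiplication

/-- A weakly measurable family of self-adjoint operators maps measurable curves to measurable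
curves. -/
theorem aestronglyMeasurable_apply {α X : Type*} [MeasurableSpace α] {ν : Measure α}
    [NormedAddCommGroup X] [InnerProductSpace ℝ X] [CompleteSpace X]
    [TopologicalSpace.SeparableSpace X] {B : α → X →L[ℝ] X}
    (hB : ∀ y z, AEStronglyMeasurable (fun t => inner ℝ (B t y) z) ν)
    (hsym : ∀ t y z, inner ℝ (B t y) z = inner ℝ y (B t z)) {z : α → X}
    (hz : AEStronglyMeasurable z ν) : AEStronglyMeasurable (fun t => B t (z t)) ν := by
  -- Pettis is applied twice: self-adjointness turns `(y, B z)` into `(B y, z)`, where `B y` is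
  -- already measurable.
  refine aestronglyMeasurable_of_inner fun y => ?_
  have h : AEStronglyMeasurable (fun t => B t y) ν := aestronglyMeasurable_of_inner fun w => by
    simpa only [real_inner_comm] using hB y w
  simpa only [hsym] using h.inner (𝕜 := ℝ) hz

/-- A measurable function bounded everywhere by `R`. -/
structure IsNiceCoeff {Y : Type*} [MeasurableSpace Y] (c : Y → ℝ) (R : ℝ) : Prop where
  measurable : Measurable c
  nonneg : 0 ≤ R
  bound : ∀ p, |c p| ≤ R

theorem IsNiceCoeff.memLp_slice {X : Type*} [MeasurableSpace X] {ν : Measure X}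
    {c : X × ℝ → ℝ} {R : ℝ} (hc : IsNiceCoeff c R) (t : ℝ) : MemLp (fun x => c (x, t)) ∞ ν :=
  memLp_top_of_bound (hc.measurable.comp measurable_prodMk_right).aestronglyMeasurable R
    (Eventually.of_forall fun _ => hc.bound _)

/-- A measurable representative is truncated at the essential supremum. The bound then holds at
every point, hence on every time slice, although a single slice is a null set. -/
theorem exists_isNiceCoeff {Y : Type*} [MeasurableSpace Y] {ν : Measure Y} {g : Y → ℝ}
    (hg : MemLp g (∞ : ℝ≥0∞) ν) : ∃ c R, IsNiceCoeff c R ∧ g =ᵐ[ν] c := by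
  have hfin : eLpNormEssSup g ν < (∞ : ℝ≥0∞) := by simpa using hg.2
  set R := (eLpNormEssSup g ν).toReal with hR
  have hR0 : 0 ≤ R := ENNReal.toReal_nonneg
  refine ⟨fun p => max (-R) (min R (hg.1.mk g p)), R, ⟨?_, hR0, fun p => ?_⟩, ?_⟩
  · exact measurable_const.max (measurable_const.min hg.1.stronglyMeasurable_mk.measurable)
  · exact abs_le.2 ⟨le_max_left _ _, max_le (by linarith) (min_le_left _ _)⟩
  · filter_upwards [hg.1.ae_eq_mk, ae_le_eLpNormEssSup (f := g) (μ := ν)] with p h1 h2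
    have h3 : ‖g p‖ ≤ R := by
      rw [hR, ← toReal_enorm]
      exact ENNReal.toReal_mono hfin.ne h2
    rw [Real.norm_eq_abs, abs_le] at h3
    rw [← h1, min_eq_right h3.2, max_eq_right h3.1]

/-! ### Time slices of coefficients and their weak time derivative. -/

section Coefficients

variable {d : ℕ} {Θ : Set (Space d)} {T : ℝ}

theorem restrict_prod_eq (Θ : Set (Space d)) (T : ℝ) :
    (volume : Measure (Space d × ℝ)).restrict (Θ ×ˢ Ioo 0 T)
      = (volume.restrict Θ).prod (tmeas T) := by
  rw [Measure.prod_restrict]; rfl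

theorem ae_slice {p : Space d × ℝ → Prop}
    (h : ∀ᵐ z ∂(volume : Measure (Space d × ℝ)).restrict (Θ ×ˢ Ioo 0 T), p z) :
    ∀ᵐ t ∂(tmeas T), ∀ᵐ x ∂(volume.restrict Θ), p (x, t) := by
  rw [restrict_prod_eq] at h
  exact Measure.ae_ae_of_ae_prod
    ((Measure.measurePreserving_swap (μ := tmeas T)
      (ν := volume.restrict Θ)).quasiMeasurePreserving.ae h)

variable {E : Type*} [NormedAddCommGroup E] [InnerProductSpace ℝ E]

/-- Multiplication by the time slice of a coefficient. -/
noncomputable abbrev coeffOp (Θ : Set (Space d)) (E : Type*) [NormedAddCommGroup E]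
    [InnerProductSpace ℝ E] (c : Space d × ℝ → ℝ) (t : ℝ) :
    Lp E 2 (volume.restrict Θ) →L[ℝ] Lp E 2 (volume.restrict Θ) :=
  mulOp (volume.restrict Θ) E (fun x => c (x, t))

theorem aestronglyMeasurable_integral_coeff {c : Space d × ℝ → ℝ} (hc : Measurable c)
    {F : Space d → ℝ} (hF : AEStronglyMeasurable F (volume.restrict Θ)) :
    AEStronglyMeasurable (fun t => ∫ x in Θ, c (x, t) * F x) (tmeas T) := by
  have h : AEStronglyMeasurable (fun p : ℝ × Space d => c (p.2, p.1) * F p.2)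
      ((tmeas T).prod (volume.restrict Θ)) :=
    (hc.comp measurable_swap).aestronglyMeasurable.mul hF.comp_snd
  exact h.integral_prod_right'

theorem aestronglyMeasurable_coeffOp_inner {c : Space d × ℝ → ℝ} {R : ℝ} (hc : IsNiceCoeff c R)
    (Y Z : Lp E 2 (volume.restrict Θ)) :
    AEStronglyMeasurable (fun t => inner ℝ (coeffOp Θ E c t Y) Z) (tmeas T) := by
  simp only [inner_mulOp (hc.memLp_slice _)]
  exact aestronglyMeasurable_integral_coeff hc.measurable
    ((Lp.aestronglyMeasurable Y).inner (Lp.aestronglyMeasurable Z))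

theorem isTestFunction_prod {ξ : Space d → ℝ} {φ : ℝ → ℝ} (hξ : IsTestFunction Θ ξ)
    (hφ : IsTestFunction (Ioo 0 T) φ) :
    IsTestFunction (Θ ×ˢ Ioo 0 T) (fun p : Space d × ℝ => ξ p.1 * φ p.2) := by
  have hsupp : Function.support (fun p : Space d × ℝ => ξ p.1 * φ p.2) ⊆ tsupport ξ ×ˢ tsupport φ :=
    fun p hp => ⟨subset_tsupport _ (left_ne_zero_of_mul hp), subset_tsupport _
      (right_ne_zero_of_mul hp)⟩
  have hK : IsCompact (tsupport ξ ×ˢ tsupport φ) := hξ.2.1.isCompact.prod hφ.2.1.isCompact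
  exact ⟨(hξ.1.comp contDiff_fst).mul (hφ.1.comp contDiff_snd),
    HasCompactSupport.of_support_subset_isCompact hK hsupp,
    (closure_minimal hsupp hK.isClosed).trans (prod_mono hξ.2.2 hφ.2.2)⟩

theorem fderiv_prod_time {ξ : Space d → ℝ} {φ : ℝ → ℝ} (hξ : ContDiff ℝ ∞ ξ) (hφ : ContDiff ℝ ∞ φ)
    (p : Space d × ℝ) :
    fderiv ℝ (fun p : Space d × ℝ => ξ p.1 * φ p.2) p (0, 1) = ξ p.1 * deriv φ p.2 := by
  have h1 : HasFDerivAt (fun p : Space d × ℝ => ξ p.1)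
      ((fderiv ℝ ξ p.1).comp (ContinuousLinearMap.fst ℝ (Space d) ℝ)) p :=
    (hξ.differentiable (by simp) p.1).hasFDerivAt.comp p hasFDerivAt_fst
  have h2 : HasFDerivAt (fun p : Space d × ℝ => φ p.2)
      ((fderiv ℝ φ p.2).comp (ContinuousLinearMap.snd ℝ (Space d) ℝ)) p :=
    (hφ.differentiable (by simp) p.2).hasFDerivAt.comp p hasFDerivAt_snd
  have h3 : HasFDerivAt (fun p : Space d × ℝ => ξ p.1 * φ p.2) _ p := h1.mul h2
  rw [h3.fderiv]
  simp

variable [IsFiniteMeasure (volume.restrict Θ)]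

/-- The weak time derivative of `t ↦ ∫ β(x,t) F(x) dx`, for `F ∈ L¹(Θ)`. -/
theorem integral_deriv_mul_integral_coeff (hΘ : IsOpen Θ) {β b β' b' : Space d × ℝ → ℝ} {R S : ℝ}
    (hβ : IsNiceCoeff β' R) (hb : IsNiceCoeff b' S)
    (hββ' : β =ᵐ[(volume : Measure (Space d × ℝ)).restrict (Θ ×ˢ Ioo 0 T)] β')
    (hbb' : b =ᵐ[(volume : Measure (Space d × ℝ)).restrict (Θ ×ˢ Ioo 0 T)] b')
    (hw : IsWeakPartialTime Θ T β b) {F : Space d → ℝ} (hF : Integrable F (volume.restrict Θ))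
    {φ : ℝ → ℝ} (hφ : IsTestFunction (Ioo 0 T) φ) :
    ∫ t, deriv φ t * (∫ x in Θ, β' (x, t) * F x) ∂(tmeas T)
      = -∫ t, φ t * (∫ x in Θ, b' (x, t) * F x) ∂(tmeas T) := by
  have hφ' : Continuous (deriv φ) := hφ.1.continuous_deriv (by simp)
  obtain ⟨C₁, hC₁⟩ := (isCompact_Icc (a := (0 : ℝ)) (b := T)).exists_bound_of_continuousOn
    hφ.1.continuous.continuousOn
  obtain ⟨C₂, hC₂⟩ := (isCompact_Icc (a := (0 : ℝ)) (b := T)).exists_bound_of_continuousOn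
    hφ'.continuousOn
  have hφi : Integrable φ (tmeas T) :=
    Integrable.of_bound hφ.1.continuous.aestronglyMeasurable C₁ (by
      filter_upwards [ae_restrict_mem measurableSet_Ioo] with t ht
      exact hC₁ t (Ioo_subset_Icc_self ht))
  have hφi' : Integrable (deriv φ) (tmeas T) :=
    Integrable.of_bound hφ'.aestronglyMeasurable C₂ (by
      filter_upwards [ae_restrict_mem measurableSet_Ioo] with t ht
      exact hC₂ t (Ioo_subset_Icc_self ht))
  have hint : ∀ {c : Space d × ℝ → ℝ} {K : ℝ} {G : Space d → ℝ} {ψ : ℝ → ℝ}, IsNiceCoeff c K →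
      Integrable G (volume.restrict Θ) → Integrable ψ (tmeas T) →
      Integrable (fun p : Space d × ℝ => c p * (G p.1 * ψ p.2))
        ((volume.restrict Θ).prod (tmeas T)) := fun hc hG hψ =>
    (hG.mul_prod hψ).bdd_mul hc.measurable.aestronglyMeasurable (Eventually.of_forall hc.bound)
  -- `m x` is the defect of the weak identity at fixed `x`. Products `ξ(x) φ(t)` show that `m`
  -- vanishes almost everywhere in `Θ`, after which any integrable `F` may replace `ξ`.
  set m : Space d → ℝ := fun x => ∫ t, (β' (x, t) * deriv φ t + b' (x, t) * φ t) ∂(tmeas T) with hm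
  have hG : ∀ {G : Space d → ℝ}, Integrable G (volume.restrict Θ) →
      Integrable (fun p : Space d × ℝ =>
        β' p * (G p.1 * deriv φ p.2) + b' p * (G p.1 * φ p.2))
        ((volume.restrict Θ).prod (tmeas T)) := fun hGi =>
    (hint hβ hGi hφi').add (hint hb hGi hφi)
  have hGm : ∀ {G : Space d → ℝ}, Integrable G (volume.restrict Θ) →
      ∫ x in Θ, G x * m x = ∫ p, (β' p * (G p.1 * deriv φ p.2) + b' p * (G p.1 * φ p.2))
        ∂((volume.restrict Θ).prod (tmeas T)) := fun {G} hGi => by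
    rw [integral_prod _ (hG hGi)]
    refine integral_congr_ae (Eventually.of_forall fun x => ?_)
    simp only [hm]
    rw [← integral_const_mul]
    refine integral_congr_ae (Eventually.of_forall fun t => ?_)
    simp only
    ring
  have hmi : Integrable m (volume.restrict Θ) := by
    -- The constant `1` is integrable because `Θ` has finite measure.
    have := (hG (integrable_const (1 : ℝ))).integral_prod_left
    simpa only [one_mul] using this
  have hm0 : ∀ᵐ x ∂(volume : Measure (Space d)), x ∈ Θ → m x = 0 := by
    refine hΘ.ae_eq_zero_of_integral_contDiff_smul_eq_zero
      (IntegrableOn.locallyIntegrableOn hmi) fun ξ h1 h2 h3 => ?_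
    have hξi : Integrable ξ (volume.restrict Θ) :=
      (h1.continuous.integrable_of_hasCompactSupport h2).restrict
    have e1 : ∫ x, ξ x • m x = ∫ x in Θ, ξ x * m x :=
      (setIntegral_eq_integral_of_forall_compl_eq_zero fun x hx => by
        have : ξ x = 0 := by
          by_contra h
          exact hx (h3 (subset_tsupport _ h))
        rw [this, zero_smul]).symm
    have hweak := hw _ (isTestFunction_prod ⟨h1, h2, h3⟩ hφ)
    rw [e1, hGm hξi, integral_add (hint hβ hξi hφi') (hint hb hξi hφi), ← restrict_prod_eq]
    have e2 : ∫ p in Θ ×ˢ Ioo 0 T, β p * fderiv ℝ (fun p : Space d × ℝ => ξ p.1 * φ p.2) p (0, 1)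
        = ∫ p in Θ ×ˢ Ioo 0 T, β' p * (ξ p.1 * deriv φ p.2) := integral_congr_ae (by
      filter_upwards [hββ'] with p hp
      rw [hp, fderiv_prod_time h1 hφ.1])
    have e3 : ∫ p in Θ ×ˢ Ioo 0 T, b p * (ξ p.1 * φ p.2)
        = ∫ p in Θ ×ˢ Ioo 0 T, b' p * (ξ p.1 * φ p.2) := integral_congr_ae (by
      filter_upwards [hbb'] with p hp
      rw [hp])
    rw [← e2, ← e3, hweak]
    ring
  have hz : ∫ x in Θ, F x * m x = 0 := by
    refine integral_eq_zero_of_ae ?_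
    filter_upwards [(ae_restrict_iff' hΘ.measurableSet).2 hm0] with x hx
    rw [hx, mul_zero]; rfl
  rw [hGm hF, integral_add (hint hβ hF hφi') (hint hb hF hφi),
    integral_prod_symm _ (hint hβ hF hφi'), integral_prod_symm _ (hint hb hF hφi)] at hz
  have e : ∀ (c : Space d × ℝ → ℝ) (ψ : ℝ → ℝ), ∫ t, ψ t * (∫ x in Θ, c (x, t) * F x) ∂(tmeas T)
      = ∫ t, (∫ x in Θ, c (x, t) * (F x * ψ t)) ∂(tmeas T) := fun c ψ => by
    refine integral_congr_ae (Eventually.of_forall fun t => ?_)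
    simp only
    rw [← integral_const_mul]
    refine integral_congr_ae (Eventually.of_forall fun x => ?_)
    simp only
    ring
  rw [e, e]
  linarith

end Coefficients

/-! ### The elliptic form and the superposition operator. -/

theorem secondCountable_Lp_two {d : ℕ} (Θ : Set (Space d)) (E : Type*) [NormedAddCommGroup E]
    [TopologicalSpace.SeparableSpace E] :
    SecondCountableTopology (Lp E 2 (volume.restrict Θ)) :=
  haveI : Fact ((2 : ℝ≥0∞) ≠ ⊤) := ⟨by norm_num⟩
  inferInstance

instance {d : ℕ} (Θ : Set (Space d)) : SecondCountableTopology (L2 Θ) :=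
  secondCountable_Lp_two Θ ℝ

instance {d : ℕ} (Θ : Set (Space d)) : SecondCountableTopology (L2Vec Θ) :=
  secondCountable_Lp_two Θ (Space d)

instance {d : ℕ} (Θ : Set (Space d)) : TopologicalSpace.SeparableSpace (H10 Θ) := inferInstance

instance {d : ℕ} (Θ : Set (Space d)) : CompleteSpace (H10 Θ) :=
  (testGraph Θ).isClosed_topologicalClosure.completeSpace_coe

theorem H10.norm_sq {d : ℕ} {Θ : Set (Space d)} (u : H10 Θ) :
    ‖u‖ ^ 2 = ‖toL2 u‖ ^ 2 + ‖grad u‖ ^ 2 :=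
  WithLp.prod_norm_sq_eq_of_L2 (u : WithLp 2 (L2 Θ × L2Vec Θ))

/-- The elliptic part of the equation, shifted by `β₀`, is represented by a Lipschitz continuous
coercive family of operators. -/
theorem exists_waveForm {d : ℕ} {Θ : Set (Space d)} (hΘ : IsOpen Θ)
    [IsFiniteMeasure (volume.restrict Θ)] {V : Type*} [NormedAddCommGroup V]
    [InnerProductSpace ℝ V] [CompleteSpace V] [TopologicalSpace.SeparableSpace V]
    (G : V →L[ℝ] L2Vec Θ) (J : V →L[ℝ] L2 Θ) (hGJ : ∀ u, ‖u‖ ^ 2 = ‖J u‖ ^ 2 + ‖G u‖ ^ 2)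
    {T : ℝ} (hT : 0 < T) {β : Space d × ℝ → ℝ}
    (hβ : IsBddCoeff Θ T β) {β₀ : ℝ} (hβ₀ : 0 < β₀)
    (hβpos : ∀ᵐ p ∂volume.restrict (Θ ×ˢ Ioo 0 T), β₀ ≤ β p)
    (hβt : ∃ b, IsBddCoeff Θ T b ∧ IsWeakPartialTime Θ T β b) :
    ∃ (M : ℝ) (A : ℝ → V →L[ℝ] V), IsEvolutionForm T M β₀ A ∧
      ∀ᵐ t ∂(tmeas T), ∀ u χ : V, inner ℝ (A t u) χ
        = (∫ x in Θ, β (x, t) * inner ℝ (G u x) (G χ x))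
          + β₀ * inner ℝ (J u) (J χ) := by
  obtain ⟨b, hb, hw⟩ := hβt
  obtain ⟨β', R, hβ', hββ'⟩ := exists_isNiceCoeff hβ
  obtain ⟨b', S, hb', hbb'⟩ := exists_isNiceCoeff hb
  -- The shift supplies the `L²` part of the norm, so coercivity with constant `β₀` needs no
  -- Poincaré inequality.
  set a : ℝ → V →L[ℝ] V := fun t =>
    (G.adjoint.comp (coeffOp Θ (Space d) β' t)).comp G + β₀ • J.adjoint.comp J with ha
  set bb : ℝ → V →L[ℝ] V := fun t =>
    (G.adjoint.comp (coeffOp Θ (Space d) b' t)).comp G with hbdef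
  have hbi : ∀ t u w, inner ℝ (bb t u) w = inner ℝ (coeffOp Θ (Space d) b' t (G u)) (G w) :=
    fun t u w => by
      simp only [hbdef, ContinuousLinearMap.comp_apply, ContinuousLinearMap.adjoint_inner_left]
  have hai : ∀ t u w, inner ℝ (a t u) w = inner ℝ (coeffOp Θ (Space d) β' t (G u)) (G w)
      + β₀ * inner ℝ (J u) (J w) := fun t u w => by
    simp only [ha, add_apply, smul_apply, ContinuousLinearMap.comp_apply, inner_add_left,
      real_inner_smul_left, ContinuousLinearMap.adjoint_inner_left]
  have hnorm : ∀ {c K}, IsNiceCoeff c K → ∀ t,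
      ‖(G.adjoint.comp (coeffOp Θ (Space d) c t)).comp G‖ ≤ ‖G.adjoint‖ * K * ‖G‖ := fun hc t => by
    refine (ContinuousLinearMap.opNorm_comp_le _ _).trans ?_
    gcongr
    refine (ContinuousLinearMap.opNorm_comp_le _ _).trans ?_
    gcongr
    exact mulOp_norm_le (hc.memLp_slice t) hc.nonneg fun x => hc.bound _
  have hFi : ∀ u w : V, Integrable (fun x => inner ℝ (G u x) (G w x)) (volume.restrict Θ) :=
    fun u w => integrable_inner_of_memLp (Lp.memLp _) (Lp.memLp _)
  have hci : ∀ {c K}, IsNiceCoeff c K → ∀ u w : V, Integrable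
      (fun t => ∫ x in Θ, c (x, t) * inner ℝ (G u x) (G w x)) (tmeas T) := fun {c K} hc u w => by
    refine Integrable.of_bound (aestronglyMeasurable_integral_coeff hc.measurable
      (hFi u w).aestronglyMeasurable) (K * ∫ x in Θ, ‖inner ℝ (G u x) (G w x)‖)
      (Eventually.of_forall fun t => ?_)
    rw [← integral_const_mul]
    refine norm_integral_le_of_norm_le ((hFi u w).norm.const_mul K)
      (Eventually.of_forall fun x => ?_)
    rw [norm_mul]
    gcongr
    exact hc.bound _
  obtain ⟨A, hA, haA⟩ := exists_evolutionForm (T := T) (M := ‖G.adjoint‖ * S * ‖G‖)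
    (C := ‖G.adjoint‖ * R * ‖G‖ + ‖β₀ • J.adjoint.comp J‖) (α := β₀) hT hβ₀
    (by have := hb'.nonneg; positivity) (a := a) (b := bb)
    (fun t => (norm_add_le _ _).trans (by gcongr; exact hnorm hβ' t)) (hnorm hb')
    (fun u w => by
      simp only [hbi]
      exact aestronglyMeasurable_coeffOp_inner hb' _ _)
    (fun t u w => by
      rw [real_inner_comm (a t w) u, hai, hai, mulOp_symm (hβ'.memLp_slice t),
        real_inner_comm (G u), real_inner_comm (J u)])
    (fun t u w => by
      rw [real_inner_comm (bb t w) u, hbi, hbi, mulOp_symm (hb'.memLp_slice t),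
        real_inner_comm (G u)])
    (fun u w => by
      obtain ⟨c, hc⟩ := exists_eq_const_add_integral hT (hci hβ' u w) (hci hb' u w)
        fun φ hφ => integral_deriv_mul_integral_coeff hΘ hβ' hb' hββ' hbb' hw (hFi u w) hφ
      refine ⟨c + β₀ * inner ℝ (J u) (J w), ?_⟩
      filter_upwards [hc] with t ht
      simp only [hai, hbi, inner_mulOp (hβ'.memLp_slice _), inner_mulOp (hb'.memLp_slice _)]
      rw [ht]
      ring)
    (fun u => by
      filter_upwards [ae_slice hββ', ae_slice hβpos] with t h1 h2
      rw [hai, inner_mulOp (hβ'.memLp_slice _), hGJ, mul_add, real_inner_self_eq_norm_sq]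
      have h3 : β₀ * ‖G u‖ ^ 2 ≤ ∫ x in Θ, β' (x, t) * inner ℝ (G u x) (G u x) := by
        rw [← real_inner_self_eq_norm_sq, L2.inner_def, ← integral_const_mul]
        refine integral_mono_ae ((hFi u u).const_mul β₀) ((hFi u u).bdd_mul
          (hβ'.memLp_slice t).1 (Eventually.of_forall fun x => hβ'.bound (x, t))) ?_
        filter_upwards [h1, h2] with x h1 h2
        rw [← h1]
        have : 0 ≤ inner ℝ (G u x) (G u x) := real_inner_self_nonneg
        gcongr
      rw [add_comm]
      gcongr)
  refine ⟨_, A, hA, ?_⟩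
  filter_upwards [haA, ae_slice hββ'] with t h1 h2 u χ
  rw [← h1, hai, inner_mulOp (hβ'.memLp_slice _)]
  congr 1
  refine integral_congr_ae ?_
  filter_upwards [h2] with x hx
  rw [hx]

/-- The superposition operator of a Lipschitz continuous function on `L²`. -/
theorem exists_superposition {X : Type*} [MeasurableSpace X] {ν : Measure X} [IsFiniteMeasure ν]
    {f : ℝ → ℝ} {L : ℝ} (hL : 0 ≤ L) (hf : ∀ z₁ z₂ : ℝ, |f z₁ - f z₂| ≤ L * |z₁ - z₂|) :
    ∃ N : Lp ℝ 2 ν → Lp ℝ 2 ν, (∀ w z, ‖N w - N z‖ ≤ L * ‖w - z‖) ∧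
      ∀ w, N w =ᵐ[ν] fun x => f (w x) := by
  -- `f 0` is subtracted so that composition preserves `L²`; it is added back as a constant, which
  -- is square integrable for a finite measure.
  have hlip : LipschitzWith ⟨L, hL⟩ (fun z => f z - f 0) :=
    LipschitzWith.of_dist_le_mul fun x y => by
      rw [Real.dist_eq, Real.dist_eq, sub_sub_sub_cancel_right]
      exact hf x y
  have h0 : (fun z => f z - f 0) 0 = 0 := sub_self _
  have hc : MemLp (fun _ : X => f 0) 2 ν := memLp_const _
  refine ⟨fun w => hlip.compLp h0 w + hc.toLp, fun w z => ?_, fun w => ?_⟩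
  · rw [add_sub_add_right_eq_sub]
    exact hlip.norm_compLp_sub_le h0 w z
  · filter_upwards [Lp.coeFn_add (hlip.compLp h0 w) hc.toLp, hlip.coeFn_compLp h0 w,
      hc.coeFn_toLp] with x h1 h2 h3
    rw [h1, Pi.add_apply, h2, h3]
    simp

/-! ### The variable-order Caputo derivative. -/

section Caputo

variable {Y : Type*} [NormedAddCommGroup Y] [NormedSpace ℝ Y]

theorem intervalIntegrable_caputo_kernel {t γ : ℝ} (hγ : γ < 1) :
    IntervalIntegrable (fun r => (t - r) ^ (-γ)) volume 0 t := by
  have h := (intervalIntegral.intervalIntegrable_rpow' (a := t) (b := 0)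
    (show -1 < -γ by linarith)).comp_sub_left t
  simpa using h

/-- The integral is `t^{1-γ} / (1-γ)`. Keeping `γ` away from `1` makes the bound uniform in the
order, hence in time when the order varies. -/
theorem integral_caputo_kernel_le {t γ T γ' : ℝ} (ht : 0 < t) (htT : t ≤ T) (hγ0 : 0 ≤ γ)
    (hγ : γ ≤ γ') (hγ' : γ' < 1) :
    ∫ r in (0 : ℝ)..t, (t - r) ^ (-γ) ≤ max 1 T / (1 - γ') := by
  rw [intervalIntegral.integral_comp_sub_left (fun x => x ^ (-γ)) t, sub_self, sub_zero,
    integral_rpow (Or.inl (by linarith)), Real.zero_rpow (by linarith), sub_zero]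
  have h1 : t ^ (-γ + 1) ≤ max 1 T := by
    rcases le_total t 1 with h | h
    · exact (Real.rpow_le_one ht.le h (by linarith)).trans (le_max_left _ _)
    · calc t ^ (-γ + 1) ≤ t ^ (1 : ℝ) := Real.rpow_le_rpow_of_exponent_le h (by linarith)
        _ = t := Real.rpow_one t
        _ ≤ _ := htT.trans (le_max_right _ _)
  exact div_le_div₀ (by positivity) h1 (by linarith) (by linarith)

theorem intervalIntegrable_caputo {T : ℝ} {v : ℝ → Y} (hv : MemLp v ∞ (tmeas T)) {t γ : ℝ}
    (ht : t ∈ Icc 0 T) (hγ : γ < 1) :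
    IntervalIntegrable (fun r => (t - r) ^ (-γ) • v r) volume 0 t := by
  have hk := intervalIntegrable_caputo_kernel (t := t) hγ
  rw [intervalIntegrable_iff_integrableOn_Ioo_of_le ht.1] at hk ⊢
  have hv' : MemLp v ∞ (volume.restrict (Ioo 0 t)) :=
    hv.mono_measure (Measure.restrict_mono (Ioo_subset_Ioo_right ht.2) le_rfl)
  exact Integrable.smul_of_top_left hk hv'

theorem norm_caputo_integral_le {v : ℝ → Y} {t γ T γ' m : ℝ} (ht : 0 < t) (htT : t ≤ T)
    (hγ0 : 0 ≤ γ) (hγ : γ ≤ γ') (hγ' : γ' < 1) (hm : 0 ≤ m)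
    (hv : ∀ᵐ s ∂(tmeas t), ‖v s‖ ≤ m) :
    ‖∫ r in (0 : ℝ)..t, (t - r) ^ (-γ) • v r‖ ≤ max 1 T / (1 - γ') * m := by
  have hk := intervalIntegrable_caputo_kernel (t := t) (hγ.trans_lt hγ')
  calc _ ≤ ∫ r in (0 : ℝ)..t, (t - r) ^ (-γ) * m := by
        refine intervalIntegral.norm_integral_le_of_norm_le ht.le ?_ (hk.mul_const m)
        rw [← ae_restrict_iff' measurableSet_Ioc, ← restrict_Ioo_eq_restrict_Ioc]
        filter_upwards [hv, ae_restrict_mem measurableSet_Ioo] with r hr hr'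
        rw [norm_smul, Real.norm_of_nonneg (Real.rpow_nonneg (by linarith [hr'.2]) _)]
        have := Real.rpow_nonneg (show 0 ≤ t - r by linarith [hr'.2]) (-γ)
        gcongr
    _ = (∫ r in (0 : ℝ)..t, (t - r) ^ (-γ)) * m := intervalIntegral.integral_mul_const _ _
    _ ≤ _ := by gcongr; exact integral_caputo_kernel_le ht htT hγ0 hγ hγ'

theorem continuousOn_inv_Gamma {γ' : ℝ} (hγ' : γ' < 1) :
    ContinuousOn (fun x => (Real.Gamma (1 - x))⁻¹) (Icc 0 γ') := by
  intro x hx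
  have hpos : 0 < 1 - x := by linarith [hx.2]
  have h1 : ContinuousAt Real.Gamma (1 - x) :=
    (Real.differentiableAt_Gamma fun m => by
      have : (0 : ℝ) ≤ m := m.cast_nonneg
      intro h
      linarith).continuousAt
  have h2 : ContinuousAt (fun x : ℝ => Real.Gamma (1 - x)) x :=
    ContinuousAt.comp (f := fun x : ℝ => 1 - x) h1 (by fun_prop)
  exact (h2.inv₀ (Real.Gamma_pos_of_pos hpos).ne').continuousWithinAt

theorem aestronglyMeasurable_caputo {T : ℝ} {v : ℝ → Y}
    (hv : AEStronglyMeasurable v (tmeas T)) {μ : ℝ → ℝ} {γ' : ℝ} (hγ' : γ' < 1)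
    (hμm : AEMeasurable μ (tmeas T)) (hμ : ∀ᵐ t ∂(tmeas T), 0 ≤ μ t ∧ μ t ≤ γ') :
    AEStronglyMeasurable (caputo μ v) (tmeas T) := by
  rcases lt_or_ge γ' 0 with hneg | hnn
  · have h0 : ∀ᵐ t ∂(tmeas T), False := by
      filter_upwards [hμ] with t ht
      linarith [ht.1, ht.2]
    have : tmeas T = 0 := by
      rw [← ae_eq_bot]
      exact Filter.eventually_false_iff_eq_bot.1 h0
    rw [this]
    exact aestronglyMeasurable_zero_measure _
  have hG : AEStronglyMeasurable (fun t => (Real.Gamma (1 - μ t))⁻¹) (tmeas T) := by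
    -- Clamping the order to `[0,γ']` keeps the Gamma argument positive, so the reciprocal is
    -- continuous on all of `ℝ`.
    have hc : Continuous (fun x : ℝ => (Real.Gamma (1 - projIcc 0 γ' hnn x))⁻¹) :=
      ((continuousOn_inv_Gamma hγ').comp_continuous
        (continuous_subtype_val.comp continuous_projIcc) fun x => (projIcc 0 γ' hnn x).2)
    refine (hc.measurable.comp_aemeasurable hμm).aestronglyMeasurable.congr ?_
    filter_upwards [hμ] with t ht
    simp only [Function.comp_apply, projIcc_of_mem hnn ht]
  refine hG.smul ?_
  -- Extended by zero off `r < t`, the integrand is jointly measurable, and the memory term is a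
  -- parameter integral over a fixed interval.
  have hk : AEStronglyMeasurable (fun p : ℝ × ℝ => {p : ℝ × ℝ | p.2 < p.1}.indicator
      (fun p => (p.1 - p.2) ^ (-μ p.1) • v p.2) p) ((tmeas T).prod (tmeas T)) := by
    refine AEStronglyMeasurable.indicator ?_ (measurableSet_lt measurable_snd measurable_fst)
    refine AEStronglyMeasurable.smul ?_ hv.comp_snd
    exact ((measurable_fst.sub measurable_snd).aemeasurable.pow
      (hμm.comp_fst.neg)).aestronglyMeasurable
  refine hk.integral_prod_right'.congr ?_
  filter_upwards [ae_restrict_mem measurableSet_Ioo] with t ht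
  have e : ∀ r, {p : ℝ × ℝ | p.2 < p.1}.indicator (fun p => (p.1 - p.2) ^ (-μ p.1) • v p.2) (t, r)
      = (Iio t).indicator (fun r => (t - r) ^ (-μ t) • v r) r := fun r => by
    simp [indicator_apply]
  simp only [e]
  rw [setIntegral_indicator measurableSet_Iio, Ioo_inter_Iio, min_eq_right ht.2.le,
    intervalIntegral.integral_of_le ht.1.le, integral_Ioc_eq_integral_Ioo]

/-- The Caputo derivative is a causal Lipschitz map of the velocity. -/
theorem exists_caputo_lipschitz {T : ℝ} {μ : ℝ → ℝ} {γ' : ℝ} (hγ' : γ' < 1)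
    (hμ : ∀ᵐ t ∂(tmeas T), 0 ≤ μ t ∧ μ t ≤ γ') :
    ∃ L : ℝ, 0 ≤ L ∧ ∀ᵐ t ∂(tmeas T), ∀ v₁ v₂ : ℝ → Y, MemLp v₁ ∞ (tmeas T) →
      MemLp v₂ ∞ (tmeas T) → ∀ m : ℝ, 0 ≤ m → (∀ᵐ s ∂(tmeas t), ‖v₁ s - v₂ s‖ ≤ m) →
      ‖caputo μ v₁ t - caputo μ v₂ t‖ ≤ L * m := by
  obtain ⟨C, hC⟩ := isCompact_Icc.exists_bound_of_continuousOn (continuousOn_inv_Gamma hγ')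
  refine ⟨|C| * (max 1 T / (1 - γ')), ?_, ?_⟩
  · have : 0 < 1 - γ' := by linarith
    positivity
  filter_upwards [hμ, ae_restrict_mem measurableSet_Ioo] with t hμt ht v₁ v₂ h₁ h₂ m hm hle
  have htT := Ioo_subset_Icc_self ht
  have hlt := hμt.2.trans_lt hγ'
  rw [caputo, caputo, ← smul_sub, ← intervalIntegral.integral_sub
    (intervalIntegrable_caputo h₁ htT hlt) (intervalIntegrable_caputo h₂ htT hlt), norm_smul,
    mul_assoc]
  simp only [← smul_sub]
  gcongr
  · exact (hC _ hμt).trans (le_abs_self C)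
  · exact norm_caputo_integral_le ht.1 ht.2.le hμt.1 hμt.2 hγ' hm hle

end Caputo

/-! ### From integrated equations to weak derivatives, and the right-hand side. -/

theorem isWeakTimeDeriv_of_prim {Y : Type*} [NormedAddCommGroup Y] [NormedSpace ℝ Y]
    [CompleteSpace Y] {T : ℝ} (hT : 0 ≤ T) {u w : ℝ → Y} (p : Y) (hw : Integrable w (tmeas T))
    (hu : u =ᵐ[tmeas T] prim p w) : IsWeakTimeDeriv T u w := by
  have hwi : IntervalIntegrable w volume 0 T := by
    rwa [intervalIntegrable_iff_integrableOn_Ioo_of_le hT]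
  have hpi : Integrable (prim p w) (tmeas T) :=
    (memLp_of_continuousOn 1 (continuousOn_prim hT p hwi)).integrable le_rfl
  refine ⟨hpi.congr hu.symm, hw, fun φ hφ => ?_⟩
  have hzero : φ 0 = 0 ∧ φ T = 0 := by
    constructor
    · by_contra h
      exact absurd (hφ.2.2 (subset_tsupport φ h)).1 (lt_irrefl _)
    · by_contra h
      exact absurd (hφ.2.2 (subset_tsupport φ h)).2 (lt_irrefl _)
  have h := integral_deriv_smul_primitive hT (hφ.1.of_le (by simp)) hzero.1 hzero.2 p hwi
  rw [← integral_tmeas hT, ← integral_tmeas hT] at h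
  refine Eq.trans (integral_congr_ae ?_) h
  filter_upwards [hu] with t ht
  rw [ht, prim]

theorem lipschitzOnWith_prim {Y : Type*} [NormedAddCommGroup Y] [NormedSpace ℝ Y] {T : ℝ} (p : Y)
    {w : ℝ → Y} (hw : MemLp w ∞ (tmeas T)) : ∃ K : ℝ≥0, LipschitzOnWith K (prim p w) (Icc 0 T) := by
  have hfin : eLpNormEssSup w (tmeas T) < (∞ : ℝ≥0∞) := by simpa using hw.2
  obtain ⟨K, hb⟩ : ∃ K : ℝ≥0, ∀ᵐ r ∂(tmeas T), ‖w r‖ ≤ K := by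
    refine ⟨(eLpNormEssSup w (tmeas T)).toNNReal, ?_⟩
    filter_upwards [ae_le_eLpNormEssSup (f := w) (μ := tmeas T)] with r hr
    rw [← toReal_enorm]
    exact ENNReal.toReal_mono hfin.ne hr
  refine ⟨K, LipschitzOnWith.of_dist_le_mul fun s hs t ht => ?_⟩
  have hi : ∀ t ∈ Icc 0 T, IntervalIntegrable w volume 0 t := fun t ht =>
    intervalIntegrable_of_memLp le_top hw ht
  rw [dist_eq_norm, prim, prim, add_sub_add_left_eq_sub,
    intervalIntegral.integral_interval_sub_left (hi s hs) (hi t ht), Real.dist_eq]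
  refine intervalIntegral.norm_integral_le_of_norm_le_const_ae ?_
  rw [tmeas, restrict_Ioo_eq_restrict_Ioc, ae_restrict_iff' measurableSet_Ioc] at hb
  filter_upwards [hb] with r hr hr'
  refine hr ?_
  rcases le_total t s with h | h
  · rw [uIoc_of_le h] at hr'; exact ⟨ht.1.trans_lt hr'.1, hr'.2.trans hs.2⟩
  · rw [uIoc_of_ge h] at hr'; exact ⟨hs.1.trans_lt hr'.1, hr'.2.trans ht.2⟩

section Abstract

variable {H : Type*} [NormedAddCommGroup H] [InnerProductSpace ℝ H]

/-- The right-hand side `N(Φ) + β₀ Φ + Q - ρ ∂ₜ^μ Φ`, in terms of the velocity `v = ∂ₜΦ`. -/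
noncomputable def rightHandSide (μ : ℝ → ℝ) (B : ℝ → H →L[ℝ] H) (Q : ℝ → H) (N : H → H) (β₀ : ℝ)
    (p : H) (v : ℝ → H) (t : ℝ) : H :=
  N (prim p v t) + β₀ • prim p v t + Q t - B t (caputo μ v t)

variable {T μbar R L β₀ : ℝ} {μ : ℝ → ℝ} {B : ℝ → H →L[ℝ] H} {Q : ℝ → H} {N : H → H}

theorem memLp_rightHandSide [CompleteSpace H] [TopologicalSpace.SeparableSpace H] (hT : 0 ≤ T)
    (hμbar : μbar < 1) (hμm : AEMeasurable μ (tmeas T))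
    (hμ : ∀ᵐ t ∂(tmeas T), 0 ≤ μ t ∧ μ t ≤ μbar)
    (hR : 0 ≤ R) (hB : ∀ t, ‖B t‖ ≤ R)
    (hBm : ∀ y z, AEStronglyMeasurable (fun t => inner ℝ (B t y) z) (tmeas T))
    (hBs : ∀ t y z, inner ℝ (B t y) z = inner ℝ y (B t z))
    (hQ : ContinuousOn Q (Icc 0 T)) (hN : Continuous N) (p : H)
    {v : ℝ → H} (hv : MemLp v ∞ (tmeas T)) :
    MemLp (rightHandSide μ B Q N β₀ p v) 2 (tmeas T) := by
  obtain ⟨Lc, -, hcap⟩ := exists_caputo_lipschitz (Y := H) hμbar hμ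
  have hP : ContinuousOn (prim p v) (Icc 0 T) :=
    continuousOn_prim hT p (intervalIntegrable_of_memLp le_top hv ⟨hT, le_rfl⟩)
  refine MemLp.sub (memLp_of_continuousOn 2
    (((hN.comp_continuousOn hP).add (hP.const_smul β₀)).add hQ)) ?_
  have hmeas : AEStronglyMeasurable (fun t => B t (caputo μ v t)) (tmeas T) :=
    aestronglyMeasurable_apply hBm hBs (aestronglyMeasurable_caputo hv.1 hμbar hμm hμ)
  have hfin : eLpNormEssSup v (tmeas T) < (∞ : ℝ≥0∞) := by simpa using hv.2
  obtain ⟨m, hm, hvm⟩ : ∃ m : ℝ, 0 ≤ m ∧ ∀ᵐ r ∂(tmeas T), ‖v r‖ ≤ m := by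
    refine ⟨(eLpNormEssSup v (tmeas T)).toReal, ENNReal.toReal_nonneg, ?_⟩
    filter_upwards [ae_le_eLpNormEssSup (f := v) (μ := tmeas T)] with r hr
    rw [← toReal_enorm]
    exact ENNReal.toReal_mono hfin.ne hr
  refine MemLp.of_bound hmeas (R * (Lc * m)) ?_
  filter_upwards [hcap, ae_restrict_mem measurableSet_Ioo] with t ht ht'
  have h0 : caputo μ (0 : ℝ → H) t = 0 := by simp [caputo]
  -- Comparison with the zero velocity turns the Lipschitz estimate into a bound.
  have h1 := ht v 0 hv MemLp.zero m hm (by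
    simp only [Pi.zero_apply, sub_zero]
    exact ae_restrict_of_ae_restrict_of_subset (Ioo_subset_Ioo_right ht'.2.le) hvm)
  rw [h0, sub_zero] at h1
  exact (ContinuousLinearMap.le_of_opNorm_le _ (hB t) _).trans
    (mul_le_mul_of_nonneg_left h1 hR)

/-- The right-hand side is a causal Lipschitz map of the velocity. -/
theorem exists_rightHandSide_lipschitz (hμbar : μbar < 1)
    (hμ : ∀ᵐ t ∂(tmeas T), 0 ≤ μ t ∧ μ t ≤ μbar)
    (hR : 0 ≤ R) (hB : ∀ t, ‖B t‖ ≤ R) (hL : 0 ≤ L)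
    (hN : ∀ w z, ‖N w - N z‖ ≤ L * ‖w - z‖) (hβ₀ : 0 ≤ β₀) (p : H) :
    ∃ K : ℝ, ∀ v₁ v₂, MemLp v₁ ∞ (tmeas T) → MemLp v₂ ∞ (tmeas T) →
      ∀ᵐ t ∂(tmeas T), ∀ m : ℝ, 0 ≤ m → (∀ᵐ s ∂(tmeas t), ‖v₁ s - v₂ s‖ ≤ m) →
      ‖rightHandSide μ B Q N β₀ p v₁ t - rightHandSide μ B Q N β₀ p v₂ t‖ ≤ K * m := by
  obtain ⟨Lc, -, hcap⟩ := exists_caputo_lipschitz (Y := H) hμbar hμ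
  -- The terms depending on `Φ` gain `T` because `Φ` is a primitive of the velocity; the memory term
  -- carries the bound `R` of the coefficient.
  refine ⟨(L + β₀) * T + R * Lc, fun v₁ v₂ h₁ h₂ => ?_⟩
  filter_upwards [hcap, ae_restrict_mem measurableSet_Ioo] with t ht ht' m hm hle
  have htT := Ioo_subset_Icc_self ht'
  have h1 := ht v₁ v₂ h₁ h₂ m hm hle
  have h2 : ‖prim p v₁ t - prim p v₂ t‖ ≤ T * m := by
    rw [prim_sub (intervalIntegrable_of_memLp le_top h₁ htT)
      (intervalIntegrable_of_memLp le_top h₂ htT), sub_self, prim, zero_add]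
    have h3 : ‖∫ s in (0 : ℝ)..t, (v₁ s - v₂ s)‖ ≤ m * |t - 0| := by
      refine intervalIntegral.norm_integral_le_of_norm_le_const_ae ?_
      rw [tmeas, restrict_Ioo_eq_restrict_Ioc, ae_restrict_iff' measurableSet_Ioc] at hle
      rwa [uIoc_of_le htT.1]
    rw [sub_zero, abs_of_nonneg htT.1] at h3
    nlinarith [htT.2]
  have e : rightHandSide μ B Q N β₀ p v₁ t - rightHandSide μ B Q N β₀ p v₂ t
      = (N (prim p v₁ t) - N (prim p v₂ t)) + β₀ • (prim p v₁ t - prim p v₂ t)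
        - B t (caputo μ v₁ t - caputo μ v₂ t) := by
    rw [map_sub, smul_sub, rightHandSide, rightHandSide]; abel
  rw [e]
  calc _ ≤ ‖N (prim p v₁ t) - N (prim p v₂ t)‖ + ‖β₀ • (prim p v₁ t - prim p v₂ t)‖
        + ‖B t (caputo μ v₁ t - caputo μ v₂ t)‖ :=
        (norm_sub_le _ _).trans (by gcongr; exact norm_add_le _ _)
    _ ≤ L * (T * m) + β₀ * (T * m) + R * (Lc * m) := by
        gcongr
        · exact (hN _ _).trans (by gcongr)
        · rw [norm_smul, Real.norm_of_nonneg hβ₀]; gcongr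
        · exact (ContinuousLinearMap.le_of_opNorm_le _ (hB t) _).trans
            (mul_le_mul_of_nonneg_left h1 hR)
    _ = _ := by ring

/-- Solutions in integrated form have the initial values and the weak time derivatives that the
equation asserts. -/
theorem IsLinSol.weak {V : Type*} [NormedAddCommGroup V] [InnerProductSpace ℝ V]
    [CompleteSpace V] [CompleteSpace H] {M α : ℝ} (hT : 0 ≤ T)
    {A : ℝ → V →L[ℝ] V} (hA : IsEvolutionForm T M α A) {j : V →L[ℝ] H} {p : V} {ψ : H} {g : ℝ → H}
    (hg : MemLp g 2 (tmeas T)) {v : ℝ → H} {u : ℝ → V} (h : IsLinSol T A j p ψ g v u) :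
    ∃ F : ℝ → StrongDual ℝ V, MemLp F 2 (tmeas T) ∧
      IsWeakTimeDeriv T (fun t => (innerSL ℝ (v t)).comp j) F ∧
      (∃ W : ℝ → StrongDual ℝ V, ContinuousOn W (Icc 0 T) ∧
        (∀ᵐ t ∂(tmeas T), W t = (innerSL ℝ (v t)).comp j) ∧ W 0 = (innerSL ℝ ψ).comp j) ∧
      ∀ t χ, F t χ = inner ℝ (g t) (j χ) - inner ℝ (A t (u t)) χ := by
  set ι : V →L[ℝ] StrongDual ℝ V := innerSL ℝ with hι
  -- Under the Riesz map of `V`, the embedding of `H` into `V*` is `j*`. This turns the integrated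
  -- equation in `V` into one in the dual.
  have hdual : ∀ w : H, (innerSL ℝ w).comp j = ι (j.adjoint w) := fun w => by
    ext χ
    exact (ContinuousLinearMap.adjoint_inner_left j χ w).symm
  set G : ℝ → V := fun t => j.adjoint (g t) - A t (u t) with hG
  have hGm : MemLp G 2 (tmeas T) :=
    (j.adjoint.comp_memLp' hg).sub (hA.memLp_apply (memLp_two_of_top h.memLp_u))
  have hιG : MemLp (fun t => ι (G t)) 2 (tmeas T) := ι.comp_memLp' hGm
  have hW : ∀ᵐ t ∂(tmeas T),
      (innerSL ℝ (v t)).comp j = prim ((innerSL ℝ ψ).comp j) (fun t => ι (G t)) t := by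
    filter_upwards [h.eq_v, ae_restrict_mem measurableSet_Ioo] with t ht ht'
    rw [hdual, ht, hdual, prim_map ι _
      (intervalIntegrable_of_memLp one_le_two hGm (Ioo_subset_Icc_self ht'))]
  refine ⟨fun t => ι (G t), hιG, isWeakTimeDeriv_of_prim hT _ (hιG.integrable one_le_two) hW,
    ⟨prim ((innerSL ℝ ψ).comp j) (fun t => ι (G t)), continuousOn_prim hT _
      (intervalIntegrable_of_memLp one_le_two hιG ⟨hT, le_rfl⟩),
      hW.mono fun t ht => ht.symm, prim_zero _ _⟩, fun t χ => ?_⟩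
  change inner ℝ (j.adjoint (g t) - A t (u t)) χ = _
  rw [inner_sub_left, ContinuousLinearMap.adjoint_inner_left]

end Abstract

/-! ### Return to the concrete equation. -/

theorem L2.inner_eq_integral {d : ℕ} {Θ : Set (Space d)} (w z : L2 Θ) :
    inner ℝ w z = ∫ x in Θ, w x * z x := by
  rw [MeasureTheory.L2.inner_def]
  refine integral_congr_ae (Eventually.of_forall fun x => ?_)
  simp [mul_comm]

/-- The right-hand side tested with a function of `L²(Θ)`. -/
theorem inner_rightHandSide {d : ℕ} {Θ : Set (Space d)} {R β₀ : ℝ} {μ : ℝ → ℝ}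
    {ρ ρ' : Space d × ℝ → ℝ} (hρ' : IsNiceCoeff ρ' R) {t : ℝ}
    (hρρ' : ∀ᵐ x ∂(volume.restrict Θ), ρ (x, t) = ρ' (x, t)) {f : ℝ → ℝ} {N : L2 Θ → L2 Θ}
    (hNf : ∀ w, N w =ᵐ[volume.restrict Θ] fun x => f (w x)) (Q : ℝ → L2 Θ) (p : L2 Θ)
    (v : ℝ → L2 Θ) (z : L2 Θ) :
    inner ℝ (rightHandSide μ (coeffOp Θ ℝ ρ') Q N β₀ p v t) z
      = (∫ x in Θ, f (prim p v t x) * z x) + (∫ x in Θ, Q t x * z x)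
        - (∫ x in Θ, ρ (x, t) * caputo μ v t x * z x) + β₀ * inner ℝ (prim p v t) z := by
  have e3 : inner ℝ (N (prim p v t)) z = ∫ x in Θ, f (prim p v t x) * z x := by
    rw [L2.inner_eq_integral]
    refine integral_congr_ae ?_
    filter_upwards [hNf (prim p v t)] with x hx
    rw [hx]
  have e4 : inner ℝ (coeffOp Θ ℝ ρ' t (caputo μ v t)) z
      = ∫ x in Θ, ρ (x, t) * caputo μ v t x * z x := by
    rw [inner_mulOp (hρ'.memLp_slice t)]
    refine integral_congr_ae ?_
    filter_upwards [hρρ'] with x hx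
    rw [hx, mul_assoc, mul_comm (caputo μ v t x)]
    rfl
  rw [rightHandSide, inner_sub_left, inner_add_left, inner_add_left, real_inner_smul_left, e3, e4,
    L2.inner_eq_integral (Q t)]
  ring

end VOWave

theorem theorem4p1 {d : ℕ} (hd : 1 ≤ d) (Θ : Set (VOWave.Space d)) (hΘo : IsOpen Θ)
    (hΘb : Bornology.IsBounded Θ) (T : ℝ) (hT : 0 < T)
    (μ : ℝ → ℝ) (μbar : ℝ) (hμbar : μbar < 1)
    (hμm : AEMeasurable μ (volume.restrict (Ioo 0 T)))
    (hμ : ∀ᵐ t ∂volume.restrict (Ioo 0 T), 0 ≤ μ t ∧ μ t ≤ μbar)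
    (ρ β : VOWave.Space d × ℝ → ℝ)
    (hρ : VOWave.IsBddCoeff Θ T ρ) (hβ : VOWave.IsBddCoeff Θ T β)
    (Q : ℝ → VOWave.L2 Θ) (hQ : ContinuousOn Q (Icc 0 T))
    (f : ℝ → ℝ) (Lf : ℝ) (hLf : 0 < Lf) (hf : ∀ z₁ z₂ : ℝ, |f z₁ - f z₂| ≤ Lf * |z₁ - z₂|)
    (β₀ : ℝ) (hβ₀ : 0 < β₀)
    (hβpos : ∀ᵐ p ∂volume.restrict (Θ ×ˢ Ioo 0 T), β₀ ≤ β p)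
    (hβt : ∃ b : VOWave.Space d × ℝ → ℝ,
      VOWave.IsBddCoeff Θ T b ∧ VOWave.IsWeakPartialTime Θ T β b)
    (hρpos : ∀ᵐ p ∂volume.restrict (Θ ×ˢ Ioo 0 T), 0 ≤ ρ p)
    (Φ₀ : VOWave.H10 Θ) (Ψ₀ : VOWave.L2 Θ) :
    ∃ (Φ : ℝ → VOWave.L2 Θ) (U : ℝ → VOWave.H10 Θ) (Φt : ℝ → VOWave.L2 Θ)
      (Φtt : ℝ → VOWave.H10Dual Θ),
      VOWave.IsWeakSolution Θ T μ ρ β f Q Φ₀ Ψ₀ Φ U Φt Φtt ∧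
      (∃ K : ℝ≥0, LipschitzOnWith K Φ (Icc 0 T)) ∧
      MemLp U ∞ (volume.restrict (Ioo 0 T)) ∧
      MemLp Φt ∞ (volume.restrict (Ioo 0 T)) ∧
      MemLp Φtt 2 (volume.restrict (Ioo 0 T)) := by
  have hfinm : IsFiniteMeasure (volume.restrict Θ) :=
    ⟨by rw [Measure.restrict_apply_univ]; exact hΘb.measure_lt_top⟩
  obtain ⟨M, A, hA, hAeq⟩ := VOWave.exists_waveForm hΘo (VOWave.grad (Θ := Θ))
    (VOWave.toL2 (Θ := Θ)) VOWave.H10.norm_sq hT hβ hβ₀ hβpos hβt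
  obtain ⟨N, hN, hNf⟩ := VOWave.exists_superposition (ν := volume.restrict Θ) hLf.le hf
  obtain ⟨ρ', R, hρ', hρρ'⟩ := VOWave.exists_isNiceCoeff hρ
  have hBn : ∀ t, ‖VOWave.coeffOp Θ ℝ ρ' t‖ ≤ R := fun t =>
    VOWave.mulOp_norm_le (hρ'.memLp_slice t) hρ'.nonneg fun x => hρ'.bound _
  have hNc : Continuous N := (LipschitzWith.of_dist_le_mul (K := ⟨Lf, hLf.le⟩) fun w z => by
    rw [dist_eq_norm, dist_eq_norm]; exact hN w z).continuous
  have hmem : ∀ v, MemLp v ∞ (VOWave.tmeas T) → MemLp (VOWave.rightHandSide μ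
      (VOWave.coeffOp Θ ℝ ρ') Q N β₀ (VOWave.toL2 Φ₀) v) 2 (VOWave.tmeas T) := fun v hv =>
    VOWave.memLp_rightHandSide hT.le hμbar hμm hμ hρ'.nonneg hBn
      (VOWave.aestronglyMeasurable_coeffOp_inner hρ')
      (fun t => VOWave.mulOp_symm (hρ'.memLp_slice t)) hQ hNc _ hv
  obtain ⟨K, hK⟩ := VOWave.exists_rightHandSide_lipschitz (Q := Q) hμbar hμ hρ'.nonneg hBn hLf.le
    hN hβ₀.le (VOWave.toL2 Φ₀)
  obtain ⟨v, u, h⟩ := VOWave.exists_isLinSol_nonlinear hT.le hA VOWave.toL2 Φ₀ Ψ₀ hmem hK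
  obtain ⟨F, hFm, hFd, hFW, hF⟩ := h.weak hT.le hA (hmem v h.memLp_v)
  have hv2 := VOWave.memLp_two_of_top h.memLp_v
  refine ⟨VOWave.prim (VOWave.toL2 Φ₀) v, u, v, F, ?_,
    VOWave.lipschitzOnWith_prim _ h.memLp_v, h.memLp_u, h.memLp_v, hFm⟩
  refine
    { continuousOn := VOWave.continuousOn_prim hT.le _
        (VOWave.intervalIntegrable_of_memLp one_le_two hv2 ⟨hT.le, le_rfl⟩)
      toL2_eq := h.eq_u
      memLp := VOWave.memLp_two_of_top h.memLp_u
      memLp_deriv := hv2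
      isDeriv := VOWave.isWeakTimeDeriv_of_prim hT.le _ (hv2.integrable one_le_two)
        (EventuallyEq.refl _ _)
      memLp_deriv2 := hFm
      isDeriv2 := hFd
      init := VOWave.prim_zero _ _
      init_deriv := hFW
      integrable_caputo := ?_
      equation := fun χ => ?_ }
  · filter_upwards [hμ, ae_restrict_mem measurableSet_Ioo] with t ht ht'
    exact VOWave.intervalIntegrable_caputo h.memLp_v (Ioo_subset_Icc_self ht')
      (ht.2.trans_lt hμbar)
  · filter_upwards [hAeq, VOWave.ae_slice hρρ', h.eq_u] with t h1 h2 h3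
    -- By `h3` the shift in the form and the shift in the right-hand side are the same `β₀ (Φ, χ)`
    -- and cancel.
    rw [hF t χ, VOWave.inner_rightHandSide hρ' h2 hNf, h1, h3]
    ring
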